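/- Let $u_1\ge u_2\ge u_3\ge\dots$ be a non-increasing sequence of numbers in $[0,1]$ such that $$u_n\cdot\frac{n^{1/2}}{\log^{3+\delta}n}\to\infty\ \text{ for some }\delta>0,\qquad\text{and}\qquad u_n\to 0 .$$ Let $U_1,U_2,\dots$ be independent $\{0,1\}$-valued random variables on a probability space $(\Omega,P)$ with $P(U_n=1)=u_n$, and let $R^\omega=\{n\ge 1: U_n(\omega)=1\}$ be the set of selected integers. Then for $P$-almost every $\omega$ the set $R^\omega=\{r_1<r_2<r_3<\dots\}$ is infinite and has the following property: for every probability space $(X,\Sigma,\mu)$, every measurable measure-preserving (not necessarily invertible) transformation $T:X\to X$, and all bounded measurable (real- or complex-valued) functions $F_1,F_2$ on $X$, $$\lim_{N\to\infty}\frac1N\sum_{1\le n<N}F_1(T^nx)\,F_2(T^{r_n}x)=\overline F_1(x)\,\overline F_2(x)\qquad\text{for $\mu$-a.e. }x\in X,$$ where $\overline F_i$ is the orthogonal projection of $F_i$ in $L^2(\mu)$ to the closed subspace of $T$-invariant functions $\{f\in L^2(\mu): f\circ T=f\}$. (The exceptional null set of $\omega$ depends neither on the system nor on $F_1,F_2$.)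 -/

import Mathlib

open MeasureTheory Filter Topology

noncomputable section

/-- The random set of positive integers `n` that are selected, i.e. those with `U n ω = 1`. -/
def selectedSet {Ω : Type*} (U : ℕ → Ω → ℕ) (ω : Ω) : Set ℕ :=
  {n | 1 ≤ n ∧ U n ω = 1}

/-- `selectedSeq U ω n` is the `n`-th smallest selected integer, for `n = 1, 2, 3, …`
(`Nat.nth` counts from `0`); the value at `n = 0` is not used. -/
def selectedSeq {Ω : Type*} (U : ℕ → Ω → ℕ) (ω : Ω) (n : ℕ) : ℕ :=
  Nat.nth (fun m => m ∈ selectedSet U ω) (n - 1)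

/-- The operator `f ↦ f ∘ T` on `L²(μ)`. -/
def koopman (𝕜 : Type*) [RCLike 𝕜] {X : Type*} [MeasurableSpace X] {μ : Measure X}
    {T : X → X} (hT : MeasurePreserving T μ μ) : Lp 𝕜 2 μ →L[𝕜] Lp 𝕜 2 μ :=
  (Lp.compMeasurePreservingₗᵢ 𝕜 T hT).toContinuousLinearMap

/-- The orthogonal projection of a square-integrable function `F` to the closed subspace
`{f | f ∘ T = f}` of `L²(μ)`. -/
def invariantProj {𝕜 : Type*} [RCLike 𝕜] {X : Type*} [MeasurableSpace X] {μ : Measure X}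
    {T : X → X} (hT : MeasurePreserving T μ μ) {F : X → 𝕜} (hF : MemLp F 2 μ) : Lp 𝕜 2 μ :=
  ((koopman 𝕜 hT).eqLocus (1 : Lp 𝕜 2 μ →L[𝕜] Lp 𝕜 2 μ)).starProjection (hF.toLp F)

end

/-!
Put `p i = u (i + 1)`, `y i = U (i + 1) ω`, `S i = ∑ j < i, y j` and `W M = ∑ i < M, p i`. For
almost every `ω` one has `S M ~ W M`, so the averages along the selected integers are governed
by the sums `∑ i < M, y i F₁ (T ^ (S i) x) F₂ (T ^ i x)`, to be compared with `W M`.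

For the centred part `∑ (y i - p i) F₁ (T ^ (S i) x) F₂ (T ^ i x)`, cut the integers into blocks
on which `i` and `p i` are constant up to factors `exp (1 / K)`. The van der Corput inequality
bounds its mean square over a block by correlations between the terms `i` and `i + d`. Sorting
them by `e = S (i + d) - S i` turns each correlation into `⟪∑ c i V ^ (i - S i) g, h⟫` for the
isometry `V f = f ∘ T` of `L²(μ)`, with coefficients `c i` depending only on `y`. Such a sum is
controlled by the values of the polynomial `∑ c i z ^ (i - S i)` at finitely many roots of unity
`z`; these are predictable combinations of centred selectors, so an exponential inequality
bounds all of them at once for almost every `ω`, whatever the system is. The growth of `u` makes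
the block mean squares summable relative to `W ^ 2`, and letting `K` tend to infinity fills in
the sums between block ends.

In the remaining sum `∑ p i F₁ (T ^ (S i) x) F₂ (T ^ i x)` the coefficients
`p i F₁ (T ^ (S i) x)` have variation `o(W)`, because `p` tends to `0` and `S` moves only at
selected integers. Hence `F₂` may be replaced by its moving averages along the orbit, which the
mean ergodic theorem and the maximal inequality show to be close, on average, to the projection
of `F₂`. The factor `F₁` alone is treated by the same comparison, run from the full orbit average
back to the weighted one.
-/

/-! ### An exponential inequality for predictable combinations of independent selectors -/

/-- A sequence of functions of a `0`-`1` sequence `y` is predictable when the `i`-th one depends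
only on the values `y j` with `j < i`. -/
def Predictable {α : Type*} (c : ℕ → (ℕ → ℕ) → α) : Prop :=
  ∀ i, DependsOn (c i) (Set.Iio i)

/-- A family of independent `{0,1}`-valued random variables with success probabilities `p`. -/
structure IsSelector {Ω : Type*} [MeasurableSpace Ω] (P : Measure Ω) (Y : ℕ → Ω → ℕ)
    (p : ℕ → ℝ) : Prop where
  measurable : ∀ i, Measurable (Y i)
  zero_or_one : ∀ i ω, Y i ω = 0 ∨ Y i ω = 1
  nonneg : ∀ i, 0 ≤ p i
  prob : ∀ i, P {ω | Y i ω = 1} = ENNReal.ofReal (p i)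
  indep : ProbabilityTheory.iIndepFun Y P

/-- The sum of the centred variables `y i - p i` with coefficients `c i`, minus a bound for its
conditional variance; its exponential is a supermartingale. -/
noncomputable def compensatedSum (p : ℕ → ℝ) (c : ℕ → (ℕ → ℕ) → ℝ) (n : ℕ) (y : ℕ → ℕ) : ℝ :=
  ∑ i ∈ Finset.range n, (c i y * (y i - p i) - c i y ^ 2 * p i)

theorem Predictable.dependsOn_compensatedSum {p : ℕ → ℝ} {c : ℕ → (ℕ → ℕ) → ℝ}
    (hc : Predictable c) (n : ℕ) : DependsOn (compensatedSum p c n) (Set.Iio n) := by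
  intro y y' h
  refine Finset.sum_congr rfl fun i hi => ?_
  have hin : i < n := Finset.mem_range.mp hi
  rw [h i hin, hc i fun j hj => h j (lt_trans hj hin)]

theorem exp_le_one_add_add_sq {x : ℝ} (hx : |x| ≤ 1) : Real.exp x ≤ 1 + x + x ^ 2 := by
  linarith [(abs_le.mp (Real.abs_exp_sub_one_sub_id_le hx)).2]

theorem two_point_exp_le {p c : ℝ} (hp0 : 0 ≤ p) (hp1 : p ≤ 1) (hc : |c| ≤ 1) :
    p * Real.exp (c * (1 - p) - c ^ 2 * p) + (1 - p) * Real.exp (c * (0 - p) - c ^ 2 * p) ≤ 1 := by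
  have hq0 : 0 ≤ 1 - p := sub_nonneg.mpr hp1
  have h1 : Real.exp (c * (1 - p)) ≤ 1 + c * (1 - p) + (c * (1 - p)) ^ 2 := by
    refine exp_le_one_add_add_sq ?_
    rw [abs_mul, abs_of_nonneg hq0]
    exact mul_le_one₀ hc hq0 (by linarith)
  have h0 : Real.exp (c * (0 - p)) ≤ 1 + c * (0 - p) + (c * (0 - p)) ^ 2 := by
    refine exp_le_one_add_add_sq ?_
    rw [abs_mul, zero_sub, abs_neg, abs_of_nonneg hp0]
    exact mul_le_one₀ hc hp0 hp1
  rw [Real.exp_sub, Real.exp_sub, mul_div_assoc', mul_div_assoc', ← add_div,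
    div_le_one (Real.exp_pos _)]
  calc p * Real.exp (c * (1 - p)) + (1 - p) * Real.exp (c * (0 - p))
      ≤ p * (1 + c * (1 - p) + (c * (1 - p)) ^ 2)
        + (1 - p) * (1 + c * (0 - p) + (c * (0 - p)) ^ 2) := by gcongr
    _ = c ^ 2 * p + 1 - c ^ 2 * p ^ 2 := by ring
    _ ≤ c ^ 2 * p + 1 := sub_le_self _ (by positivity)
    _ ≤ Real.exp (c ^ 2 * p) := Real.add_one_le_exp _

namespace IsSelector

variable {Ω : Type*} [MeasurableSpace Ω] {P : Measure Ω} {Y : ℕ → Ω → ℕ} {p : ℕ → ℝ}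

theorem le_one [IsProbabilityMeasure P] (hY : IsSelector P Y p) (i : ℕ) : p i ≤ 1 := by
  rw [← ENNReal.ofReal_le_one, ← hY.prob i]
  exact prob_le_one

theorem measure_zero [IsProbabilityMeasure P] (hY : IsSelector P Y p) (i : ℕ) :
    P {ω | Y i ω = 0} = ENNReal.ofReal (1 - p i) := by
  have h : {ω | Y i ω = 0} = {ω | Y i ω = 1}ᶜ := by
    ext ω
    rcases hY.zero_or_one i ω with h | h <;> simp [h]
  have hm : MeasurableSet {ω | Y i ω = 1} := hY.measurable i (measurableSet_singleton 1)
  rw [h, prob_compl_eq_one_sub hm, hY.prob,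
    ENNReal.ofReal_sub _ (hY.nonneg i), ENNReal.ofReal_one]

theorem exists_restrict_of_dependsOn {α : Type*} {n : ℕ} {G : (ℕ → ℕ) → α}
    (hG : DependsOn G (Set.Iio n)) :
    ∃ g : (Finset.range n → ℕ) → α, ∀ y, G y = g (fun j => y j) := by
  refine ⟨fun v => G fun j => if h : j ∈ Finset.range n then v ⟨j, h⟩ else 0, fun y => hG ?_⟩
  intro j hj
  simp [Set.mem_Iio.mp hj]

theorem measurable_of_dependsOn (hY : IsSelector P Y p) {α : Type*} [MeasurableSpace α] {n : ℕ}
    {G : (ℕ → ℕ) → α} (hG : DependsOn G (Set.Iio n)) : Measurable fun ω => G fun i => Y i ω := by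
  obtain ⟨g, hg⟩ := exists_restrict_of_dependsOn hG
  simp_rw [hg]
  exact (Measurable.of_discrete (f := g)).comp (measurable_pi_lambda _ fun j => hY.measurable j)

theorem setLIntegral_of_dependsOn (hY : IsSelector P Y p) {n : ℕ} {G : (ℕ → ℕ) → ENNReal}
    (hG : DependsOn G (Set.Iio n)) (k : ℕ) :
    ∫⁻ ω in {ω | Y n ω = k}, G (fun i => Y i ω) ∂P
      = P {ω | Y n ω = k} * ∫⁻ ω, G (fun i => Y i ω) ∂P := by
  have hk : MeasurableSet {ω | Y n ω = k} := hY.measurable n (measurableSet_singleton k)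
  obtain ⟨g, hg⟩ := exists_restrict_of_dependsOn hG
  have hind : ProbabilityTheory.IndepFun ({ω | Y n ω = k}.indicator (1 : Ω → ENNReal))
      (fun ω => G fun i => Y i ω) P := by
    simp_rw [hg]
    exact (hY.indep.indepFun_finset {n} (Finset.range n) (by simp) hY.measurable).comp
      (φ := fun v : ({n} : Finset ℕ) → ℕ =>
        ({k} : Set ℕ).indicator (1 : ℕ → ENNReal) (v ⟨n, by simp⟩))
      Measurable.of_discrete Measurable.of_discrete
  rw [← lintegral_indicator hk, ← lintegral_indicator_one hk,
    ← ProbabilityTheory.lintegral_mul_eq_lintegral_mul_lintegral_of_indepFun''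
      (measurable_one.indicator hk).aemeasurable
      (hY.measurable_of_dependsOn hG).aemeasurable hind]
  simp only [Set.indicator, Pi.one_apply, ite_mul, one_mul, zero_mul]

theorem lintegral_eq_two_point [IsProbabilityMeasure P] (hY : IsSelector P Y p) {n : ℕ}
    {G : ℕ → (ℕ → ℕ) → ENNReal} (hG : ∀ k, DependsOn (G k) (Set.Iio n)) :
    ∫⁻ ω, G (Y n ω) (fun i => Y i ω) ∂P
      = ∫⁻ ω, (ENNReal.ofReal (p n) * G 1 (fun i => Y i ω)
        + ENNReal.ofReal (1 - p n) * G 0 (fun i => Y i ω)) ∂P := by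
  have h1 : MeasurableSet {ω | Y n ω = 1} := hY.measurable n (measurableSet_singleton 1)
  have h0 : MeasurableSet {ω | Y n ω = 0} := hY.measurable n (measurableSet_singleton 0)
  have hcompl : {ω | Y n ω = 1}ᶜ = {ω | Y n ω = 0} := by
    ext ω
    rcases hY.zero_or_one n ω with h | h <;> simp [h]
  have mG : ∀ k, Measurable fun ω => G k fun i => Y i ω := fun k =>
    hY.measurable_of_dependsOn (hG k)
  rw [← lintegral_add_compl _ h1, hcompl,
    setLIntegral_congr_fun h1 fun ω (hω : Y n ω = 1) => by rw [hω],
    setLIntegral_congr_fun h0 fun ω (hω : Y n ω = 0) => by rw [hω],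
    hY.setLIntegral_of_dependsOn (hG 1), hY.setLIntegral_of_dependsOn (hG 0), hY.prob,
    hY.measure_zero, lintegral_add_left ((mG 1).const_mul _), lintegral_const_mul _ (mG 1),
    lintegral_const_mul _ (mG 0)]

theorem lintegral_exp_compensatedSum_le_one [IsProbabilityMeasure P] (hY : IsSelector P Y p)
    {c : ℕ → (ℕ → ℕ) → ℝ} (hc : Predictable c) (hc1 : ∀ i ω, |c i fun j => Y j ω| ≤ 1) (n : ℕ) :
    ∫⁻ ω, ENNReal.ofReal (Real.exp (compensatedSum p c n fun j => Y j ω)) ∂P ≤ 1 := by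
  induction n with
  | zero => simp [compensatedSum]
  | succ n ih =>
    set G : ℕ → (ℕ → ℕ) → ENNReal := fun k y => ENNReal.ofReal
      (Real.exp (compensatedSum p c n y) * Real.exp (c n y * (k - p n) - c n y ^ 2 * p n)) with hG
    have hGdep : ∀ k, DependsOn (G k) (Set.Iio n) := fun k y y' h => by
      simp only [hG, hc.dependsOn_compensatedSum n h, hc n h]
    have hstep : ∀ ω, ENNReal.ofReal (Real.exp (compensatedSum p c (n + 1) fun j => Y j ω))
        = G (Y n ω) fun j => Y j ω := fun ω => by
      rw [compensatedSum, Finset.sum_range_succ, Real.exp_add]; rfl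
    simp_rw [hstep]
    rw [hY.lintegral_eq_two_point hGdep]
    refine (lintegral_mono fun ω => ?_).trans ih
    have hp0 := hY.nonneg n
    have hp1 : 0 ≤ 1 - p n := sub_nonneg.mpr (hY.le_one n)
    simp only [hG]
    rw [← ENNReal.ofReal_mul hp0, ← ENNReal.ofReal_mul hp1,
      ← ENNReal.ofReal_add (by positivity) (by positivity)]
    refine ENNReal.ofReal_le_ofReal ?_
    have htwo := mul_le_mul_of_nonneg_left (two_point_exp_le hp0 (hY.le_one n) (hc1 n ω))
      (Real.exp_pos (compensatedSum p c n fun j => Y j ω)).le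
    push_cast
    linarith

theorem measure_compensatedSum_ge_le [IsProbabilityMeasure P] (hY : IsSelector P Y p)
    {c : ℕ → (ℕ → ℕ) → ℝ} (hc : Predictable c) (hc1 : ∀ i ω, |c i fun j => Y j ω| ≤ 1) (n : ℕ)
    (L : ℝ) :
    P {ω | L ≤ compensatedSum p c n fun j => Y j ω} ≤ ENNReal.ofReal (Real.exp (-L)) := by
  have hm : Measurable fun ω => ENNReal.ofReal (Real.exp (compensatedSum p c n fun j => Y j ω)) :=
    (hY.measurable_of_dependsOn (hc.dependsOn_compensatedSum n)).exp.ennreal_ofReal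
  have hmarkov := (mul_meas_ge_le_lintegral₀ hm.aemeasurable (ENNReal.ofReal (Real.exp L))).trans
    (hY.lintegral_exp_compensatedSum_le_one hc hc1 n)
  simp only [ENNReal.ofReal_le_ofReal_iff (Real.exp_pos _).le, Real.exp_le_exp] at hmarkov
  rw [Real.exp_neg, ENNReal.ofReal_inv_of_pos (Real.exp_pos _), ENNReal.le_inv_iff_mul_le, mul_comm]
  exact hmarkov

theorem measure_predictable_sum_gt_le [IsProbabilityMeasure P] (hY : IsSelector P Y p)
    {c : ℕ → (ℕ → ℕ) → ℝ} (hc : Predictable c) (hc1 : ∀ i ω, |c i fun j => Y j ω| ≤ 1) (n : ℕ)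
    {Λ V : ℝ} (hΛ : 0 < Λ) (hV : Λ ≤ V) :
    P {ω | ∑ i ∈ Finset.range n, (c i fun j => Y j ω) ^ 2 * p i ≤ V ∧
        2 * √(Λ * V) < ∑ i ∈ Finset.range n, (c i fun j => Y j ω) * (Y i ω - p i)}
      ≤ ENNReal.ofReal (Real.exp (-Λ)) := by
  set s : ℝ := √(Λ / V) with hs
  have hV0 : 0 < V := hΛ.trans_le hV
  have hs0 : 0 < s := Real.sqrt_pos.mpr (div_pos hΛ hV0)
  have hs1 : s ≤ 1 := Real.sqrt_le_one.mpr ((div_le_one hV0).mpr hV)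
  have hsq : s ^ 2 * V = Λ := by
    rw [hs, Real.sq_sqrt (div_pos hΛ hV0).le, div_mul_cancel₀ _ hV0.ne']
  have hsV : s * √(Λ * V) = Λ := by
    rw [hs, ← Real.sqrt_mul (div_pos hΛ hV0).le, show Λ / V * (Λ * V) = Λ ^ 2 by field_simp,
      Real.sqrt_sq hΛ.le]
  refine (measure_mono fun ω hω => ?_).trans (hY.measure_compensatedSum_ge_le
    (c := fun i y => s * c i y) (fun i y y' h => by simp only [hc i h]) (fun i ω => ?_) n Λ)
  · obtain ⟨hvar, hsum⟩ := hω
    have hdev := mul_lt_mul_of_pos_left hsum hs0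
    have hcomp := mul_le_mul_of_nonneg_left hvar (sq_nonneg s)
    simp only [Set.mem_ofPred_eq, compensatedSum, Finset.sum_sub_distrib, mul_pow, mul_assoc,
      ← Finset.mul_sum]
    linarith
  · rw [abs_mul, abs_of_pos hs0]
    exact mul_le_one₀ hs1 (abs_nonneg _) (hc1 i ω)

theorem measure_abs_predictable_sum_gt_le [IsProbabilityMeasure P] (hY : IsSelector P Y p)
    {c : ℕ → (ℕ → ℕ) → ℝ} (hc : Predictable c) (hc1 : ∀ i ω, |c i fun j => Y j ω| ≤ 1) (n : ℕ)
    {Λ V : ℝ} (hΛ : 0 < Λ) (hV : Λ ≤ V) :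
    P {ω | ∑ i ∈ Finset.range n, (c i fun j => Y j ω) ^ 2 * p i ≤ V ∧
        2 * √(Λ * V) < |∑ i ∈ Finset.range n, (c i fun j => Y j ω) * (Y i ω - p i)|}
      ≤ ENNReal.ofReal (2 * Real.exp (-Λ)) := by
  have hneg := hY.measure_predictable_sum_gt_le (c := fun i y => -c i y)
    (fun i y y' h => by simp only [hc i h]) (fun i ω => by rw [abs_neg]; exact hc1 i ω) n hΛ hV
  rw [two_mul (Real.exp (-Λ)), ENNReal.ofReal_add (Real.exp_pos _).le (Real.exp_pos _).le]
  refine (measure_mono ?_).trans ((measure_union_le _ _).trans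
    (add_le_add (hY.measure_predictable_sum_gt_le hc hc1 n hΛ hV) hneg))
  rintro ω ⟨hvar, hsum⟩
  rcases lt_abs.mp hsum with h | h
  · exact Or.inl ⟨hvar, h⟩
  · refine Or.inr ⟨by simpa only [neg_sq] using hvar, ?_⟩
    simpa only [neg_mul, Finset.sum_neg_distrib] using h

theorem measure_norm_predictable_sum_gt_le [IsProbabilityMeasure P] (hY : IsSelector P Y p)
    {c : ℕ → (ℕ → ℕ) → ℂ} (hc : Predictable c) (hc1 : ∀ i ω, ‖c i fun j => Y j ω‖ ≤ 1) (n : ℕ)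
    {Λ V : ℝ} (hΛ : 0 < Λ) (hV : Λ ≤ V) :
    P {ω | ∑ i ∈ Finset.range n, ‖c i fun j => Y j ω‖ ^ 2 * p i ≤ V ∧
        4 * √(Λ * V) < ‖∑ i ∈ Finset.range n, (c i fun j => Y j ω) * ((Y i ω - p i : ℝ) : ℂ)‖}
      ≤ ENNReal.ofReal (4 * Real.exp (-Λ)) := by
  have hre := hY.measure_abs_predictable_sum_gt_le (c := fun i y => (c i y).re)
    (fun i y y' h => by simp only [hc i h]) (fun i ω => (Complex.abs_re_le_norm _).trans (hc1 i ω))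
    n hΛ hV
  have him := hY.measure_abs_predictable_sum_gt_le (c := fun i y => (c i y).im)
    (fun i y y' h => by simp only [hc i h]) (fun i ω => (Complex.abs_im_le_norm _).trans (hc1 i ω))
    n hΛ hV
  rw [show 4 * Real.exp (-Λ) = 2 * Real.exp (-Λ) + 2 * Real.exp (-Λ) by ring,
    ENNReal.ofReal_add (by positivity) (by positivity)]
  refine (measure_mono ?_).trans ((measure_union_le _ _).trans (add_le_add hre him))
  rintro ω ⟨hvar, hsum⟩
  have hvar_of_le : ∀ r : ℂ → ℝ, (∀ z, |r z| ≤ ‖z‖) →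
      ∑ i ∈ Finset.range n, r (c i fun j => Y j ω) ^ 2 * p i ≤ V := fun r hr =>
    (Finset.sum_le_sum fun i _ => mul_le_mul_of_nonneg_right
      (sq_le_sq.mpr ((hr _).trans (le_abs_self _))) (hY.nonneg i)).trans hvar
  have hsplit := Complex.norm_le_abs_re_add_abs_im
    (∑ i ∈ Finset.range n, (c i fun j => Y j ω) * ((Y i ω - p i : ℝ) : ℂ))
  simp only [Complex.re_sum, Complex.im_sum, Complex.re_mul_ofReal, Complex.im_mul_ofReal]
    at hsplit
  by_contra hnot
  simp only [Set.mem_union, Set.mem_ofPred_eq, not_or, not_and, not_lt] at hnot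
  linarith [hnot.1 (hvar_of_le Complex.re Complex.abs_re_le_norm),
    hnot.2 (hvar_of_le Complex.im Complex.abs_im_le_norm)]

end IsSelector

/-! ### A spectral bound for trigonometric polynomials of an isometry -/

section Fourier

open scoped ZMod InnerProductSpace

variable {E : Type*} [NormedAddCommGroup E] [InnerProductSpace ℂ E] {N : ℕ} [NeZero N]

theorem sum_norm_sq_dft (Φ : ZMod N → E) : ∑ k, ‖𝓕 Φ k‖ ^ 2 = N * ∑ j, ‖Φ j‖ ^ 2 := by
  have hconj : ∀ j k : ZMod N,
      (starRingEnd ℂ) (ZMod.stdAddChar (-(j * k))) = ZMod.stdAddChar (-(k * -j)) := fun j k => by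
    rw [← AddChar.map_neg_eq_conj]
    congr 1
    ring
  have hinner : ∑ k, ⟪𝓕 Φ k, 𝓕 Φ k⟫_ℂ = N * ∑ j, ⟪Φ j, Φ j⟫_ℂ := calc
    ∑ k, ⟪𝓕 Φ k, 𝓕 Φ k⟫_ℂ = ∑ k, ∑ j, ⟪Φ j, ZMod.stdAddChar (-(k * -j)) • 𝓕 Φ k⟫_ℂ := by
      refine Finset.sum_congr rfl fun k _ => ?_
      conv_lhs => rw [ZMod.dft_apply Φ k, sum_inner]
      simp only [inner_smul_left, hconj, inner_smul_right, ZMod.dft_apply]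
    _ = ∑ j, ⟪Φ j, 𝓕 (𝓕 Φ) (-j)⟫_ℂ := by
      rw [Finset.sum_comm]
      simp only [ZMod.dft_apply (𝓕 Φ), inner_sum]
    _ = N * ∑ j, ⟪Φ j, Φ j⟫_ℂ := by
      simp only [ZMod.dft_dft, neg_neg, inner_smul_right, Finset.mul_sum]
  have hre := congrArg Complex.re hinner
  simp only [inner_self_eq_norm_sq_to_K, Complex.coe_algebraMap] at hre
  exact_mod_cast hre

theorem dft_shift (Φ : ZMod N → E) (t k : ZMod N) :
    𝓕 (fun j => Φ (j + t)) k = ZMod.stdAddChar (t * k) • 𝓕 Φ k := by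
  rw [ZMod.dft_apply, ZMod.dft_apply, Finset.smul_sum]
  refine Fintype.sum_equiv (Equiv.addRight t) _ _ fun j => ?_
  rw [Equiv.coe_addRight, smul_smul, ← AddChar.map_add_eq_mul]
  congr 2
  ring

theorem sum_norm_sq_shift_le {ι : Type*} (s : Finset ι) (c : ι → ℂ) (t : ι → ZMod N) {S : ℝ}
    (hS : ∀ k, ‖∑ m ∈ s, c m * ZMod.stdAddChar (t m * k)‖ ≤ S) (Φ : ZMod N → E) :
    ∑ j, ‖∑ m ∈ s, c m • Φ (j + t m)‖ ^ 2 ≤ S ^ 2 * ∑ j, ‖Φ j‖ ^ 2 := by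
  have hdft : ∀ k, 𝓕 (fun j => ∑ m ∈ s, c m • Φ (j + t m)) k
      = (∑ m ∈ s, c m * ZMod.stdAddChar (t m * k)) • 𝓕 Φ k := fun k => by
    have hsum : (fun j => ∑ m ∈ s, c m • Φ (j + t m)) = ∑ m ∈ s, c m • fun j => Φ (j + t m) := by
      ext j
      simp only [Finset.sum_apply, Pi.smul_apply]
    simp only [hsum, map_sum, map_smul, Finset.sum_apply, Pi.smul_apply, dft_shift, smul_smul,
      Finset.sum_smul]
  refine le_of_mul_le_mul_left (a := (N : ℝ)) ?_ (Nat.cast_pos.mpr (NeZero.pos N))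
  calc (N : ℝ) * ∑ j, ‖∑ m ∈ s, c m • Φ (j + t m)‖ ^ 2
      = ∑ k, ‖∑ m ∈ s, c m * ZMod.stdAddChar (t m * k)‖ ^ 2 * ‖𝓕 Φ k‖ ^ 2 := by
        simp only [← sum_norm_sq_dft, hdft, norm_smul, mul_pow]
    _ ≤ ∑ k, S ^ 2 * ‖𝓕 Φ k‖ ^ 2 := by
        gcongr with k _
        exact hS k
    _ = N * (S ^ 2 * ∑ j, ‖Φ j‖ ^ 2) := by
        rw [← Finset.mul_sum, sum_norm_sq_dft]
        ring

/-- Transference: the orbit `g, V g, …, V ^ (2 * b) g` is read as a function on `ZMod (2 * b + 1)`,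
on which shifts by at most `b` do not wrap around in its first half. -/
theorem norm_sq_sum_isometry_pow_le (V : E →ₗᵢ[ℂ] E) (g : E) {ι : Type*} (s : Finset ι)
    (c : ι → ℂ) (t : ι → ℕ) {b : ℕ} (ht : ∀ m ∈ s, t m ≤ b) {S : ℝ}
    (hS : ∀ k : ZMod (2 * b + 1),
      ‖∑ m ∈ s, c m * ZMod.stdAddChar ((t m : ZMod (2 * b + 1)) * k)‖ ≤ S) :
    ‖∑ m ∈ s, c m • (V ^ t m) g‖ ^ 2 ≤ 2 * S ^ 2 * ‖g‖ ^ 2 := by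
  set Φ : ZMod (2 * b + 1) → E := fun j => (V ^ j.val) g
  have hnorm : ∀ n v, ‖(V ^ n) v‖ = ‖v‖ := fun n v => (V ^ n).norm_map v
  have horbit : ∀ j ∈ Finset.range (b + 1), ‖∑ m ∈ s, c m • Φ (j + t m)‖
      = ‖∑ m ∈ s, c m • (V ^ t m) g‖ := fun j hj => by
    rw [← hnorm j (∑ m ∈ s, c m • (V ^ t m) g), map_sum]
    congr 1
    refine Finset.sum_congr rfl fun m hm => ?_
    have hval : (j + t m : ZMod (2 * b + 1)).val = j + t m := by
      rw [← Nat.cast_add]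
      exact ZMod.val_natCast_of_lt (by have := ht m hm; have := Finset.mem_range.mp hj; omega)
    simp only [Φ, hval, map_smul, pow_add, LinearIsometry.coe_mul, Function.comp_apply]
  have hinj : Set.InjOn (Nat.cast : ℕ → ZMod (2 * b + 1)) (Finset.range (b + 1)) := by
    intro i hi j hj hij
    simp only [Finset.coe_range, Set.mem_Iio] at hi hj
    rwa [ZMod.natCast_eq_natCast_iff', Nat.mod_eq_of_lt (by omega),
      Nat.mod_eq_of_lt (by omega)] at hij
  have hb : (0 : ℝ) < (b + 1 : ℕ) := Nat.cast_pos.mpr b.succ_pos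
  refine le_of_mul_le_mul_left (a := ((b + 1 : ℕ) : ℝ)) ?_ hb
  calc ((b + 1 : ℕ) : ℝ) * ‖∑ m ∈ s, c m • (V ^ t m) g‖ ^ 2
      = ∑ j ∈ Finset.range (b + 1), ‖∑ m ∈ s, c m • Φ (j + t m)‖ ^ 2 := by
        rw [Finset.sum_congr rfl fun j hj => congrArg (· ^ 2) (horbit j hj), Finset.sum_const,
          Finset.card_range, nsmul_eq_mul]
    _ ≤ ∑ j, ‖∑ m ∈ s, c m • Φ (j + t m)‖ ^ 2 := by
        rw [← Finset.sum_image (f := fun j => ‖∑ m ∈ s, c m • Φ (j + t m)‖ ^ 2) hinj]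
        exact Finset.sum_le_univ_sum_of_nonneg fun _ => sq_nonneg _
    _ ≤ S ^ 2 * ∑ j, ‖Φ j‖ ^ 2 := sum_norm_sq_shift_le s c _ hS Φ
    _ = S ^ 2 * ((2 * b + 1 : ℕ) * ‖g‖ ^ 2) := by simp [Φ, hnorm]
    _ ≤ (b + 1 : ℕ) * (2 * S ^ 2 * ‖g‖ ^ 2) := by
        push_cast
        nlinarith [mul_nonneg (sq_nonneg S) (sq_nonneg ‖g‖)]

end Fourier

/-! ### The van der Corput inequality -/

section VanDerCorput

open scoped InnerProductSpace

theorem sum_Ico_shift_of_support {E : Type*} [AddCommMonoid E] {f : ℕ → E} {a b : ℕ}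
    (hf : ∀ i ∉ Finset.Ico a b, f i = 0) {j D : ℕ} (hj : j ≤ D) :
    ∑ s ∈ Finset.Ico a (b + D), (if j ≤ s then f (s - j) else 0) = ∑ i ∈ Finset.Ico a b, f i := by
  refine (Finset.sum_of_injOn (· + j) (add_left_injective j).injOn (fun i hi => ?_)
    (fun s _ hs => ?_) fun i _ => ?_).symm
  · simp only [Finset.coe_Ico, Set.mem_Ico] at hi ⊢
    omega
  · split_ifs with hjs
    · exact hf _ fun hmem => hs ⟨s - j, hmem, Nat.sub_add_cancel hjs⟩
    · rfl
  · rw [if_pos (Nat.le_add_left j i), Nat.add_sub_cancel]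

variable {𝕜 E : Type*} [RCLike 𝕜] [NormedAddCommGroup E] [InnerProductSpace 𝕜 E]

theorem sum_inner_shift_shift {v : ℕ → E} {a b : ℕ} (hv : ∀ i ∉ Finset.Ico a b, v i = 0)
    {j k D : ℕ} (hjk : j ≤ k) (hk : k ≤ D) :
    ∑ s ∈ Finset.Ico a (b + D),
        ⟪if k ≤ s then v (s - k) else 0, if j ≤ s then v (s - j) else 0⟫_𝕜
      = ∑ i ∈ Finset.Ico a b, ⟪v i, v (i + (k - j))⟫_𝕜 := by
  rw [← sum_Ico_shift_of_support (f := fun i => ⟪v i, v (i + (k - j))⟫_𝕜)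
    (fun i hi => by rw [hv i hi, inner_zero_left]) hk]
  refine Finset.sum_congr rfl fun s _ => ?_
  split_ifs with hks hjs
  · rw [Nat.sub_add_sub_cancel hks hjk]
  · omega
  · exact inner_zero_left _
  · exact inner_zero_left _

theorem norm_sum_inner_self {ι : Type*} (s : Finset ι) (w : ι → E) :
    ‖∑ i ∈ s, ⟪w i, w i⟫_𝕜‖ = ∑ i ∈ s, ‖w i‖ ^ 2 := by
  simp only [inner_self_eq_norm_sq_to_K, ← RCLike.ofReal_pow, ← RCLike.ofReal_sum]
  exact RCLike.norm_of_nonneg (Finset.sum_nonneg fun i _ => sq_nonneg _)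

theorem sum_norm_sq_window_le {v : ℕ → E} {a b : ℕ} (hv : ∀ i ∉ Finset.Ico a b, v i = 0) {D : ℕ}
    {A : ℝ} (hA0 : 0 ≤ A)
    (hA : ∀ d, 0 < d → d < D → ‖∑ i ∈ Finset.Ico a b, ⟪v i, v (i + d)⟫_𝕜‖ ≤ A) :
    ∑ s ∈ Finset.Ico a (b + D), ‖∑ j ∈ Finset.range D, if j ≤ s then v (s - j) else 0‖ ^ 2
      ≤ D * (∑ i ∈ Finset.Ico a b, ‖v i‖ ^ 2 + D * A) := by
  set u : ℕ → ℕ → E := fun j s => if j ≤ s then v (s - j) else 0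
  set Q := ∑ i ∈ Finset.Ico a b, ‖v i‖ ^ 2
  have hdiag : ∀ j < D, ‖∑ s ∈ Finset.Ico a (b + D), ⟪u j s, u j s⟫_𝕜‖ = Q := fun j hj => by
    rw [sum_inner_shift_shift hv le_rfl hj.le]
    simp only [tsub_self, add_zero, norm_sum_inner_self, Q]
  have hlt : ∀ j k, j < k → k < D → ‖∑ s ∈ Finset.Ico a (b + D), ⟪u k s, u j s⟫_𝕜‖ ≤ A :=
    fun j k hjk hk => by
      rw [sum_inner_shift_shift hv hjk.le hk.le]
      exact hA _ (Nat.sub_pos_of_lt hjk) (by omega)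
  have hcorr : ∀ j ∈ Finset.range D, ∀ k ∈ Finset.range D,
      ‖∑ s ∈ Finset.Ico a (b + D), ⟪u k s, u j s⟫_𝕜‖ ≤ (if k = j then Q else 0) + A := by
    intro j hj k hk
    rw [Finset.mem_range] at hk hj
    rcases lt_trichotomy j k with h | rfl | h
    · simpa only [h.ne', if_false, zero_add] using hlt j k h hk
    · simpa only [if_true, hdiag j hj] using le_add_of_nonneg_right hA0
    · rw [if_neg h.ne, zero_add, ← RCLike.norm_conj, map_sum]
      simpa only [inner_conj_symm] using hlt k j h hj
  calc ∑ s ∈ Finset.Ico a (b + D), ‖∑ j ∈ Finset.range D, u j s‖ ^ 2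
      = ‖∑ j ∈ Finset.range D, ∑ k ∈ Finset.range D,
          ∑ s ∈ Finset.Ico a (b + D), ⟪u k s, u j s⟫_𝕜‖ := by
        rw [← norm_sum_inner_self (𝕜 := 𝕜)]
        simp only [sum_inner, inner_sum]
        rw [Finset.sum_comm]
        exact congrArg _ (Finset.sum_congr rfl fun j _ => Finset.sum_comm)
    _ ≤ ∑ j ∈ Finset.range D, ∑ k ∈ Finset.range D, ((if k = j then Q else 0) + A) :=
        norm_sum_le_of_le _ fun j hj => norm_sum_le_of_le _ (hcorr j hj)
    _ = D * (Q + D * A) := by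
        simp only [Finset.sum_add_distrib, Finset.sum_ite_eq', Finset.sum_const, Finset.card_range,
          nsmul_eq_mul, Finset.sum_ite_mem, Finset.inter_self]
        ring

theorem vanDerCorput_of_support {v : ℕ → E} {a b : ℕ} (hv : ∀ i ∉ Finset.Ico a b, v i = 0)
    {D : ℕ} {A : ℝ} (hA0 : 0 ≤ A)
    (hA : ∀ d, 0 < d → d < D → ‖∑ i ∈ Finset.Ico a b, ⟪v i, v (i + d)⟫_𝕜‖ ≤ A) :
    D * ‖∑ i ∈ Finset.Ico a b, v i‖ ^ 2
      ≤ ((b - a : ℕ) + D) * (∑ i ∈ Finset.Ico a b, ‖v i‖ ^ 2 + D * A) := by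
  rcases Nat.eq_zero_or_pos D with rfl | hD
  · simp only [Nat.cast_zero, zero_mul]
    positivity
  set w : ℕ → E := fun s => ∑ j ∈ Finset.range D, if j ≤ s then v (s - j) else 0
  have hsum : (D : 𝕜) • ∑ i ∈ Finset.Ico a b, v i = ∑ s ∈ Finset.Ico a (b + D), w s := by
    rw [Finset.sum_comm, Finset.sum_congr rfl fun j hj =>
      sum_Ico_shift_of_support hv (Finset.mem_range.mp hj).le, Finset.sum_const,
      Finset.card_range, Nat.cast_smul_eq_nsmul]
  have hcard : ((Finset.Ico a (b + D)).card : ℝ) ≤ (b - a : ℕ) + D := by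
    rw [Nat.card_Ico]
    exact_mod_cast (by omega : b + D - a ≤ b - a + D)
  refine le_of_mul_le_mul_left (a := (D : ℝ)) ?_ (Nat.cast_pos.mpr hD)
  calc (D : ℝ) * (D * ‖∑ i ∈ Finset.Ico a b, v i‖ ^ 2)
      = ‖∑ s ∈ Finset.Ico a (b + D), w s‖ ^ 2 := by
        rw [← hsum, norm_smul, RCLike.norm_natCast]
        ring
    _ ≤ (∑ s ∈ Finset.Ico a (b + D), ‖w s‖) ^ 2 := by
        gcongr
        exact norm_sum_le _ _
    _ ≤ (Finset.Ico a (b + D)).card * ∑ s ∈ Finset.Ico a (b + D), ‖w s‖ ^ 2 :=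
        sq_sum_le_card_mul_sum_sq
    _ ≤ ((b - a : ℕ) + D) * (D * (∑ i ∈ Finset.Ico a b, ‖v i‖ ^ 2 + D * A)) := by
        gcongr
        exact sum_norm_sq_window_le hv hA0 hA
    _ = D * (((b - a : ℕ) + D) * (∑ i ∈ Finset.Ico a b, ‖v i‖ ^ 2 + D * A)) := by ring

theorem vanDerCorput (v : ℕ → E) (a b : ℕ) {D : ℕ} {A : ℝ} (hA0 : 0 ≤ A)
    (hA : ∀ d, 0 < d → d < D → ‖∑ i ∈ Finset.Ico a (b - d), ⟪v i, v (i + d)⟫_𝕜‖ ≤ A) :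
    D * ‖∑ i ∈ Finset.Ico a b, v i‖ ^ 2
      ≤ ((b - a : ℕ) + D) * (∑ i ∈ Finset.Ico a b, ‖v i‖ ^ 2 + D * A) := by
  set w : ℕ → E := fun i => if i ∈ Finset.Ico a b then v i else 0
  have hw : ∀ i ∈ Finset.Ico a b, w i = v i := fun i hi => if_pos hi
  have hcorr : ∀ d, ∑ i ∈ Finset.Ico a b, ⟪w i, w (i + d)⟫_𝕜
      = ∑ i ∈ Finset.Ico a (b - d), ⟪v i, v (i + d)⟫_𝕜 := fun d => by
    have hsub : Finset.Ico a (b - d) ⊆ Finset.Ico a b := Finset.Ico_subset_Ico_right (by omega)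
    rw [← Finset.sum_subset hsub fun i hi hid => ?_]
    · refine Finset.sum_congr rfl fun i hi => ?_
      rw [hw i (hsub hi), hw (i + d)]
      simp only [Finset.mem_Ico] at hi ⊢
      omega
    · simp only [Finset.mem_Ico] at hi hid
      simp only [w, Finset.mem_Ico, if_neg (show ¬(a ≤ i + d ∧ i + d < b) by omega),
        inner_zero_right]
  have h := vanDerCorput_of_support (𝕜 := 𝕜) (v := w) (fun i hi => if_neg hi) hA0
    fun d hd hdD => by rw [hcorr]; exact hA d hd hdD
  rwa [Finset.sum_congr rfl hw,
    Finset.sum_congr rfl fun i hi => congrArg (‖·‖ ^ 2) (hw i hi)] at h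

theorem mul_norm_sq_sum_le_of_correlation_le (v : ℕ → E) (a b : ℕ) {D : ℕ} {A : ℝ} (hA0 : 0 ≤ A)
    (hA : ∀ d, 0 < d → d < D → ‖∑ i ∈ Finset.Ico a (b - d), ⟪v i, v (i + d)⟫_𝕜‖ ≤ A) :
    D * ‖∑ i ∈ Finset.Ico a b, v i‖ ^ 2
      ≤ 2 * ((b - a : ℕ) + D) * ∑ i ∈ Finset.Ico a b, ‖v i‖ ^ 2 + 2 * (b - a : ℕ) * D * A := by
  set H := b - a with hH
  set Q := ∑ i ∈ Finset.Ico a b, ‖v i‖ ^ 2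
  have hQ : 0 ≤ Q := Finset.sum_nonneg fun i _ => sq_nonneg _
  rcases le_total D H with hDH | hHD
  · have hDH' : (D : ℝ) ≤ H := Nat.cast_le.mpr hDH
    have hDA : D * (D * A) ≤ H * (D * A) := by gcongr
    linarith [vanDerCorput v a b hA0 hA, mul_nonneg (show (0 : ℝ) ≤ H + D by positivity) hQ]
  · rcases Nat.eq_zero_or_pos H with h0 | hpos
    · rw [Finset.Ico_eq_empty_of_le (Nat.sub_eq_zero_iff_le.mp (hH ▸ h0)), Finset.sum_empty,
        norm_zero]
      simp only [ne_eq, OfNat.ofNat_ne_zero, not_false_eq_true, zero_pow, mul_zero]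
      positivity
    · have hHpos : (0 : ℝ) < H := Nat.cast_pos.mpr hpos
      have hvdc := vanDerCorput v a b hA0 fun d hd hdH => hA d hd (hdH.trans_le hHD)
      have hS : ‖∑ i ∈ Finset.Ico a b, v i‖ ^ 2 ≤ 2 * (Q + H * A) :=
        le_of_mul_le_mul_left (hvdc.trans_eq (by ring)) hHpos
      calc D * ‖∑ i ∈ Finset.Ico a b, v i‖ ^ 2 ≤ D * (2 * (Q + H * A)) := by gcongr
        _ ≤ D * (2 * (Q + H * A)) + 2 * H * Q := le_add_of_nonneg_right (by positivity)
        _ = 2 * (H + D) * Q + 2 * H * D * A := by ring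

end VanDerCorput

/-! ### The mean square of a block of centred selected terms -/

section Lp

open scoped InnerProductSpace

variable {𝕜 X : Type*} [RCLike 𝕜] [MeasurableSpace X] {μ : Measure X}

theorem inner_toLp_toLp {f g : X → 𝕜} (hf : MemLp f 2 μ) (hg : MemLp g 2 μ) :
    ⟪hf.toLp f, hg.toLp g⟫_𝕜 = ∫ x, ⟪f x, g x⟫_𝕜 ∂μ := by
  rw [L2.inner_def]
  refine integral_congr_ae ?_
  filter_upwards [hf.coeFn_toLp, hg.coeFn_toLp] with x hfx hgx
  rw [hfx, hgx]

theorem integral_norm_sq_eq_norm_toLp_sq {f : X → 𝕜} (hf : MemLp f 2 μ) :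
    ∫ x, ‖f x‖ ^ 2 ∂μ = ‖hf.toLp f‖ ^ 2 := by
  have h := inner_toLp_toLp hf hf
  simp only [inner_self_eq_norm_sq_to_K, ← RCLike.ofReal_pow, integral_ofReal] at h
  exact (RCLike.ofReal_inj.mp h).symm

theorem toLp_finsetSum {ι : Type*} (s : Finset ι) {f : ι → X → 𝕜} {q : ENNReal}
    (hf : ∀ i, MemLp (f i) q μ) :
    (memLp_finsetSum s fun i _ => hf i).toLp (fun x => ∑ i ∈ s, f i x)
      = ∑ i ∈ s, (hf i).toLp (f i) := by
  classical
  induction s using Finset.induction_on with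
  | empty => rfl
  | insert i s his ih =>
    simp_rw [Finset.sum_insert his]
    rw [← ih]
    rfl

theorem integral_norm_sq_sum_eq {ι : Type*} (s : Finset ι) {f : ι → X → 𝕜}
    (hf : ∀ i, MemLp (f i) 2 μ) :
    ∫ x, ‖∑ i ∈ s, f i x‖ ^ 2 ∂μ = ‖∑ i ∈ s, (hf i).toLp (f i)‖ ^ 2 := by
  rw [← toLp_finsetSum, ← integral_norm_sq_eq_norm_toLp_sq]

theorem norm_toLp_le_of_bound [IsProbabilityMeasure μ] {f : X → 𝕜} {q : ENNReal}
    (hf : MemLp f q μ) {C : ℝ} (hC : ∀ x, ‖f x‖ ≤ C) (hC0 : 0 ≤ C) : ‖hf.toLp f‖ ≤ C := by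
  rw [Lp.norm_toLp]
  refine ENNReal.toReal_le_of_le_ofReal hC0 ?_
  simpa using eLpNorm_le_of_ae_bound (p := q) (ae_of_all μ hC)

theorem compMeasurePreserving_pow_toLp {T : X → X} (hT : MeasurePreserving T μ μ) {f : X → 𝕜}
    (hf : MemLp f 2 μ) (n : ℕ) :
    (Lp.compMeasurePreservingₗᵢ 𝕜 T hT ^ n) (hf.toLp f)
      = (hf.comp_measurePreserving (hT.iterate n)).toLp (f ∘ T^[n]) := by
  induction n with
  | zero => rfl
  | succ n ih =>
    rw [pow_succ', LinearIsometry.coe_mul, Function.comp_apply, ih]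
    exact Lp.toLp_compMeasurePreserving _ hT

end Lp

section CentredTerm

/-- The number of selected integers below `i`. -/
def selCount (y : ℕ → ℕ) (i : ℕ) : ℕ := ∑ j ∈ Finset.range i, y j

/-- The contribution of the integer `i` to the average along the selected integers, with the
indicator `y i` of its selection centred: `(y i - p i) F₁ (T ^ (selCount y i) x) F₂ (T ^ i x)`. -/
noncomputable def centredTerm {𝕜 X : Type*} [RCLike 𝕜] (y : ℕ → ℕ) (p : ℕ → ℝ)
    (T : X → X) (F₁ F₂ : X → 𝕜) (i : ℕ) (x : X) : 𝕜 :=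
  (((y i : ℝ) - p i : ℝ) : 𝕜) * (F₁ (T^[selCount y i] x) * F₂ (T^[i] x))

theorem selCount_add (y : ℕ → ℕ) (i d : ℕ) :
    selCount y (i + d) = selCount y i + ∑ j ∈ Finset.Ico i (i + d), y j := by
  rw [selCount, selCount, Finset.sum_range_add_sum_Ico _ (Nat.le_add_right i d)]

theorem selCount_mono (y : ℕ → ℕ) : Monotone (selCount y) := fun _ _ h =>
  Finset.sum_le_sum_of_subset (Finset.range_mono h)

theorem selCount_le {y : ℕ → ℕ} (hy : ∀ i, y i = 0 ∨ y i = 1) (i : ℕ) : selCount y i ≤ i := by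
  calc selCount y i ≤ ∑ j ∈ Finset.range i, 1 :=
        Finset.sum_le_sum fun j _ => by rcases hy j with h | h <;> omega
    _ = i := by simp

theorem dependsOn_selCount (i : ℕ) : DependsOn (fun y => selCount y i) (Set.Iio i) :=
  fun _ _ h => Finset.sum_congr rfl fun j hj => h j (Finset.mem_range.mp hj)

variable {X : Type*} [MeasurableSpace X] {μ : Measure X} {T : X → X} {y : ℕ → ℕ} {p : ℕ → ℝ}

section RCLike

variable {𝕜 : Type*} [RCLike 𝕜] {F₁ F₂ : X → 𝕜}

theorem measurable_centredTerm (hT : Measurable T) (h₁ : Measurable F₁) (h₂ : Measurable F₂)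
    (i : ℕ) : Measurable (centredTerm y p T F₁ F₂ i) :=
  ((h₁.comp (hT.iterate _)).mul (h₂.comp (hT.iterate _))).const_mul _

theorem norm_centredTerm_le {X : Type*} {T : X → X} {F₁ F₂ : X → 𝕜} (h₁ : ∀ x, ‖F₁ x‖ ≤ 1)
    (h₂ : ∀ x, ‖F₂ x‖ ≤ 1) (i : ℕ) (x : X) :
    ‖centredTerm y p T F₁ F₂ i x‖ ≤ |(y i : ℝ) - p i| := by
  rw [centredTerm, norm_mul, norm_mul, RCLike.norm_ofReal]
  exact mul_le_of_le_one_right (abs_nonneg _) (mul_le_one₀ (h₁ _) (norm_nonneg _) (h₂ _))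

theorem memLp_centredTerm [IsProbabilityMeasure μ] (hT : Measurable T)
    (h₁ : Measurable F₁) (h₂ : Measurable F₂) (hb₁ : ∀ x, ‖F₁ x‖ ≤ 1) (hb₂ : ∀ x, ‖F₂ x‖ ≤ 1)
    (i : ℕ) : MemLp (centredTerm y p T F₁ F₂ i) 2 μ :=
  .of_bound (measurable_centredTerm hT h₁ h₂ i).aestronglyMeasurable _
    (ae_of_all _ (norm_centredTerm_le hb₁ hb₂ i))

theorem integral_iterate_mul_iterate (hT : MeasurePreserving T μ μ) {Φ G : X → 𝕜}
    (hΦ : Measurable Φ) (hG : Measurable G) {m i : ℕ} (hmi : m ≤ i) :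
    ∫ x, Φ (T^[m] x) * G (T^[i] x) ∂μ = ∫ x, Φ x * G (T^[i - m] x) ∂μ := by
  have hm := hT.iterate m
  have hmeas : Measurable (fun x => Φ x * G (T^[i - m] x)) :=
    hΦ.mul (hG.comp (hT.measurable.iterate _))
  conv_rhs => rw [← hm.map_eq]
  rw [integral_map hm.aemeasurable hmeas.aestronglyMeasurable]
  simp_rw [← Function.iterate_add_apply, Nat.sub_add_cancel hmi]

end RCLike

open scoped InnerProductSpace ComplexConjugate

/-- The product of the conjugate of `F` and its translate by `T ^ d`, which appears when two
centred terms at distance `d` are correlated. -/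
def lagProduct (T : X → X) (F : X → ℂ) (d : ℕ) (x : X) : ℂ := conj (F x) * F (T^[d] x)

theorem measurable_lagProduct {F : X → ℂ} (hT : Measurable T) (hF : Measurable F) (d : ℕ) :
    Measurable (lagProduct T F d) :=
  (Complex.continuous_conj.measurable.comp hF).mul (hF.comp (hT.iterate d))

theorem norm_lagProduct_le_one {X : Type*} {T : X → X} {F : X → ℂ} (hF : ∀ x, ‖F x‖ ≤ 1)
    (d : ℕ) (x : X) : ‖lagProduct T F d x‖ ≤ 1 := by
  rw [lagProduct, norm_mul, RCLike.norm_conj]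
  exact mul_le_one₀ (hF _) (norm_nonneg _) (hF _)

theorem inner_centredTerm_centredTerm {X : Type*} {T : X → X} {F₁ F₂ : X → ℂ} {i d e : ℕ}
    (h : selCount y (i + d) = selCount y i + e) (x : X) :
    ⟪centredTerm y p T F₁ F₂ i x, centredTerm y p T F₁ F₂ (i + d) x⟫_ℂ
      = ((((y i : ℝ) - p i) * ((y (i + d) : ℝ) - p (i + d)) : ℝ) : ℂ)
        * (lagProduct T F₁ e (T^[selCount y i] x) * lagProduct T F₂ d (T^[i] x)) := by
  simp only [RCLike.inner_apply, centredTerm, lagProduct, ← Function.iterate_add_apply, h,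
    map_mul, Complex.conj_ofReal, add_comm e, add_comm d, Complex.coe_algebraMap,
    Complex.ofReal_mul]
  ring

/-- The exponential sum at frequency `k` which governs the correlation between the block
`[a, b)` and its shift by `d`, restricted to the `i` with `e` selected integers in
`[i, i + d)`. -/
noncomputable def corrSum (p : ℕ → ℝ) (y : ℕ → ℕ) (a b d e : ℕ) (k : ZMod (2 * b + 1)) : ℂ :=
  ∑ i ∈ (Finset.Ico a (b - d)).filter fun i => selCount y (i + d) = selCount y i + e,
    ((((y i : ℝ) - p i) * ((y (i + d) : ℝ) - p (i + d)) : ℝ) : ℂ)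
      * ZMod.stdAddChar (((i - selCount y i : ℕ) : ZMod (2 * b + 1)) * k)

variable {F₁ F₂ : X → ℂ}

theorem inner_toLp_centredTerm (hT : MeasurePreserving T μ μ) (h₁ : Measurable F₁)
    (h₂ : Measurable F₂) (hy : ∀ i, y i = 0 ∨ y i = 1)
    (hv : ∀ i, MemLp (centredTerm y p T F₁ F₂ i) 2 μ) {i d e : ℕ}
    (hΦ : MemLp (fun x => conj (lagProduct T F₁ e x)) 2 μ)
    (hG : MemLp (lagProduct T F₂ d) 2 μ) (h : selCount y (i + d) = selCount y i + e) :
    ⟪(hv i).toLp, (hv (i + d)).toLp⟫_ℂ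
      = ⟪hΦ.toLp, ((((y i : ℝ) - p i) * ((y (i + d) : ℝ) - p (i + d)) : ℝ) : ℂ)
        • (Lp.compMeasurePreservingₗᵢ ℂ T hT ^ (i - selCount y i)) hG.toLp⟫_ℂ := by
  rw [inner_smul_right, compMeasurePreserving_pow_toLp, inner_toLp_toLp, inner_toLp_toLp]
  simp only [inner_centredTerm_centredTerm h, integral_const_mul, RCLike.inner_apply,
    Complex.conj_conj, Function.comp_apply]
  rw [integral_iterate_mul_iterate hT (measurable_lagProduct hT.measurable h₁ e)
    (measurable_lagProduct hT.measurable h₂ d) (selCount_le hy i)]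
  simp_rw [mul_comm]

variable [IsProbabilityMeasure μ]

theorem norm_sum_filter_inner_centredTerm_le (hT : MeasurePreserving T μ μ)
    (h₁ : Measurable F₁) (h₂ : Measurable F₂) (hb₁ : ∀ x, ‖F₁ x‖ ≤ 1) (hb₂ : ∀ x, ‖F₂ x‖ ≤ 1)
    (hy : ∀ i, y i = 0 ∨ y i = 1) (hv : ∀ i, MemLp (centredTerm y p T F₁ F₂ i) 2 μ)
    {a b d e : ℕ} {t : ℝ} (ht : ∀ k, ‖corrSum p y a b d e k‖ ≤ t) :
    ‖∑ i ∈ (Finset.Ico a (b - d)).filter fun i => selCount y (i + d) = selCount y i + e,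
      ⟪(hv i).toLp, (hv (i + d)).toLp⟫_ℂ‖ ≤ 2 * t := by
  have ht0 : 0 ≤ t := (norm_nonneg _).trans (ht 0)
  have hΦ1 : ∀ x, ‖conj (lagProduct T F₁ e x)‖ ≤ 1 := fun x => by
    rw [RCLike.norm_conj]
    exact norm_lagProduct_le_one hb₁ e x
  have hΦ : MemLp (fun x => conj (lagProduct T F₁ e x)) 2 μ :=
    .of_bound (Complex.continuous_conj.measurable.comp
      (measurable_lagProduct hT.measurable h₁ e)).aestronglyMeasurable 1 (ae_of_all _ hΦ1)
  have hG : MemLp (lagProduct T F₂ d) 2 μ :=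
    .of_bound (measurable_lagProduct hT.measurable h₂ d).aestronglyMeasurable 1
      (ae_of_all _ (norm_lagProduct_le_one hb₂ d))
  rw [Finset.sum_congr rfl fun i hi => inner_toLp_centredTerm hT h₁ h₂ hy hv hΦ hG
    (Finset.mem_filter.mp hi).2, ← inner_sum]
  have hV := norm_sq_sum_isometry_pow_le (Lp.compMeasurePreservingₗᵢ ℂ T hT) hG.toLp
    ((Finset.Ico a (b - d)).filter fun i => selCount y (i + d) = selCount y i + e)
    (fun i => ((((y i : ℝ) - p i) * ((y (i + d) : ℝ) - p (i + d)) : ℝ) : ℂ))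
    (fun i => i - selCount y i) (b := b) (fun i hi => by
      have := Finset.mem_Ico.mp (Finset.mem_filter.mp hi).1
      omega) ht
  refine (norm_inner_le_norm _ _).trans ?_
  refine (mul_le_of_le_one_left (norm_nonneg _)
    (norm_toLp_le_of_bound hΦ hΦ1 zero_le_one)).trans ?_
  refine abs_le_of_sq_le_sq' (hV.trans ?_) (by positivity) |>.2
  calc 2 * t ^ 2 * ‖hG.toLp‖ ^ 2 ≤ 2 * t ^ 2 * 1 ^ 2 := by
        gcongr
        exact norm_toLp_le_of_bound hG (norm_lagProduct_le_one hb₂ d) zero_le_one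
    _ ≤ (2 * t) ^ 2 := by nlinarith [sq_nonneg t]

theorem norm_sum_inner_centredTerm_le (hT : MeasurePreserving T μ μ)
    (h₁ : Measurable F₁) (h₂ : Measurable F₂) (hb₁ : ∀ x, ‖F₁ x‖ ≤ 1) (hb₂ : ∀ x, ‖F₂ x‖ ≤ 1)
    (hy : ∀ i, y i = 0 ∨ y i = 1) (hv : ∀ i, MemLp (centredTerm y p T F₁ F₂ i) 2 μ)
    {a b d E : ℕ} {t : ℝ}
    (hE : ∀ i, a ≤ i → i + d < b → selCount y (i + d) ≤ selCount y i + E)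
    (ht : ∀ e k, ‖corrSum p y a b d e k‖ ≤ t) :
    ‖∑ i ∈ Finset.Ico a (b - d), ⟪(hv i).toLp, (hv (i + d)).toLp⟫_ℂ‖ ≤ (E + 1) * (2 * t) := by
  have hmaps : ∀ i ∈ Finset.Ico a (b - d),
      selCount y (i + d) - selCount y i ∈ Finset.range (E + 1) := fun i hi => by
    have hi := Finset.mem_Ico.mp hi
    have := hE i hi.1 (by omega)
    exact Finset.mem_range.mpr (by omega)
  have hfilter : ∀ i e, selCount y (i + d) - selCount y i = e
      ↔ selCount y (i + d) = selCount y i + e := fun i e => by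
    have := selCount_mono y (Nat.le_add_right i d)
    omega
  rw [← Finset.sum_fiberwise_of_maps_to hmaps]
  simp_rw [hfilter]
  calc _ ≤ ∑ _e ∈ Finset.range (E + 1), 2 * t := norm_sum_le_of_le _ fun e _ =>
        norm_sum_filter_inner_centredTerm_le hT h₁ h₂ hb₁ hb₂ hy hv (ht e)
    _ = (E + 1) * (2 * t) := by simp

theorem mul_integral_norm_sq_sum_centredTerm_le (hT : MeasurePreserving T μ μ)
    (h₁ : Measurable F₁) (h₂ : Measurable F₂) (hb₁ : ∀ x, ‖F₁ x‖ ≤ 1) (hb₂ : ∀ x, ‖F₂ x‖ ≤ 1)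
    (hy : ∀ i, y i = 0 ∨ y i = 1) {a b D E : ℕ} {t : ℝ}
    (hE : ∀ d < D, ∀ i, a ≤ i → i + d < b → selCount y (i + d) ≤ selCount y i + E)
    (ht : ∀ d, 0 < d → ∀ e k, ‖corrSum p y a b d e k‖ ≤ t) :
    D * ∫ x, ‖∑ i ∈ Finset.Ico a b, centredTerm y p T F₁ F₂ i x‖ ^ 2 ∂μ
      ≤ 2 * ((b - a : ℕ) + D) * ∑ i ∈ Finset.Ico a b, ((y i : ℝ) - p i) ^ 2
        + 2 * (b - a : ℕ) * D * ((E + 1) * (2 * t)) := by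
  have ht0 : 0 ≤ t := (norm_nonneg _).trans (ht 1 one_pos 0 0)
  have hv := fun i => memLp_centredTerm (μ := μ) (y := y) (p := p) hT.measurable h₁ h₂ hb₁ hb₂ i
  have hA : 0 ≤ (E + 1) * (2 * t) := by positivity
  have hcorr : ∀ d, 0 < d → d < D →
      ‖∑ i ∈ Finset.Ico a (b - d), ⟪(hv i).toLp, (hv (i + d)).toLp⟫_ℂ‖ ≤ (E + 1) * (2 * t) :=
    fun d hd0 hdD => norm_sum_inner_centredTerm_le hT h₁ h₂ hb₁ hb₂ hy hv (hE d hdD) (ht d hd0)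
  have hnorm : ∑ i ∈ Finset.Ico a b, ‖(hv i).toLp‖ ^ 2
      ≤ ∑ i ∈ Finset.Ico a b, ((y i : ℝ) - p i) ^ 2 := Finset.sum_le_sum fun i _ => by
    rw [← sq_abs ((y i : ℝ) - p i)]
    have h := norm_toLp_le_of_bound (hv i) (norm_centredTerm_le hb₁ hb₂ i) (abs_nonneg _)
    gcongr
  have hint : ∫ x, ‖∑ i ∈ Finset.Ico a b, centredTerm y p T F₁ F₂ i x‖ ^ 2 ∂μ
      = ‖∑ i ∈ Finset.Ico a b, (hv i).toLp‖ ^ 2 :=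
    integral_norm_sq_sum_eq (Finset.Ico a b) hv
  rw [hint]
  calc _ ≤ _ := mul_norm_sq_sum_le_of_correlation_le _ a b hA hcorr
    _ ≤ _ := by gcongr

end CentredTerm

/-! ### Good blocks -/

section GoodBlock

variable {p : ℕ → ℝ} {y : ℕ → ℕ} {a b : ℕ} {U Λ : ℝ}

theorem sum_range_ite_add_le {M : Type*} [AddCommMonoid M] (f : ℕ → M) (a b d : ℕ) :
    ∑ l ∈ Finset.range b, (if a + d ≤ l then f (l - d) else 0)
      = ∑ i ∈ Finset.Ico a (b - d), f i := by
  rw [← Finset.sum_filter]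
  refine (Finset.sum_nbij' (· + d) (· - d) ?_ ?_ ?_ ?_ ?_).symm <;>
    simp only [Finset.mem_filter, Finset.mem_range, Finset.mem_Ico, Nat.add_sub_cancel,
      implies_true] <;> omega

theorem abs_natCast_sub_le_one {n : ℕ} {q : ℝ} (hn : n = 0 ∨ n = 1) (hq0 : 0 ≤ q) (hq1 : q ≤ 1) :
    |(n : ℝ) - q| ≤ 1 := by
  rw [abs_le]
  rcases hn with rfl | rfl <;> push_cast <;> constructor <;> linarith

theorem measure_biUnion_finset_le_ofReal {ι Ω : Type*} [MeasurableSpace Ω] {P : Measure Ω}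
    {s : Finset ι} {A : ι → Set Ω} {c : ℝ} (hA : ∀ m ∈ s, P (A m) ≤ ENNReal.ofReal c) :
    P (⋃ m ∈ s, A m) ≤ ENNReal.ofReal (s.card * c) := by
  rw [ENNReal.ofReal_mul (Nat.cast_nonneg _), ENNReal.ofReal_natCast, ← nsmul_eq_mul]
  exact (measure_biUnion_finset_le _ _).trans (Finset.sum_le_card_nsmul _ _ _ hA)

/-- A block `[a, b)` is good for `y` if all its windows contain at most the expected order of
selected integers and all its correlation sums exhibit square root cancellation. -/
structure GoodBlock (p : ℕ → ℝ) (a b : ℕ) (U Λ : ℝ) (y : ℕ → ℕ) : Prop where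
  count : ∀ i j, a ≤ i → i ≤ j → j ≤ b →
    ∑ l ∈ Finset.Ico i j, (y l : ℝ) ≤ 2 * ((j - i : ℕ) * U) + Λ
  corr : ∀ d, 0 < d → ∀ e k, ‖corrSum p y a b d e k‖ ≤
    4 * √(Λ * (U * (3 * ((b - a : ℕ) * U) + Λ) + Λ))

theorem sum_centred_sq_le (hp0 : ∀ i, 0 ≤ p i) (hp1 : ∀ i, p i ≤ 1)
    (hU : ∀ i, a ≤ i → i < b → p i ≤ U) (hy : ∀ i, y i = 0 ∨ y i = 1)
    (hcount : ∑ l ∈ Finset.Ico a b, (y l : ℝ) ≤ 2 * ((b - a : ℕ) * U) + Λ) :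
    ∑ i ∈ Finset.Ico a b, ((y i : ℝ) - p i) ^ 2 ≤ 3 * ((b - a : ℕ) * U) + Λ := by
  have hterm : ∀ i ∈ Finset.Ico a b, ((y i : ℝ) - p i) ^ 2 ≤ y i + U := fun i hi => by
    have hpU := hU i (Finset.mem_Ico.mp hi).1 (Finset.mem_Ico.mp hi).2
    have hp0 := hp0 i
    have hp1 := hp1 i
    rcases hy i with h | h <;> rw [h] <;> push_cast <;> nlinarith
  have hsum := Finset.sum_le_sum hterm
  rw [Finset.sum_add_distrib, Finset.sum_const, Nat.card_Ico, nsmul_eq_mul] at hsum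
  linarith

/-- The coefficient of `y l - p l` in `corrSum p y a b d e k`; it depends on `y` only through the
values `y j` with `j < l`. -/
noncomputable def corrCoeff (p : ℕ → ℝ) (a b d e : ℕ) (k : ZMod (2 * b + 1)) (l : ℕ)
    (y : ℕ → ℕ) : ℂ :=
  if a + d ≤ l ∧ selCount y l = selCount y (l - d) + e then
    (((y (l - d) : ℝ) - p (l - d) : ℝ) : ℂ)
      * ZMod.stdAddChar (((l - d - selCount y (l - d) : ℕ) : ZMod (2 * b + 1)) * k)
  else 0

theorem corrSum_eq_sum_corrCoeff (p : ℕ → ℝ) (y : ℕ → ℕ) (a b d e : ℕ) (k : ZMod (2 * b + 1)) :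
    corrSum p y a b d e k
      = ∑ l ∈ Finset.range b, corrCoeff p a b d e k l y * (((y l : ℝ) - p l : ℝ) : ℂ) := by
  rw [corrSum, Finset.sum_filter, ← sum_range_ite_add_le]
  refine Finset.sum_congr rfl fun l _ => ?_
  by_cases hl : a + d ≤ l
  · simp only [corrCoeff, hl, if_true, true_and, Nat.sub_add_cancel (le_of_add_le_right hl),
      ite_mul, zero_mul, Complex.ofReal_mul]
    congr 1
    ring
  · simp only [corrCoeff, hl, if_false, false_and, zero_mul]

theorem predictable_corrCoeff (p : ℕ → ℝ) (a b : ℕ) {d : ℕ} (hd : 0 < d) (e : ℕ)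
    (k : ZMod (2 * b + 1)) : Predictable (corrCoeff p a b d e k) := by
  intro l y y' h
  by_cases hl : a + d ≤ l
  · have hl' : l - d < l := by omega
    rw [corrCoeff, corrCoeff, show selCount y l = selCount y' l from dependsOn_selCount l h,
      show selCount y (l - d) = selCount y' (l - d) from
        dependsOn_selCount (l - d) fun j hj => h j (lt_trans hj hl'), h (l - d) hl']
  · rw [corrCoeff, corrCoeff, if_neg fun h => hl h.1, if_neg fun h => hl h.1]

theorem norm_corrCoeff_le (p : ℕ → ℝ) (y : ℕ → ℕ) (a b d e : ℕ) (k : ZMod (2 * b + 1)) (l : ℕ) :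
    ‖corrCoeff p a b d e k l y‖ ≤ if a + d ≤ l then |(y (l - d) : ℝ) - p (l - d)| else 0 := by
  by_cases hl : a + d ≤ l
  · rw [corrCoeff, if_pos hl]
    split_ifs
    · rw [norm_mul, AddChar.norm_apply, mul_one, Complex.norm_real, Real.norm_eq_abs]
    · rw [norm_zero]
      exact abs_nonneg _
  · rw [corrCoeff, if_neg fun h => hl h.1, if_neg hl, norm_zero]

theorem sum_norm_corrCoeff_sq_mul_le (hp0 : ∀ i, 0 ≤ p i) (hU0 : 0 ≤ U)
    (hU : ∀ i, a ≤ i → i < b → p i ≤ U) (y : ℕ → ℕ) (d e : ℕ) (k : ZMod (2 * b + 1)) :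
    ∑ l ∈ Finset.range b, ‖corrCoeff p a b d e k l y‖ ^ 2 * p l
      ≤ U * ∑ i ∈ Finset.Ico a b, ((y i : ℝ) - p i) ^ 2 := by
  calc ∑ l ∈ Finset.range b, ‖corrCoeff p a b d e k l y‖ ^ 2 * p l
      ≤ ∑ l ∈ Finset.range b,
          if a + d ≤ l then U * ((y (l - d) : ℝ) - p (l - d)) ^ 2 else 0 := by
        refine Finset.sum_le_sum fun l hl => ?_
        have hc := norm_corrCoeff_le p y a b d e k l
        split_ifs at hc ⊢ with hal
        · rw [mul_comm U, ← sq_abs ((y (l - d) : ℝ) - p (l - d))]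
          have := hU l ((Nat.le_add_right a d).trans hal) (Finset.mem_range.mp hl)
          have := hp0 l
          gcongr
        · rw [norm_le_zero_iff.mp hc]
          simp
    _ = U * ∑ i ∈ Finset.Ico a (b - d), ((y i : ℝ) - p i) ^ 2 := by
        rw [sum_range_ite_add_le fun i => U * ((y i : ℝ) - p i) ^ 2, Finset.mul_sum]
    _ ≤ U * ∑ i ∈ Finset.Ico a b, ((y i : ℝ) - p i) ^ 2 := by
        gcongr
        exact Nat.sub_le b d

theorem goodBlock_of_lt (hab : a ≤ b) (hp0 : ∀ i, 0 ≤ p i) (hp1 : ∀ i, p i ≤ 1) (hU0 : 0 ≤ U)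
    (hU : ∀ i, a ≤ i → i < b → p i ≤ U) (hy : ∀ i, y i = 0 ∨ y i = 1)
    (hcount : ∀ i ∈ Finset.Icc a b, ∀ j ∈ Finset.Icc a b,
      ∑ l ∈ Finset.Ico i j, (y l : ℝ) ≤ 2 * ((j - i : ℕ) * U) + Λ)
    (hcorr : ∀ d < b, 0 < d → ∀ e < b, ∀ k,
      U * ∑ i ∈ Finset.Ico a b, ((y i : ℝ) - p i) ^ 2 ≤ U * (3 * ((b - a : ℕ) * U) + Λ) + Λ →
      ‖corrSum p y a b d e k‖ ≤ 4 * √(Λ * (U * (3 * ((b - a : ℕ) * U) + Λ) + Λ)))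
    (hΛ : 0 ≤ Λ) : GoodBlock p a b U Λ y where
  count i j hai hij hjb := hcount i (Finset.mem_Icc.mpr ⟨hai, hij.trans hjb⟩) j
    (Finset.mem_Icc.mpr ⟨hai.trans hij, hjb⟩)
  corr d hd0 e k := by
    by_cases hde : d < b ∧ e < b
    · have hsq := sum_centred_sq_le hp0 hp1 hU hy
        (hcount a (Finset.left_mem_Icc.mpr hab) b (Finset.right_mem_Icc.mpr hab))
      exact hcorr d hde.1 hd0 e hde.2 k
        (le_add_of_le_of_nonneg (mul_le_mul_of_nonneg_left hsq hU0) hΛ)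
    · have hempty : corrSum p y a b d e k = 0 := by
        rw [corrSum, Finset.filter_false_of_mem, Finset.sum_empty]
        intro i hi he
        have := selCount_le hy (i + d)
        have := Finset.mem_Ico.mp hi
        omega
      rw [hempty, norm_zero]
      positivity

theorem card_goodBlock_conditions_le (a b : ℕ) :
    (Finset.Icc a b ×ˢ Finset.Icc a b).card +
      (Finset.Ioo 0 b ×ˢ Finset.range b ×ˢ (Finset.univ : Finset (ZMod (2 * b + 1)))).card * 4
      ≤ 12 * (b + 1) ^ 3 := by
  simp only [Finset.card_product, Nat.card_Icc, Nat.card_Ioo, Finset.card_range,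
    Finset.card_univ, ZMod.card]
  calc _ ≤ (b + 1) * (b + 1) + b * (b * (2 * b + 1)) * 4 := by gcongr <;> omega
    _ ≤ 12 * (b + 1) ^ 3 := by nlinarith [Nat.zero_le (b ^ 2), Nat.zero_le (b ^ 3)]

namespace IsSelector

variable {Ω : Type*} [MeasurableSpace Ω] {P : Measure Ω} [IsProbabilityMeasure P]
  {Y : ℕ → Ω → ℕ}

theorem measure_sum_Ico_gt_le (hY : IsSelector P Y p) {i j : ℕ}
    (hU : ∀ l ∈ Finset.Ico i j, p l ≤ U) :
    P {ω | 2 * ((j - i : ℕ) * U) + Λ < ∑ l ∈ Finset.Ico i j, (Y l ω : ℝ)}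
      ≤ ENNReal.ofReal (Real.exp (-Λ)) := by
  refine (measure_mono fun ω hω => ?_).trans (hY.measure_compensatedSum_ge_le
    (c := fun l _ => if l ∈ Finset.Ico i j then 1 else 0) (fun _ _ _ _ => rfl)
    (fun l _ => by split_ifs <;> simp) j Λ)
  have hsum : compensatedSum p (fun l _ => if l ∈ Finset.Ico i j then 1 else 0) j (Y · ω)
      = ∑ l ∈ Finset.Ico i j, ((Y l ω : ℝ) - 2 * p l) := by
    have hterm : ∀ l, (if l ∈ Finset.Ico i j then (1 : ℝ) else 0) * (Y l ω - p l)
        - (if l ∈ Finset.Ico i j then (1 : ℝ) else 0) ^ 2 * p l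
        = if l ∈ Finset.Ico i j then (Y l ω : ℝ) - 2 * p l else 0 := fun l => by
      split_ifs <;> ring
    rw [compensatedSum, Finset.sum_congr rfl fun l _ => hterm l, Finset.sum_ite_mem,
      Finset.inter_eq_right.mpr fun l hl => Finset.mem_range.mpr (Finset.mem_Ico.mp hl).2]
  have hp : ∑ l ∈ Finset.Ico i j, 2 * p l ≤ (j - i : ℕ) * (2 * U) := by
    rw [← Nat.card_Ico, ← nsmul_eq_mul]
    exact Finset.sum_le_card_nsmul _ _ _ fun l hl => by linarith [hU l hl]
  rw [Set.mem_ofPred_eq] at hω ⊢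
  rw [hsum, Finset.sum_sub_distrib]
  linarith

theorem measure_norm_corrSum_gt_le (hY : IsSelector P Y p) (hU0 : 0 ≤ U)
    (hU : ∀ i, a ≤ i → i < b → p i ≤ U) {V : ℝ} (hΛ : 0 < Λ) (hV : Λ ≤ V) {d : ℕ} (hd : 0 < d)
    (e : ℕ) (k : ZMod (2 * b + 1)) :
    P {ω | U * ∑ i ∈ Finset.Ico a b, ((Y i ω : ℝ) - p i) ^ 2 ≤ V ∧
        4 * √(Λ * V) < ‖corrSum p (Y · ω) a b d e k‖}
      ≤ ENNReal.ofReal (4 * Real.exp (-Λ)) := by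
  refine (measure_mono fun ω hω => ?_).trans (hY.measure_norm_predictable_sum_gt_le
    (predictable_corrCoeff p a b hd e k) (fun l ω => ?_) b hΛ hV)
  · exact ⟨(sum_norm_corrCoeff_sq_mul_le hY.nonneg hU0 hU (Y · ω) d e k).trans hω.1,
      corrSum_eq_sum_corrCoeff p (Y · ω) a b d e k ▸ hω.2⟩
  · refine (norm_corrCoeff_le p _ a b d e k l).trans ?_
    split_ifs
    · exact abs_natCast_sub_le_one (hY.zero_or_one _ ω) (hY.nonneg _) (hY.le_one _)
    · exact zero_le_one

theorem measure_not_goodBlock_le (hY : IsSelector P Y p) (hab : a ≤ b) (hU0 : 0 ≤ U)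
    (hU : ∀ i, a ≤ i → i < b → p i ≤ U) (hΛ : 0 < Λ) :
    P {ω | ¬ GoodBlock p a b U Λ (Y · ω)}
      ≤ ENNReal.ofReal (12 * (b + 1) ^ 3 * Real.exp (-Λ)) := by
  set V : ℝ := U * (3 * ((b - a : ℕ) * U) + Λ) + Λ with hV
  have hVΛ : Λ ≤ V := le_add_of_nonneg_left (by positivity)
  set A : ℕ × ℕ → Set Ω := fun m =>
    {ω | 2 * ((m.2 - m.1 : ℕ) * U) + Λ < ∑ l ∈ Finset.Ico m.1 m.2, (Y l ω : ℝ)} with hA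
  set B : ℕ × ℕ × ZMod (2 * b + 1) → Set Ω := fun m =>
    {ω | U * ∑ i ∈ Finset.Ico a b, ((Y i ω : ℝ) - p i) ^ 2 ≤ V ∧
      4 * √(Λ * V) < ‖corrSum p (Y · ω) a b m.1 m.2.1 m.2.2‖} with hB
  set s : Finset (ℕ × ℕ) := Finset.Icc a b ×ˢ Finset.Icc a b with hs
  set r : Finset (ℕ × ℕ × ZMod (2 * b + 1)) :=
    Finset.Ioo 0 b ×ˢ Finset.range b ×ˢ Finset.univ with hr
  have hcover : {ω | ¬ GoodBlock p a b U Λ (Y · ω)} ⊆ (⋃ m ∈ s, A m) ∪ ⋃ m ∈ r, B m := by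
    intro ω hω
    by_contra hnot
    simp only [Set.mem_union, Set.mem_iUnion, not_or, not_exists, hA, hB, hs, hr,
      Set.mem_ofPred_eq, not_and, not_lt, Finset.mem_product, Prod.forall, and_imp,
      Finset.mem_univ, true_imp_iff] at hnot
    refine hω (goodBlock_of_lt hab hY.nonneg hY.le_one hU0 hU (hY.zero_or_one · ω)
      (fun i hi j hj => hnot.1 i j hi hj) (fun d hd hd0 e he k hvar => ?_) hΛ.le)
    exact hnot.2 d e k (Finset.mem_Ioo.mpr ⟨hd0, hd⟩) (Finset.mem_range.mpr he) hvar
  have hPA : ∀ m ∈ s, P (A m) ≤ ENNReal.ofReal (Real.exp (-Λ)) := fun m hm => by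
    have hm := Finset.mem_product.mp hm
    exact hY.measure_sum_Ico_gt_le fun l hl => hU l
      ((Finset.mem_Icc.mp hm.1).1.trans (Finset.mem_Ico.mp hl).1)
      ((Finset.mem_Ico.mp hl).2.trans_le (Finset.mem_Icc.mp hm.2).2)
  have hPB : ∀ m ∈ r, P (B m) ≤ ENNReal.ofReal (4 * Real.exp (-Λ)) := fun m hm =>
    hY.measure_norm_corrSum_gt_le hU0 hU hΛ hVΛ
      (Finset.mem_Ioo.mp (Finset.mem_product.mp hm).1).1 _ _
  refine (measure_mono hcover).trans ((measure_union_le _ _).trans ((add_le_add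
    (measure_biUnion_finset_le_ofReal hPA) (measure_biUnion_finset_le_ofReal hPB)).trans ?_))
  rw [← ENNReal.ofReal_add (by positivity) (by positivity), ← mul_assoc, ← add_mul]
  gcongr
  exact_mod_cast card_goodBlock_conditions_le a b

end IsSelector

end GoodBlock

/-! ### Mean square of good blocks relative to their weights -/

section BlockWeight

variable {p : ℕ → ℝ} {y : ℕ → ℕ} {a b : ℕ} {U Λ δ x : ℝ}

/-- The weight of the block `[a, b)`: its expected number of selected integers plus an error term.
For the `q`-th block, `x` is `q + 1`; the mean square of the centred block sums is at most
`O(x ^ (-(1 + δ / 2)))` times the squared weight, while the weights of all blocks below `M` add up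
to `O(expCount p M)`. -/
noncomputable def blockWeight (p : ℕ → ℝ) (δ x : ℝ) (a b : ℕ) : ℝ :=
  ∑ i ∈ Finset.Ico a b, p i + √((b - a : ℕ) : ℝ) * x ^ (5 / 2 + δ)

theorem rpow_five_halves_add (hx : 0 < x) (δ : ℝ) :
    x ^ (5 / 2 + δ) = √x * (x ^ (1 + δ / 2)) ^ 2 := by
  rw [Real.sqrt_eq_rpow, ← Real.rpow_natCast, ← Real.rpow_mul hx.le, ← Real.rpow_add hx]
  congr 1
  push_cast
  ring

theorem add_le_blockWeight (hx : 0 < x) (hU : ∀ i, a ≤ i → i < b → U / 3 ≤ p i) :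
    √((b - a : ℕ) : ℝ) ^ 2 * U / 3 + √((b - a : ℕ) : ℝ) * √x * (x ^ (1 + δ / 2)) ^ 2
      ≤ blockWeight p δ x a b := by
  have hsum := Finset.card_nsmul_le_sum (Finset.Ico a b) p (U / 3) fun i hi =>
    hU i (Finset.mem_Ico.mp hi).1 (Finset.mem_Ico.mp hi).2
  rw [Nat.card_Ico, nsmul_eq_mul] at hsum
  rw [blockWeight, rpow_five_halves_add hx, Real.sq_sqrt (Nat.cast_nonneg _), mul_assoc,
    mul_div_assoc]
  gcongr

theorem exists_nat_mul_mem_Icc {X : ℝ} (hX : 1 ≤ X) (hU0 : 0 < U) (hU1 : U ≤ 1) :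
    ∃ D : ℕ, X ≤ D * U ∧ D * U ≤ 2 * X := by
  refine ⟨⌈X / U⌉₊, (div_le_iff₀ hU0).mp (Nat.le_ceil _), ?_⟩
  calc ⌈X / U⌉₊ * U ≤ (X / U + 1) * U := by
        gcongr
        exact (Nat.ceil_lt_add_one (by positivity)).le
    _ = X + U := by rw [add_mul, div_mul_cancel₀ _ hU0.ne', one_mul]
    _ ≤ 2 * X := by linarith

theorem GoodBlock.selCount_add_le (h : GoodBlock p a b U Λ y) (hU : 0 ≤ U) {d D i : ℕ} (hd : d ≤ D)
    (hi : a ≤ i) (hib : i + d ≤ b) :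
    selCount y (i + d) ≤ selCount y i + ⌊2 * (D * U) + Λ⌋₊ := by
  rw [selCount_add]
  gcongr
  refine Nat.le_floor ?_
  push_cast
  calc ∑ l ∈ Finset.Ico i (i + d), (y l : ℝ) ≤ 2 * ((i + d - i : ℕ) * U) + Λ :=
        h.count i (i + d) hi (Nat.le_add_right i d) hib
    _ ≤ 2 * (D * U) + Λ := by
        rw [Nat.add_sub_cancel_left]
        gcongr

theorem sqrt_correlation_bound_le {H : ℝ} (hH : 0 ≤ H) (hx : 0 ≤ x) (hU0 : 0 ≤ U) (hU1 : U ≤ 1) :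
    √(10 * x * (U * (3 * (H * U) + 10 * x) + 10 * x)) ≤ 6 * (√x * √H * U) + 15 * √x ^ 2 := by
  refine Real.sqrt_le_iff.mpr ⟨by positivity, ?_⟩
  have hxU : √x ^ 4 * U ≤ √x ^ 4 := mul_le_of_le_one_right (by positivity) hU1
  have hmixed : 0 ≤ √x ^ 3 * √H * U := by positivity
  have hsq : 0 ≤ √x ^ 2 * √H ^ 2 * U ^ 2 := by positivity
  have hx4 : 0 ≤ √x ^ 4 := by positivity
  calc 10 * x * (U * (3 * (H * U) + 10 * x) + 10 * x)
      = 30 * (√x ^ 2 * √H ^ 2 * U ^ 2) + 100 * (√x ^ 4 * U) + 100 * √x ^ 4 := by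
        rw [show √x ^ 4 = (√x ^ 2) ^ 2 by ring, Real.sq_sqrt hx, Real.sq_sqrt hH]
        ring
    _ ≤ (6 * (√x * √H * U) + 15 * √x ^ 2) ^ 2 := by
        nlinarith only [hxU, hmixed, hsq, hx4]

theorem block_polynomial_inequality {r g X w : ℝ} (hr : 1 ≤ r) (hg : 1 ≤ g) (hX : g ^ 2 ≤ X)
    (hU : 0 ≤ U) (hw : r ^ 2 * U / 3 + r * g * X ^ 2 ≤ w) :
    2 * (r ^ 2 * U / X + 1) * (3 * (r ^ 2 * U) + 10 * g ^ 2)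
      + 4 * r ^ 2 * (15 * X * (4 * (6 * (g * r * U) + 15 * g ^ 2))) ≤ 4000 * X⁻¹ * w ^ 2 := by
  set A := r ^ 2 * U with hA
  set B := r * g * X ^ 2 with hB
  have hA0 : 0 ≤ A := by positivity
  have hX1 : 1 ≤ X := (one_le_pow₀ hg).trans hX
  have hX0 : 0 < X := by linarith
  have hrgX : r * g * X ≤ B := by
    rw [hB, sq X]
    gcongr
    exact le_mul_of_one_le_left hX0.le hX1
  have hXB : X ≤ B := (le_mul_of_one_le_left hX0.le (one_le_mul_of_one_le_of_one_le hr hg)).trans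
    hrgX
  calc 2 * (A / X + 1) * (3 * A + 10 * g ^ 2)
        + 4 * r ^ 2 * (15 * X * (4 * (6 * (g * r * U) + 15 * g ^ 2)))
      = X⁻¹ * (2 * (A + X) * (3 * A + 10 * g ^ 2) + 1440 * (A * B) + 3600 * (r * g * X) ^ 2) := by
        rw [hA, hB]
        field_simp
        ring
    _ ≤ X⁻¹ * (2 * (A + B) * (3 * A + 10 * B) + 1440 * (A * B) + 3600 * B ^ 2) := by
        gcongr
        exact hX.trans hXB
    _ ≤ X⁻¹ * (4000 * (A / 3 + B) ^ 2) := by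
        gcongr
        nlinarith [mul_nonneg hA0 (hX0.le.trans hXB), sq_nonneg A, sq_nonneg B]
    _ ≤ X⁻¹ * (4000 * w ^ 2) := by gcongr
    _ = 4000 * X⁻¹ * w ^ 2 := by ring

variable {X : Type*} [MeasurableSpace X] {μ : Measure X} [IsProbabilityMeasure μ] {T : X → X}
  {F₁ F₂ : X → ℂ}

theorem GoodBlock.integral_norm_sq_le (hgood : GoodBlock p a b U Λ y)
    (hT : MeasurePreserving T μ μ) (h₁ : Measurable F₁) (h₂ : Measurable F₂)
    (hb₁ : ∀ x, ‖F₁ x‖ ≤ 1) (hb₂ : ∀ x, ‖F₂ x‖ ≤ 1) (hy : ∀ i, y i = 0 ∨ y i = 1)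
    (hp0 : ∀ i, 0 ≤ p i) (hp1 : ∀ i, p i ≤ 1) (hab : a ≤ b) (hU0 : 0 ≤ U)
    (hU : ∀ i, a ≤ i → i < b → p i ≤ U) {D : ℕ} (hD : 0 < D) :
    ∫ ξ, ‖∑ i ∈ Finset.Ico a b, centredTerm y p T F₁ F₂ i ξ‖ ^ 2 ∂μ
      ≤ 2 * ((b - a : ℕ) / D + 1) * (3 * ((b - a : ℕ) * U) + Λ)
        + 4 * (b - a : ℕ) * ((⌊2 * (D * U) + Λ⌋₊ + 1)
          * (4 * √(Λ * (U * (3 * ((b - a : ℕ) * U) + Λ) + Λ)))) := by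
  have hD' : (0 : ℝ) < D := Nat.cast_pos.mpr hD
  have hsq := sum_centred_sq_le hp0 hp1 hU hy (hgood.count a b le_rfl hab le_rfl)
  have hint := mul_integral_norm_sq_sum_centredTerm_le hT h₁ h₂ hb₁ hb₂ hy (D := D)
    (fun d hd i hi hib => hgood.selCount_add_le hU0 hd.le hi hib.le) hgood.corr
  refine le_of_mul_le_mul_left (hint.trans ?_) hD'
  calc _ ≤ 2 * ((b - a : ℕ) + (D : ℝ)) * (3 * ((b - a : ℕ) * U) + Λ)
        + 2 * (b - a : ℕ) * D * ((⌊2 * (D * U) + Λ⌋₊ + 1)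
          * (2 * (4 * √(Λ * (U * (3 * ((b - a : ℕ) * U) + Λ) + Λ))))) := by gcongr
    _ = _ := by
        field_simp
        ring

theorem GoodBlock.integral_norm_sq_le_blockWeight (hgood : GoodBlock p a b U (10 * x) y)
    (hT : MeasurePreserving T μ μ) (h₁ : Measurable F₁) (h₂ : Measurable F₂)
    (hb₁ : ∀ x, ‖F₁ x‖ ≤ 1) (hb₂ : ∀ x, ‖F₂ x‖ ≤ 1) (hy : ∀ i, y i = 0 ∨ y i = 1)
    (hp0 : ∀ i, 0 ≤ p i) (hp1 : ∀ i, p i ≤ 1) (hx : 1 ≤ x) (hδ : 0 ≤ δ) (hab : a < b)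
    (hU0 : 0 < U) (hU1 : U ≤ 1) (hU : ∀ i, a ≤ i → i < b → p i ≤ U)
    (hU3 : ∀ i, a ≤ i → i < b → U / 3 ≤ p i) :
    ∫ ξ, ‖∑ i ∈ Finset.Ico a b, centredTerm y p T F₁ F₂ i ξ‖ ^ 2 ∂μ
      ≤ 4000 * x ^ (-(1 + δ / 2)) * blockWeight p δ x a b ^ 2 := by
  have hx0 : 0 < x := by linarith
  set X := x ^ (1 + δ / 2)
  have hxX : x ≤ X := Real.self_le_rpow_of_one_le hx (by linarith)
  have hX0 : 0 < X := by linarith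
  obtain ⟨D, hXD, hDX⟩ := exists_nat_mul_mem_Icc (hx.trans hxX) hU0 hU1
  have hD0 : (0 : ℝ) < D := pos_of_mul_pos_left (hX0.trans_le hXD) hU0.le
  have hfloor : (⌊2 * (D * U) + 10 * x⌋₊ : ℝ) + 1 ≤ 15 * X := by
    have := Nat.floor_le (show 0 ≤ 2 * (D * U) + 10 * x by positivity)
    linarith
  have hH : (b - a : ℕ) = √((b - a : ℕ) : ℝ) ^ 2 := (Real.sq_sqrt (Nat.cast_nonneg _)).symm
  have hdiv : (b - a : ℕ) / (D : ℝ) ≤ √((b - a : ℕ) : ℝ) ^ 2 * U / X := by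
    rw [← hH, div_le_div_iff₀ hD0 hX0, mul_assoc, mul_comm U]
    gcongr
  have hroot := sqrt_correlation_bound_le (Nat.cast_nonneg (b - a)) hx0.le hU0.le hU1
  have hpoly := block_polynomial_inequality (X := X) (w := blockWeight p δ x a b)
    (Real.one_le_sqrt.mpr (Nat.one_le_cast.mpr (Nat.sub_pos_of_lt hab)))
    (Real.one_le_sqrt.mpr hx) ((Real.sq_sqrt hx0.le).trans_le hxX) hU0.le
    (add_le_blockWeight hx0 hU3)
  rw [Real.rpow_neg hx0.le]
  calc _ ≤ _ := hgood.integral_norm_sq_le hT h₁ h₂ hb₁ hb₂ hy hp0 hp1 hab.le hU0.le hU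
        (Nat.cast_pos.mp hD0)
    _ ≤ 2 * (√((b - a : ℕ) : ℝ) ^ 2 * U / X + 1)
          * (3 * (√((b - a : ℕ) : ℝ) ^ 2 * U) + 10 * √x ^ 2)
        + 4 * √((b - a : ℕ) : ℝ) ^ 2
          * (15 * X * (4 * (6 * (√x * √((b - a : ℕ) : ℝ) * U) + 15 * √x ^ 2))) := by
        rw [Real.sq_sqrt hx0.le] at hroot ⊢
        rw [← hH] at hdiv ⊢
        gcongr
    _ ≤ _ := hpoly

end BlockWeight

/-! ### Slowly decaying selection probabilities and their block decomposition -/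

/-- Selection probabilities decaying more slowly than `log ^ (3 + δ) n / √n`, indexed so that
`p i` is the probability of the integer `i + 1`. -/
structure SlowDecay (p : ℕ → ℝ) (δ : ℝ) : Prop where
  anti : Antitone p
  pos : ∀ i, 0 < p i
  le_one : ∀ i, p i ≤ 1
  slow : Tendsto (fun i : ℕ => p i * (√((i : ℝ) + 1) / Real.log ((i : ℝ) + 1) ^ (3 + δ)))
    atTop atTop

/-- The expected number of selected indices below `M`. -/
noncomputable def expCount (p : ℕ → ℝ) (M : ℕ) : ℝ := ∑ i ∈ Finset.range M, p i

theorem expCount_mono {p : ℕ → ℝ} (hp : ∀ i, 0 ≤ p i) : Monotone (expCount p) := fun _ _ h =>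
  Finset.sum_le_sum_of_subset_of_nonneg (Finset.range_subset_range.mpr h) fun i _ _ => hp i

theorem expCount_nonneg {p : ℕ → ℝ} (hp : ∀ i, 0 ≤ p i) (M : ℕ) : 0 ≤ expCount p M :=
  Finset.sum_nonneg fun i _ => hp i

theorem mul_le_expCount {p : ℕ → ℝ} (hp : Antitone p) (M : ℕ) : M * p M ≤ expCount p M := by
  have := Finset.card_nsmul_le_sum (Finset.range M) p (p M) fun i hi =>
    hp (Finset.mem_range.mp hi).le
  rwa [Finset.card_range, nsmul_eq_mul] at this

theorem log_natCast_succ_nonneg (i : ℕ) : 0 ≤ Real.log ((i : ℝ) + 1) :=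
  Real.log_nonneg (le_add_of_nonneg_left (Nat.cast_nonneg i))

theorem tendsto_log_natCast_succ : Tendsto (fun i : ℕ => Real.log ((i : ℝ) + 1)) atTop atTop :=
  Real.tendsto_log_atTop.comp (tendsto_atTop_add_const_right _ _ tendsto_natCast_atTop_atTop)

theorem eventually_sqrt_le_sqrt_mul_log_rpow {c : ℝ} (hc : 0 ≤ c) : ∀ᶠ i : ℕ in atTop,
    √((i : ℝ) + 1) ≤ √((i : ℝ) + 1) * Real.log ((i : ℝ) + 1) ^ c := by
  filter_upwards [tendsto_log_natCast_succ.eventually_ge_atTop 1] with i hlog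
  exact le_mul_of_one_le_right (by positivity) (Real.one_le_rpow hlog hc)

theorem le_add_one_of_floor_eq {s t : ℝ} (hs : 0 ≤ s) (h : ⌊s⌋₊ = ⌊t⌋₊) : t ≤ s + 1 :=
  calc t ≤ ⌊t⌋₊ + 1 := (Nat.lt_floor_add_one t).le
    _ ≤ s + 1 := by
        rw [← h]
        gcongr
        exact Nat.floor_le hs

namespace SlowDecay

variable {p : ℕ → ℝ} {δ : ℝ}

theorem nonneg (hp : SlowDecay p δ) (i : ℕ) : 0 ≤ p i := (hp.pos i).le

theorem neg_log_nonneg (hp : SlowDecay p δ) (i : ℕ) : 0 ≤ -Real.log (p i) :=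
  neg_nonneg.mpr (Real.log_nonpos (hp.nonneg i) (hp.le_one i))

theorem eventually_le_succ_mul (hp : SlowDecay p δ) (C : ℝ) : ∀ᶠ i : ℕ in atTop,
    C * (√((i : ℝ) + 1) * Real.log ((i : ℝ) + 1) ^ (3 + δ)) ≤ ((i : ℝ) + 1) * p i := by
  filter_upwards [hp.slow.eventually_ge_atTop C,
    tendsto_log_natCast_succ.eventually_gt_atTop 0] with i hC hlog
  have : 0 < Real.log ((i : ℝ) + 1) ^ (3 + δ) := Real.rpow_pos_of_pos hlog _
  calc C * (√((i : ℝ) + 1) * Real.log ((i : ℝ) + 1) ^ (3 + δ))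
      ≤ (p i * (√((i : ℝ) + 1) / Real.log ((i : ℝ) + 1) ^ (3 + δ))) *
        (√((i : ℝ) + 1) * Real.log ((i : ℝ) + 1) ^ (3 + δ)) := by gcongr
    _ = (√((i : ℝ) + 1) * √((i : ℝ) + 1)) * p i := by field_simp
    _ = ((i : ℝ) + 1) * p i := by rw [Real.mul_self_sqrt (by positivity)]

theorem eventually_le_expCount (hp : SlowDecay p δ) (C : ℝ) : ∀ᶠ i : ℕ in atTop,
    C * (√((i : ℝ) + 1) * Real.log ((i : ℝ) + 1) ^ (3 + δ)) ≤ expCount p i := by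
  filter_upwards [hp.eventually_le_succ_mul (2 * C), eventually_ge_atTop 1] with i hC hi
  have hexp := mul_le_expCount hp.anti i
  have hle : p i ≤ i * p i := le_mul_of_one_le_left (hp.nonneg i) (Nat.one_le_cast.mpr hi)
  linarith

theorem eventually_sqrt_le_expCount (hp : SlowDecay p δ) (hδ : 0 < δ) : ∀ᶠ i : ℕ in atTop,
    √((i : ℝ) + 1) ≤ expCount p i := by
  filter_upwards [hp.eventually_le_expCount 1,
    eventually_sqrt_le_sqrt_mul_log_rpow (show 0 ≤ 3 + δ by positivity)] with i hexp hsqrt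
  rw [one_mul] at hexp
  exact hsqrt.trans hexp

theorem tendsto_expCount (hp : SlowDecay p δ) (hδ : 0 < δ) : Tendsto (expCount p) atTop atTop :=
  tendsto_atTop_mono' _ (hp.eventually_sqrt_le_expCount hδ) (Real.tendsto_sqrt_atTop.comp
    (tendsto_atTop_add_const_right _ 1 tendsto_natCast_atTop_atTop))

theorem isLittleO_log_expCount (hp : SlowDecay p δ) (hδ : 0 < δ) :
    (fun M : ℕ => Real.log ((M : ℝ) + 1)) =o[atTop] expCount p := by
  have hsqrt : (fun M : ℕ => √((M : ℝ) + 1)) =O[atTop] expCount p := by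
    refine Asymptotics.IsBigO.of_bound 1 ?_
    filter_upwards [hp.eventually_sqrt_le_expCount hδ] with M hM
    rw [Real.norm_of_nonneg (Real.sqrt_nonneg _), one_mul]
    exact hM.trans (le_abs_self _)
  refine Asymptotics.IsLittleO.trans_isBigO ?_ hsqrt
  simp only [Real.sqrt_eq_rpow]
  exact (isLittleO_log_rpow_atTop (half_pos one_pos)).comp_tendsto
    (tendsto_atTop_add_const_right _ 1 tendsto_natCast_atTop_atTop)

theorem eventually_neg_log_le (hp : SlowDecay p δ) (hδ : 0 < δ) : ∀ᶠ i : ℕ in atTop,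
    -Real.log (p i) ≤ Real.log ((i : ℝ) + 1) := by
  filter_upwards [hp.eventually_le_succ_mul 1,
    eventually_sqrt_le_sqrt_mul_log_rpow (show 0 ≤ 3 + δ by positivity)] with i hexp hsqrt
  have hone : 1 ≤ ((i : ℝ) + 1) * p i := by
    rw [one_mul] at hexp
    exact (Real.one_le_sqrt.mpr (le_add_of_nonneg_left (Nat.cast_nonneg i))).trans
      (hsqrt.trans hexp)
  have hlog := Real.log_nonneg hone
  rw [Real.log_mul (by positivity) (hp.pos i).ne'] at hlog
  linarith

end SlowDecay

/-- Indices with the same key form a block, on which both `i + 1` and `p i` vary little: the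
former by a factor at most `exp (1 / K)`, the latter by a factor at most `e`. -/
noncomputable def blockKey (K : ℕ) (p : ℕ → ℝ) (i : ℕ) : ℕ :=
  ⌊K * Real.log ((i : ℝ) + 1)⌋₊ + ⌊-Real.log (p i)⌋₊

/-- The first index whose key is at least `q`, so that the `q`-th block is
`[blockStart K p q, blockStart K p (q + 1))`; it may be empty. -/
noncomputable def blockStart (K : ℕ) (p : ℕ → ℝ) (q : ℕ) : ℕ := sInf {i | q ≤ blockKey K p i}

/-- The weight of the `q`-th block. -/
noncomputable def keyWeight (K : ℕ) (p : ℕ → ℝ) (δ : ℝ) (q : ℕ) : ℝ :=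
  blockWeight p δ ((q : ℝ) + 1) (blockStart K p q) (blockStart K p (q + 1))

theorem sum_Ico_le_keyWeight (K : ℕ) (p : ℕ → ℝ) (δ : ℝ) (q : ℕ) :
    ∑ i ∈ Finset.Ico (blockStart K p q) (blockStart K p (q + 1)), p i ≤ keyWeight K p δ q :=
  le_add_of_nonneg_right (by positivity)

theorem monotone_floor_mul_log (K : ℕ) : Monotone fun i : ℕ => ⌊K * Real.log ((i : ℝ) + 1)⌋₊ :=
  fun i j h => by
    dsimp only
    gcongr

theorem tendsto_blockKey {K : ℕ} (hK : 0 < K) (p : ℕ → ℝ) :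
    Tendsto (blockKey K p) atTop atTop :=
  tendsto_atTop_mono (fun _ => Nat.le_add_right _ _) (tendsto_nat_floor_atTop.comp
    (tendsto_log_natCast_succ.const_mul_atTop (Nat.cast_pos.mpr hK)))

theorem blockStart_zero (K : ℕ) (p : ℕ → ℝ) : blockStart K p 0 = 0 := by
  simp [blockStart]

namespace SlowDecay

variable {p : ℕ → ℝ} {δ : ℝ} {K : ℕ} {i j q : ℕ}

theorem monotone_floor_neg_log (hp : SlowDecay p δ) :
    Monotone fun i : ℕ => ⌊-Real.log (p i)⌋₊ := fun _ j h =>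
  Nat.floor_mono (neg_le_neg (Real.log_le_log (hp.pos j) (hp.anti h)))

theorem blockKey_mono (hp : SlowDecay p δ) : Monotone (blockKey K p) :=
  (monotone_floor_mul_log K).add hp.monotone_floor_neg_log

theorem lt_blockStart_iff (hp : SlowDecay p δ) (hK : 0 < K) :
    i < blockStart K p q ↔ blockKey K p i < q := by
  have hmem : q ≤ blockKey K p (blockStart K p q) :=
    Nat.sInf_mem (s := {i | q ≤ blockKey K p i})
      ((tendsto_blockKey hK p).eventually_ge_atTop q).exists
  rw [← not_le, ← not_le, not_iff_not]
  exact ⟨fun h => hmem.trans (hp.blockKey_mono h), fun h => Nat.sInf_le h⟩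

theorem blockStart_mono (hp : SlowDecay p δ) (hK : 0 < K) : Monotone (blockStart K p) :=
  fun _ _ h => le_of_forall_lt fun _ hi =>
    (hp.lt_blockStart_iff hK).mpr (((hp.lt_blockStart_iff hK).mp hi).trans_le h)

theorem blockKey_eq (hp : SlowDecay p δ) (hK : 0 < K) (h₁ : blockStart K p q ≤ i)
    (h₂ : i < blockStart K p (q + 1)) : blockKey K p i = q :=
  le_antisymm (Nat.lt_succ_iff.mp ((hp.lt_blockStart_iff hK).mp h₂))
    (not_lt.mp (mt (hp.lt_blockStart_iff hK).mpr (not_lt.mpr h₁)))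

theorem blockStart_blockKey_le (hp : SlowDecay p δ) (hK : 0 < K) (i : ℕ) :
    blockStart K p (blockKey K p i) ≤ i :=
  not_lt.mp fun h => lt_irrefl _ ((hp.lt_blockStart_iff hK).mp h)

theorem lt_blockStart_blockKey_succ (hp : SlowDecay p δ) (hK : 0 < K) (i : ℕ) :
    i < blockStart K p (blockKey K p i + 1) :=
  (hp.lt_blockStart_iff hK).mpr (Nat.lt_succ_self _)

theorem blockKey_blockStart_blockKey (hp : SlowDecay p δ) (hK : 0 < K) (i : ℕ) :
    blockKey K p (blockStart K p (blockKey K p i)) = blockKey K p i :=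
  hp.blockKey_eq hK le_rfl
    ((hp.blockStart_blockKey_le hK i).trans_lt (hp.lt_blockStart_blockKey_succ hK i))

theorem tendsto_blockStart (hp : SlowDecay p δ) (hK : 0 < K) :
    Tendsto (blockStart K p) atTop atTop :=
  tendsto_atTop_atTop.mpr fun b => ⟨blockKey K p b + 1, fun _ hq =>
    ((hp.lt_blockStart_iff hK).mpr (Nat.lt_of_succ_le hq)).le⟩

theorem blockStart_succ_le_exp (hp : SlowDecay p δ) (hK : 0 < K) (q : ℕ) :
    (blockStart K p (q + 1) : ℝ) ≤ Real.exp (q + 1) := by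
  rcases h : blockStart K p (q + 1) with _ | i
  · rw [Nat.cast_zero]
    positivity
  have hkey : blockKey K p i < q + 1 := (hp.lt_blockStart_iff hK).mp (h ▸ Nat.lt_succ_self i)
  have hfloor : K * Real.log ((i : ℝ) + 1) < q + 1 := by
    exact_mod_cast (Nat.floor_lt' (Nat.succ_ne_zero q)).mp ((Nat.le_add_right _ _).trans_lt hkey)
  rw [Nat.cast_succ, ← Real.log_le_iff_le_exp (by positivity)]
  calc Real.log ((i : ℝ) + 1) ≤ K * Real.log ((i : ℝ) + 1) :=
        le_mul_of_one_le_left (log_natCast_succ_nonneg i) (Nat.one_le_cast.mpr hK)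
    _ ≤ q + 1 := hfloor.le

theorem floor_eq_of_blockKey_eq (hp : SlowDecay p δ) (hij : i ≤ j)
    (h : blockKey K p i = blockKey K p j) :
    ⌊K * Real.log ((i : ℝ) + 1)⌋₊ = ⌊K * Real.log ((j : ℝ) + 1)⌋₊ ∧
      ⌊-Real.log (p i)⌋₊ = ⌊-Real.log (p j)⌋₊ := by
  have hlog := monotone_floor_mul_log K hij
  have hneg_log := hp.monotone_floor_neg_log hij
  simp only [blockKey] at h hlog hneg_log
  omega

theorem div_three_le_of_blockKey_eq (hp : SlowDecay p δ) (hij : i ≤ j)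
    (h : blockKey K p i = blockKey K p j) : p i / 3 ≤ p j := by
  have hlog := le_add_one_of_floor_eq (hp.neg_log_nonneg i) (hp.floor_eq_of_blockKey_eq hij h).2
  have hle : p i ≤ p j * Real.exp 1 := by
    rw [← Real.exp_log (hp.pos i), ← Real.exp_log (hp.pos j), ← Real.exp_add]
    exact Real.exp_le_exp.mpr (by linarith)
  rw [div_le_iff₀ three_pos]
  refine hle.trans (mul_le_mul_of_nonneg_left ?_ (hp.nonneg j))
  linarith [Real.exp_one_lt_d9]

theorem succ_le_of_blockKey_eq (hp : SlowDecay p δ) (hK : 0 < K) (hij : i ≤ j)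
    (h : blockKey K p i = blockKey K p j) : (j : ℝ) + 1 ≤ Real.exp (1 / K) * (i + 1) := by
  have hK' : (0 : ℝ) < K := Nat.cast_pos.mpr hK
  have hfloor := le_add_one_of_floor_eq (mul_nonneg hK'.le (log_natCast_succ_nonneg i))
    (hp.floor_eq_of_blockKey_eq hij h).1
  have hlog : Real.log ((j : ℝ) + 1) ≤ 1 / K + Real.log ((i : ℝ) + 1) := by
    refine le_of_mul_le_mul_left ?_ hK'
    rw [mul_add, mul_one_div_cancel hK'.ne']
    linarith
  calc (j : ℝ) + 1 = Real.exp (Real.log ((j : ℝ) + 1)) := (Real.exp_log (by positivity)).symm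
    _ ≤ Real.exp (1 / K + Real.log ((i : ℝ) + 1)) := Real.exp_le_exp.mpr hlog
    _ = _ := by rw [Real.exp_add, Real.exp_log (by positivity)]

theorem sum_range_sum_Ico_blockStart {E : Type*} [AddCommMonoid E] (hp : SlowDecay p δ)
    (hK : 0 < K) (f : ℕ → E) (Q : ℕ) :
    ∑ q ∈ Finset.range Q, ∑ i ∈ Finset.Ico (blockStart K p q) (blockStart K p (q + 1)), f i
      = ∑ i ∈ Finset.range (blockStart K p Q), f i := by
  induction Q with
  | zero => rw [blockStart_zero, Finset.sum_range_zero, Finset.sum_range_zero]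
  | succ Q ih =>
    rw [Finset.sum_range_succ, ih, Finset.sum_range_add_sum_Ico _
      (hp.blockStart_mono hK (Nat.le_succ Q))]

theorem expCount_sub_le_of_blockKey_eq (hp : SlowDecay p δ) (hK : 0 < K) {s M : ℕ} (hsM : s ≤ M)
    (h : blockKey K p s = blockKey K p M) :
    expCount p M - expCount p s ≤ (Real.exp (1 / K) - 1) * expCount p M := by
  have hexp : 0 ≤ Real.exp (1 / (K : ℝ)) - 1 := sub_nonneg.mpr (Real.one_le_exp (by positivity))
  rcases hsM.eq_or_lt with rfl | hlt
  · rw [sub_self]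
    exact mul_nonneg hexp (expCount_nonneg hp.nonneg _)
  have hlen : ((M - s : ℕ) : ℝ) ≤ (Real.exp (1 / K) - 1) * (s + 1) := by
    rw [Nat.cast_sub hsM]
    linarith [hp.succ_le_of_blockKey_eq hK hsM h]
  have hhead : ((s : ℝ) + 1) * p s ≤ expCount p M := by
    calc ((s : ℝ) + 1) * p s = s * p s + p s := by ring
      _ ≤ expCount p s + p s := by
          gcongr
          exact mul_le_expCount hp.anti s
      _ = expCount p (s + 1) := (Finset.sum_range_succ p s).symm
      _ ≤ expCount p M := expCount_mono hp.nonneg hlt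
  calc expCount p M - expCount p s = ∑ i ∈ Finset.Ico s M, p i :=
        (Finset.sum_Ico_eq_sub _ hsM).symm
    _ ≤ (M - s : ℕ) * p s := by
        rw [← Nat.card_Ico, ← nsmul_eq_mul]
        exact Finset.sum_le_card_nsmul _ _ _ fun i hi => hp.anti (Finset.mem_Ico.mp hi).1
    _ ≤ ((Real.exp (1 / K) - 1) * (s + 1)) * p s := by
        gcongr
        exact hp.nonneg s
    _ = (Real.exp (1 / K) - 1) * ((s + 1) * p s) := mul_assoc _ _ _
    _ ≤ _ := by gcongr

theorem keyWeight_nonneg (hp : SlowDecay p δ) (K q : ℕ) : 0 ≤ keyWeight K p δ q :=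
  (Finset.sum_nonneg fun i _ => hp.nonneg i).trans (sum_Ico_le_keyWeight K p δ q)

theorem tendsto_sum_keyWeight (hp : SlowDecay p δ) (hδ : 0 < δ) (hK : 0 < K) :
    Tendsto (fun Q => ∑ q ∈ Finset.range Q, keyWeight K p δ q) atTop atTop := by
  refine tendsto_atTop_mono (fun Q => ?_)
    ((hp.tendsto_expCount hδ).comp (hp.tendsto_blockStart hK))
  rw [Function.comp, expCount, ← hp.sum_range_sum_Ico_blockStart hK]
  exact Finset.sum_le_sum fun q _ => sum_Ico_le_keyWeight K p δ q

theorem eventually_blockKey_le (hp : SlowDecay p δ) (hδ : 0 < δ) (K : ℕ) :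
    ∀ᶠ M : ℕ in atTop, (blockKey K p M : ℝ) ≤ (K + 1) * Real.log ((M : ℝ) + 1) := by
  filter_upwards [hp.eventually_neg_log_le hδ] with M hM
  have hfloor₁ := Nat.floor_le (mul_nonneg (Nat.cast_nonneg (α := ℝ) K) (log_natCast_succ_nonneg M))
  have hfloor₂ := Nat.floor_le (hp.neg_log_nonneg M)
  rw [blockKey]
  push_cast
  linarith

theorem sum_sqrt_block_length_le (hp : SlowDecay p δ) (hK : 0 < K) (Q : ℕ) :
    ∑ q ∈ Finset.range Q, √((blockStart K p (q + 1) - blockStart K p q : ℕ) : ℝ)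
      ≤ √Q * √(blockStart K p Q) := by
  rw [← Real.sqrt_mul (Nat.cast_nonneg Q)]
  refine Real.le_sqrt_of_sq_le (sq_sum_le_card_mul_sum_sq.trans_eq ?_)
  simp only [Finset.card_range, Real.sq_sqrt (Nat.cast_nonneg _)]
  rw [← Nat.cast_sum, Finset.sum_range_tsub (hp.blockStart_mono hK), blockStart_zero, Nat.sub_zero]

theorem sum_keyWeight_le (hp : SlowDecay p δ) (hδ : 0 < δ) (hK : 0 < K) (Q : ℕ) :
    ∑ q ∈ Finset.range Q, keyWeight K p δ q
      ≤ expCount p (blockStart K p Q) + √(blockStart K p Q) * (Q : ℝ) ^ (3 + δ) := by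
  have hpow : √(Q : ℝ) * (Q : ℝ) ^ (5 / 2 + δ) = (Q : ℝ) ^ (3 + δ) := by
    rw [Real.sqrt_eq_rpow, ← Real.rpow_add_of_nonneg (Nat.cast_nonneg Q) (by norm_num)
      (by positivity)]
    congr 1
    ring
  calc _ ≤ ∑ q ∈ Finset.range Q,
        (∑ i ∈ Finset.Ico (blockStart K p q) (blockStart K p (q + 1)), p i
          + √((blockStart K p (q + 1) - blockStart K p q : ℕ) : ℝ) * (Q : ℝ) ^ (5 / 2 + δ)) := by
        refine Finset.sum_le_sum fun q hq => ?_
        rw [keyWeight, blockWeight]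
        gcongr
        exact_mod_cast Finset.mem_range.mp hq
    _ = expCount p (blockStart K p Q) +
        (∑ q ∈ Finset.range Q, √((blockStart K p (q + 1) - blockStart K p q : ℕ) : ℝ)) *
          (Q : ℝ) ^ (5 / 2 + δ) := by
        rw [Finset.sum_add_distrib, hp.sum_range_sum_Ico_blockStart hK, Finset.sum_mul, expCount]
    _ ≤ expCount p (blockStart K p Q)
        + √Q * √(blockStart K p Q) * (Q : ℝ) ^ (5 / 2 + δ) := by
        gcongr
        exact hp.sum_sqrt_block_length_le hK Q
    _ = _ := by
        rw [← hpow]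
        ring

theorem eventually_sum_keyWeight_le (hp : SlowDecay p δ) (hδ : 0 < δ) (hK : 0 < K) :
    ∀ᶠ M : ℕ in atTop,
      ∑ q ∈ Finset.range (blockKey K p M), keyWeight K p δ q ≤ 2 * expCount p M := by
  filter_upwards [hp.eventually_le_expCount ((K + 1) ^ (3 + δ)), hp.eventually_blockKey_le hδ K]
    with M hexp hkey
  have hstart := hp.blockStart_blockKey_le hK M
  calc _ ≤ _ := hp.sum_keyWeight_le hδ hK _
    _ ≤ expCount p M + √((M : ℝ) + 1) * ((K + 1) * Real.log ((M : ℝ) + 1)) ^ (3 + δ) := by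
        gcongr
        · exact expCount_mono hp.nonneg hstart
        · exact (Nat.cast_le.mpr hstart).trans (lt_add_one _).le
    _ = expCount p M + (K + 1) ^ (3 + δ) *
        (√((M : ℝ) + 1) * Real.log ((M : ℝ) + 1) ^ (3 + δ)) := by
        rw [Real.mul_rpow (by positivity) (log_natCast_succ_nonneg M)]
        ring
    _ ≤ 2 * expCount p M := by linarith

end SlowDecay

/-! ### Typical selections -/

/-- The properties of a sequence of selections, almost sure for random ones, that imply convergence
almost everywhere in every measure-preserving system. -/
structure TypicalSelection (p : ℕ → ℝ) (y : ℕ → ℕ) : Prop where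
  zero_or_one : ∀ i, y i = 0 ∨ y i = 1
  blocks : ∀ K : ℕ, 0 < K → ∀ᶠ q : ℕ in atTop,
    GoodBlock p (blockStart K p q) (blockStart K p (q + 1)) (p (blockStart K p q))
      (10 * ((q : ℝ) + 1)) y
  count : (fun M => (selCount y M : ℝ) - expCount p M) =o[atTop] expCount p

theorem exists_tsum_ofReal_add_ne_top {f : ℕ → ENNReal} {g : ℕ → ℝ} (hg : Summable g)
    (h : ∀ᶠ n in atTop, f n ≤ ENNReal.ofReal (g n)) : ∃ n₀, ∑' n, f (n + n₀) ≠ ⊤ := by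
  obtain ⟨n₀, hn₀⟩ := eventually_atTop.mp h
  exact ⟨n₀, ne_top_of_le_ne_top ((summable_nat_add_iff n₀).mpr hg).tsum_ofReal_ne_top
    (ENNReal.tsum_le_tsum fun n => hn₀ (n + n₀) (Nat.le_add_left n₀ n))⟩

theorem ae_eventually_not_of_measure_le {Ω : Type*} [MeasurableSpace Ω] {P : Measure Ω}
    {B : ℕ → Ω → Prop} {g : ℕ → ℝ} (hg : Summable g)
    (hB : ∀ᶠ n in atTop, P {ω | B n ω} ≤ ENNReal.ofReal (g n)) :
    ∀ᵐ ω ∂P, ∀ᶠ n in atTop, ¬ B n ω := by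
  obtain ⟨n₀, hn₀⟩ := exists_tsum_ofReal_add_ne_top hg hB
  filter_upwards [ae_eventually_notMem (s := fun n => {ω | B (n + n₀) ω}) hn₀] with ω hω
  rw [← map_add_atTop_eq_nat n₀, eventually_map]
  exact hω

theorem summable_natCast_succ_rpow {c : ℝ} (hc : c < -1) :
    Summable fun n : ℕ => ((n : ℝ) + 1) ^ c := by
  simpa using (summable_nat_add_iff 1).mpr (Real.summable_nat_rpow.mpr hc)

theorem twelve_mul_pow_mul_exp_le {u : ℝ} (hu : 0 ≤ u) {n : ℕ} (hn : (n : ℝ) ≤ Real.exp u) :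
    12 * ((n : ℝ) + 1) ^ 3 * Real.exp (-(10 * u)) ≤ 96 * Real.exp (-u) := by
  have hexp : 1 ≤ Real.exp u := Real.one_le_exp hu
  calc 12 * ((n : ℝ) + 1) ^ 3 * Real.exp (-(10 * u))
      ≤ 12 * (2 * Real.exp u) ^ 3 * Real.exp (-(10 * u)) := by
        gcongr
        linarith
    _ = 96 * Real.exp (3 * u + -(10 * u)) := by
        rw [mul_pow, ← Real.exp_nat_mul, Real.exp_add]
        push_cast
        ring
    _ ≤ 96 * Real.exp (-u) := by
        gcongr
        linarith

namespace IsSelector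

variable {Ω : Type*} [MeasurableSpace Ω] {P : Measure Ω} [IsProbabilityMeasure P]
  {Y : ℕ → Ω → ℕ} {p : ℕ → ℝ} {δ : ℝ}

theorem ae_eventually_goodBlock (hY : IsSelector P Y p) (hp : SlowDecay p δ) {K : ℕ} (hK : 0 < K) :
    ∀ᵐ ω ∂P, ∀ᶠ q : ℕ in atTop,
      GoodBlock p (blockStart K p q) (blockStart K p (q + 1)) (p (blockStart K p q))
        (10 * ((q : ℝ) + 1)) fun i => Y i ω := by
  have hsum : Summable fun q : ℕ => 96 * Real.exp (-((q : ℝ) + 1)) := by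
    simpa using ((summable_nat_add_iff 1).mpr Real.summable_exp_neg_nat).mul_left 96
  simpa only [not_not] using ae_eventually_not_of_measure_le hsum (Eventually.of_forall fun q =>
    (hY.measure_not_goodBlock_le (hp.blockStart_mono hK (Nat.le_succ q)) (hp.nonneg _)
      (fun i hi _ => hp.anti hi) (by positivity)).trans (ENNReal.ofReal_le_ofReal
        (twelve_mul_pow_mul_exp_le (by positivity) (hp.blockStart_succ_le_exp hK q))))

theorem measure_abs_selCount_sub_gt_le (hY : IsSelector P Y p) {M : ℕ} {Λ : ℝ} (hΛ : 0 < Λ)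
    (hM : Λ ≤ expCount p M) :
    P {ω | 2 * √(Λ * expCount p M) < |(selCount (fun i => Y i ω) M : ℝ) - expCount p M|}
      ≤ ENNReal.ofReal (2 * Real.exp (-Λ)) := by
  refine (measure_mono fun ω hω => ?_).trans (hY.measure_abs_predictable_sum_gt_le
    (c := fun _ _ => 1) (fun _ _ _ _ => rfl) (fun _ _ => abs_one.le) M hΛ hM)
  refine ⟨?_, ?_⟩
  · simp only [one_pow, one_mul, expCount, le_refl]
  · simp only [one_mul, Finset.sum_sub_distrib]
    simpa only [Set.mem_ofPred_eq, selCount, expCount, Nat.cast_sum] using hω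

theorem ae_eventually_abs_selCount_sub_le (hY : IsSelector P Y p) (hp : SlowDecay p δ)
    (hδ : 0 < δ) : ∀ᵐ ω ∂P, ∀ᶠ M : ℕ in atTop,
      |(selCount (fun i => Y i ω) M : ℝ) - expCount p M|
        ≤ 2 * √(2 * Real.log ((M : ℝ) + 1) * expCount p M) := by
  have hlog : (fun M : ℕ => 2 * Real.log ((M : ℝ) + 1)) =o[atTop] expCount p :=
    (hp.isLittleO_log_expCount hδ).const_mul_left 2
  have hsum : Summable fun M : ℕ => 2 * ((M : ℝ) + 1) ^ (-2 : ℝ) :=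
    (summable_natCast_succ_rpow (by norm_num)).mul_left 2
  simp only [← not_lt]
  refine ae_eventually_not_of_measure_le hsum ?_
  filter_upwards [hlog.def one_pos, tendsto_log_natCast_succ.eventually_gt_atTop 0]
    with M hle hpos
  have hΛ : 0 < 2 * Real.log ((M : ℝ) + 1) := mul_pos two_pos hpos
  rw [Real.norm_of_nonneg hΛ.le, Real.norm_of_nonneg (expCount_nonneg hp.nonneg M), one_mul] at hle
  refine (hY.measure_abs_selCount_sub_gt_le hΛ hle).trans_eq ?_
  rw [Real.rpow_def_of_pos (by positivity)]
  ring_nf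

theorem ae_isLittleO_selCount_sub (hY : IsSelector P Y p) (hp : SlowDecay p δ) (hδ : 0 < δ) :
    ∀ᵐ ω ∂P, (fun M => (selCount (fun i => Y i ω) M : ℝ) - expCount p M) =o[atTop] expCount p := by
  filter_upwards [hY.ae_eventually_abs_selCount_sub_le hp hδ] with ω hω
  have hsq : (fun M => ((selCount (fun i => Y i ω) M : ℝ) - expCount p M) ^ 2)
      =O[atTop] fun M => Real.log ((M : ℝ) + 1) * expCount p M := by
    refine Asymptotics.IsBigO.of_bound 8 (hω.mono fun M hM => ?_)
    have hnn : 0 ≤ Real.log ((M : ℝ) + 1) * expCount p M :=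
      mul_nonneg (log_natCast_succ_nonneg M) (expCount_nonneg hp.nonneg M)
    rw [Real.norm_of_nonneg (sq_nonneg _), Real.norm_of_nonneg hnn, ← sq_abs]
    calc _ ≤ (2 * √(2 * Real.log ((M : ℝ) + 1) * expCount p M)) ^ 2 := by gcongr
      _ = 8 * (Real.log ((M : ℝ) + 1) * expCount p M) := by
          rw [mul_pow, Real.sq_sqrt (by rw [mul_assoc]; exact mul_nonneg zero_le_two hnn)]
          ring
  have hlog : (fun M : ℕ => Real.log ((M : ℝ) + 1) * expCount p M)
      =o[atTop] fun M => expCount p M ^ 2 := by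
    simpa only [sq] using
      (hp.isLittleO_log_expCount hδ).mul_isBigO (Asymptotics.isBigO_refl (expCount p) atTop)
  exact (hsq.trans_isLittleO hlog).of_pow two_ne_zero

theorem ae_typicalSelection (hY : IsSelector P Y p) (hp : SlowDecay p δ) (hδ : 0 < δ) :
    ∀ᵐ ω ∂P, TypicalSelection p fun i => Y i ω := by
  filter_upwards [ae_all_iff.mpr fun k => hY.ae_eventually_goodBlock hp (Nat.succ_pos k),
    hY.ae_isLittleO_selCount_sub hp hδ] with ω hblocks hcount
  refine ⟨fun i => hY.zero_or_one i ω, fun K hK => ?_, hcount⟩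
  obtain ⟨k, rfl⟩ := Nat.exists_eq_succ_of_ne_zero hK.ne'
  exact hblocks k

end IsSelector

/-! ### Almost everywhere convergence of the centred averages -/

theorem ae_tendsto_zero_of_summable_integral {X : Type*} [MeasurableSpace X] {μ : Measure X}
    {f : ℕ → X → ℝ} (hfm : ∀ n, Measurable (f n)) (hfi : ∀ n, Integrable (f n) μ)
    (hf0 : ∀ n x, 0 ≤ f n x) {g : ℕ → ℝ} (hg : Summable g)
    (h : ∀ᶠ n in atTop, ∫ x, f n x ∂μ ≤ g n) :
    ∀ᵐ x ∂μ, Tendsto (fun n => f n x) atTop (𝓝 0) := by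
  obtain ⟨n₀, hn₀⟩ := exists_tsum_ofReal_add_ne_top (f := fun n => ENNReal.ofReal (∫ x, f n x ∂μ))
    hg (h.mono fun n hn => ENNReal.ofReal_le_ofReal hn)
  have hlin : ∫⁻ x, ∑' n, ENNReal.ofReal (f (n + n₀) x) ∂μ ≠ ⊤ := by
    rw [lintegral_tsum fun n => (hfm _).ennreal_ofReal.aemeasurable]
    simp_rw [← ofReal_integral_eq_lintegral_ofReal (hfi _) (ae_of_all _ (hf0 _))]
    exact hn₀
  filter_upwards [ae_lt_top (.tsum fun n => (hfm _).ennreal_ofReal) hlin] with x hx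
  rw [← tendsto_add_atTop_iff_nat n₀]
  simpa [Function.comp_def, ENNReal.toReal_ofReal (hf0 _ _)] using
    (ENNReal.tendsto_toReal ENNReal.zero_ne_top).comp
      (ENNReal.tendsto_atTop_zero_of_tsum_ne_top hx.ne)

theorem norm_sum_Ico_centredTerm_le {𝕜 X : Type*} [RCLike 𝕜] {T : X → X} {F₁ F₂ : X → 𝕜}
    (hb₁ : ∀ x, ‖F₁ x‖ ≤ 1) (hb₂ : ∀ x, ‖F₂ x‖ ≤ 1) {y : ℕ → ℕ} {p : ℕ → ℝ} (hp0 : ∀ i, 0 ≤ p i)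
    {s M : ℕ} (h : s ≤ M) (x : X) :
    ‖∑ i ∈ Finset.Ico s M, centredTerm y p T F₁ F₂ i x‖
      ≤ ((selCount y M : ℝ) - selCount y s) + (expCount p M - expCount p s) := by
  calc _ ≤ ∑ i ∈ Finset.Ico s M, ((y i : ℝ) + p i) := by
        refine norm_sum_le_of_le _ fun i _ => (norm_centredTerm_le hb₁ hb₂ i x).trans ?_
        exact (abs_sub _ _).trans_eq (by rw [Nat.abs_cast, abs_of_nonneg (hp0 i)])
    _ = _ := by
        simp only [Finset.sum_add_distrib, Finset.sum_Ico_eq_sub _ h, selCount, expCount,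
          Nat.cast_sum]
        ring

namespace TypicalSelection

variable {X : Type*} [MeasurableSpace X] {μ : Measure X} [IsProbabilityMeasure μ] {T : X → X}
  {y : ℕ → ℕ} {p : ℕ → ℝ} {δ : ℝ} {K : ℕ} {F₁ F₂ : X → ℂ}

theorem eventually_integral_norm_sq_block_le (hy : TypicalSelection p y) (hp : SlowDecay p δ)
    (hδ : 0 ≤ δ) (hK : 0 < K) (hT : MeasurePreserving T μ μ) (h₁ : Measurable F₁)
    (h₂ : Measurable F₂) (hb₁ : ∀ x, ‖F₁ x‖ ≤ 1) (hb₂ : ∀ x, ‖F₂ x‖ ≤ 1) :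
    ∀ᶠ q : ℕ in atTop, ∫ x, ‖∑ i ∈ Finset.Ico (blockStart K p q) (blockStart K p (q + 1)),
        centredTerm y p T F₁ F₂ i x‖ ^ 2 ∂μ
      ≤ 4000 * ((q : ℝ) + 1) ^ (-(1 + δ / 2)) * keyWeight K p δ q ^ 2 := by
  filter_upwards [hy.blocks K hK] with q hgood
  rcases (hp.blockStart_mono hK (Nat.le_succ q)).eq_or_lt with h | h
  · simp only [← Nat.succ_eq_add_one, ← h, Finset.Ico_self, Finset.sum_empty, norm_zero, ne_eq,
      OfNat.ofNat_ne_zero, not_false_eq_true, zero_pow, integral_zero]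
    positivity
  · exact hgood.integral_norm_sq_le_blockWeight hT h₁ h₂ hb₁ hb₂ hy.zero_or_one hp.nonneg
      hp.le_one (le_add_of_nonneg_left (Nat.cast_nonneg q)) hδ h (hp.pos _) (hp.le_one _)
      (fun i hi _ => hp.anti hi) fun i hi hi' => hp.div_three_le_of_blockKey_eq hi
        ((hp.blockKey_eq hK le_rfl h).trans (hp.blockKey_eq hK hi hi').symm)

theorem ae_tendsto_block_div_keyWeight (hy : TypicalSelection p y) (hp : SlowDecay p δ)
    (hδ : 0 < δ) (hK : 0 < K) (hT : MeasurePreserving T μ μ) (h₁ : Measurable F₁)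
    (h₂ : Measurable F₂) (hb₁ : ∀ x, ‖F₁ x‖ ≤ 1) (hb₂ : ∀ x, ‖F₂ x‖ ≤ 1) :
    ∀ᵐ x ∂μ, Tendsto (fun q => ‖∑ i ∈ Finset.Ico (blockStart K p q) (blockStart K p (q + 1)),
        centredTerm y p T F₁ F₂ i x‖ ^ 2 / keyWeight K p δ q ^ 2) atTop (𝓝 0) := by
  have hmeas := fun q => Finset.measurable_sum
    (Finset.Ico (blockStart K p q) (blockStart K p (q + 1)))
    fun i _ => measurable_centredTerm (y := y) (p := p) hT.measurable h₁ h₂ i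
  have hmem := fun q => memLp_finsetSum
    (Finset.Ico (blockStart K p q) (blockStart K p (q + 1)))
    fun i _ => memLp_centredTerm (μ := μ) (y := y) (p := p) hT.measurable h₁ h₂ hb₁ hb₂ i
  refine ae_tendsto_zero_of_summable_integral
    (g := fun q : ℕ => 4000 * ((q : ℝ) + 1) ^ (-(1 + δ / 2)))
    (fun q => ((hmeas q).norm.pow_const 2).div_const _)
    (fun q => ((hmem q).integrable_norm_pow two_ne_zero).div_const _)
    (fun q x => by positivity) ((summable_natCast_succ_rpow (by linarith)).mul_left _) ?_
  filter_upwards [hy.eventually_integral_norm_sq_block_le hp hδ.le hK hT h₁ h₂ hb₁ hb₂] with q hq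
  rw [integral_div]
  exact div_le_of_le_mul₀ (sq_nonneg _) (by positivity) hq

theorem ae_isLittleO_sum_blocks (hy : TypicalSelection p y) (hp : SlowDecay p δ) (hδ : 0 < δ)
    (hK : 0 < K) (hT : MeasurePreserving T μ μ) (h₁ : Measurable F₁) (h₂ : Measurable F₂)
    (hb₁ : ∀ x, ‖F₁ x‖ ≤ 1) (hb₂ : ∀ x, ‖F₂ x‖ ≤ 1) :
    ∀ᵐ x ∂μ, (fun Q => ∑ i ∈ Finset.range (blockStart K p Q), centredTerm y p T F₁ F₂ i x)
      =o[atTop] fun Q => ∑ q ∈ Finset.range Q, keyWeight K p δ q := by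
  filter_upwards [hy.ae_tendsto_block_div_keyWeight hp hδ hK hT h₁ h₂ hb₁ hb₂] with x hx
  have hblock : (fun q => ∑ i ∈ Finset.Ico (blockStart K p q) (blockStart K p (q + 1)),
      centredTerm y p T F₁ F₂ i x) =o[atTop] keyWeight K p δ := by
    refine .of_norm_left (.of_pow (n := 2) ?_ two_ne_zero)
    refine (Asymptotics.isLittleO_iff_tendsto fun q hq => ?_).mpr hx
    rcases (hp.blockStart_mono hK (Nat.le_succ q)).eq_or_lt with h | h
    · simp [← h]
    · have hpos : 0 < ∑ i ∈ Finset.Ico (blockStart K p q) (blockStart K p (q + 1)), p i :=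
        Finset.sum_pos (fun i _ => hp.pos i) (Finset.nonempty_Ico.mpr h)
      exact absurd (sq_eq_zero_iff.mp hq) (hpos.trans_le (sum_Ico_le_keyWeight K p δ q)).ne'
  simpa only [hp.sum_range_sum_Ico_blockStart hK] using
    hblock.sum_range (hp.keyWeight_nonneg K) (hp.tendsto_sum_keyWeight hδ hK)

theorem eventually_norm_sum_centredTerm_le (hy : TypicalSelection p y) (hp : SlowDecay p δ)
    (hδ : 0 < δ) (hK : 0 < K) {X : Type*} {T : X → X} {F₁ F₂ : X → ℂ} (hb₁ : ∀ x, ‖F₁ x‖ ≤ 1)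
    (hb₂ : ∀ x, ‖F₂ x‖ ≤ 1) {x : X}
    (hx : (fun Q => ∑ i ∈ Finset.range (blockStart K p Q), centredTerm y p T F₁ F₂ i x)
      =o[atTop] fun Q => ∑ q ∈ Finset.range Q, keyWeight K p δ q) {ε : ℝ} (hε : 0 < ε) :
    ∀ᶠ M in atTop, ‖∑ i ∈ Finset.range M, centredTerm y p T F₁ F₂ i x‖
      ≤ (4 * ε + 2 * (Real.exp (1 / K) - 1)) * expCount p M := by
  have hkey := tendsto_blockKey hK p
  filter_upwards [hkey.eventually (hx.def hε), hp.eventually_sum_keyWeight_le hδ hK,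
    hy.count.def hε, ((hp.tendsto_blockStart hK).comp hkey).eventually (hy.count.def hε)]
    with M hblocks hweight hM hs
  set s := blockStart K p (blockKey K p M) with hs_def
  have hsM : s ≤ M := hp.blockStart_blockKey_le hK M
  have htail := hp.expCount_sub_le_of_blockKey_eq hK hsM (hp.blockKey_blockStart_blockKey hK M)
  have hmono : ε * expCount p s ≤ ε * expCount p M := by
    gcongr
    exact expCount_mono hp.nonneg hsM
  have hhead : ‖∑ i ∈ Finset.range s, centredTerm y p T F₁ F₂ i x‖ ≤ ε * (2 * expCount p M) := by
    refine hblocks.trans ?_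
    rw [Real.norm_of_nonneg (Finset.sum_nonneg fun q _ => hp.keyWeight_nonneg K q)]
    gcongr
  simp only [Function.comp_apply, ← hs_def, Real.norm_eq_abs,
    abs_of_nonneg (expCount_nonneg hp.nonneg _)] at hM hs
  rw [← Finset.sum_range_add_sum_Ico _ hsM]
  calc _ ≤ ε * (2 * expCount p M)
        + (((selCount y M : ℝ) - selCount y s) + (expCount p M - expCount p s)) :=
        norm_add_le_of_le hhead (norm_sum_Ico_centredTerm_le hb₁ hb₂ hp.nonneg hsM x)
    _ ≤ _ := by linarith [(abs_le.mp hM).2, (abs_le.mp hs).1]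

theorem ae_isLittleO_sum_centredTerm (hy : TypicalSelection p y) (hp : SlowDecay p δ) (hδ : 0 < δ)
    (hT : MeasurePreserving T μ μ) (h₁ : Measurable F₁) (h₂ : Measurable F₂)
    (hb₁ : ∀ x, ‖F₁ x‖ ≤ 1) (hb₂ : ∀ x, ‖F₂ x‖ ≤ 1) :
    ∀ᵐ x ∂μ, (fun M => ∑ i ∈ Finset.range M, centredTerm y p T F₁ F₂ i x)
      =o[atTop] expCount p := by
  filter_upwards [ae_all_iff.mpr fun k =>
    hy.ae_isLittleO_sum_blocks hp hδ (Nat.succ_pos k) hT h₁ h₂ hb₁ hb₂] with x hx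
  have hexp : Tendsto (fun k : ℕ => 2 * (Real.exp (1 / ((k + 1 : ℕ) : ℝ)) - 1)) atTop (𝓝 0) := by
    have hinv : Tendsto (fun k : ℕ => 1 / ((k + 1 : ℕ) : ℝ)) atTop (𝓝 0) := by
      simpa using tendsto_one_div_add_atTop_nhds_zero_nat (𝕜 := ℝ)
    simpa using (((Real.continuous_exp.tendsto 0).comp hinv).sub_const 1).const_mul 2
  refine Asymptotics.isLittleO_iff.mpr fun ε hε => ?_
  obtain ⟨k, hk⟩ := (hexp.eventually_le_const (half_pos hε)).exists
  filter_upwards [hy.eventually_norm_sum_centredTerm_le hp hδ (Nat.succ_pos k) hb₁ hb₂ (hx k)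
    (show 0 < ε / 8 by positivity)] with M hM
  rw [Real.norm_of_nonneg (expCount_nonneg hp.nonneg M)]
  refine hM.trans (mul_le_mul_of_nonneg_right ?_ (expCount_nonneg hp.nonneg M))
  rw [Nat.succ_eq_add_one]
  linarith

end TypicalSelection

/-! ### The maximal ergodic inequality -/

/-- The maximum of the Birkhoff sums of `f` of length at most `n`, the empty sum included. -/
def maxBirkhoff {X : Type*} (T : X → X) (f : X → ℝ) : ℕ → X → ℝ
  | 0 => fun _ => 0
  | n + 1 => fun x => max 0 (f x + maxBirkhoff T f n (T x))

section MaximalErgodic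

variable {X : Type*} {T : X → X} {f : X → ℝ}

theorem maxBirkhoff_nonneg (n : ℕ) (x : X) : 0 ≤ maxBirkhoff T f n x := by
  cases n with
  | zero => exact le_rfl
  | succ n => exact le_max_left _ _

theorem maxBirkhoff_le_succ (n : ℕ) (x : X) : maxBirkhoff T f n x ≤ maxBirkhoff T f (n + 1) x := by
  induction n generalizing x with
  | zero => exact maxBirkhoff_nonneg 1 x
  | succ n ih => exact max_le_max le_rfl (add_le_add_right (ih (T x)) _)

theorem birkhoffSum_le_maxBirkhoff (n : ℕ) (x : X) : birkhoffSum T f n x ≤ maxBirkhoff T f n x := by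
  induction n generalizing x with
  | zero => exact le_rfl
  | succ n ih =>
    rw [birkhoffSum_succ']
    exact (add_le_add_right (ih (T x)) _).trans (le_max_right _ _)

theorem maxBirkhoff_sub_comp_le {n : ℕ} {x : X} (hx : 0 < maxBirkhoff T f n x) :
    maxBirkhoff T f n x - maxBirkhoff T f n (T x) ≤ f x := by
  cases n with
  | zero => exact (lt_irrefl (0 : ℝ) hx).elim
  | succ n =>
    have hmax : maxBirkhoff T f (n + 1) x = f x + maxBirkhoff T f n (T x) :=
      max_eq_right ((lt_max_iff.mp hx).resolve_left (lt_irrefl _)).le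
    linarith [maxBirkhoff_le_succ (T := T) (f := f) n (T x)]

variable [MeasurableSpace X] {μ : Measure X}

theorem measurable_maxBirkhoff (hT : Measurable T) (hf : Measurable f) (n : ℕ) :
    Measurable (maxBirkhoff T f n) := by
  induction n with
  | zero => exact measurable_const
  | succ n ih => exact measurable_const.max (hf.add (ih.comp hT))

theorem integrable_maxBirkhoff (hT : MeasurePreserving T μ μ) (hf : Integrable f μ) (n : ℕ) :
    Integrable (maxBirkhoff T f n) μ := by
  induction n with
  | zero => exact integrable_zero _ _ _
  | succ n ih => exact (integrable_zero X ℝ μ).sup (hf.add (hT.integrable_comp_of_integrable ih))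

theorem setIntegral_maxBirkhoff_pos_nonneg (hT : MeasurePreserving T μ μ) (hf : Integrable f μ)
    (hfm : Measurable f) (n : ℕ) : 0 ≤ ∫ x in {x | 0 < maxBirkhoff T f n x}, f x ∂μ := by
  have hmeas := measurable_maxBirkhoff hT.measurable hfm n
  have hint := integrable_maxBirkhoff hT hf n
  have hintT : Integrable (fun x => maxBirkhoff T f n (T x)) μ :=
    hT.integrable_comp_of_integrable hint
  set E := {x | 0 < maxBirkhoff T f n x}
  have hcomp : ∫ x in E, maxBirkhoff T f n (T x) ∂μ ≤ ∫ x in E, maxBirkhoff T f n x ∂μ := by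
    calc _ ≤ ∫ x, maxBirkhoff T f n (T x) ∂μ :=
          setIntegral_le_integral hintT (ae_of_all _ fun x => maxBirkhoff_nonneg n (T x))
      _ = ∫ x, maxBirkhoff T f n x ∂μ := by
          rw [← integral_map hT.aemeasurable (hT.map_eq ▸ hmeas.aestronglyMeasurable), hT.map_eq]
      _ = ∫ x in E, maxBirkhoff T f n x ∂μ :=
          (setIntegral_eq_integral_of_forall_compl_eq_zero fun x hx =>
            le_antisymm (not_lt.mp hx) (maxBirkhoff_nonneg n x)).symm
  calc 0 ≤ ∫ x in E, (maxBirkhoff T f n x - maxBirkhoff T f n (T x)) ∂μ := by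
        rw [integral_sub hint.integrableOn hintT.integrableOn]
        exact sub_nonneg.mpr hcomp
    _ ≤ ∫ x in E, f x ∂μ :=
        setIntegral_mono_on (hint.sub hintT).integrableOn hf.integrableOn
          (hmeas measurableSet_Ioi) fun x hx => maxBirkhoff_sub_comp_le hx

variable [IsFiniteMeasure μ]

theorem mul_measureReal_maxBirkhoff_sub_pos_le (hT : MeasurePreserving T μ μ)
    (hf : Integrable f μ) (hfm : Measurable f) (hf0 : ∀ x, 0 ≤ f x) (ε : ℝ) (n : ℕ) :
    ε * μ.real {x | 0 < maxBirkhoff T (fun x => f x - ε) n x} ≤ ∫ x, f x ∂μ := by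
  have hmax := setIntegral_maxBirkhoff_pos_nonneg hT (hf.sub (integrable_const ε))
    (hfm.sub_const ε) n
  simp only [Pi.sub_apply] at hmax
  rw [integral_sub hf.integrableOn (integrable_const _), setIntegral_const, smul_eq_mul,
    sub_nonneg, mul_comm] at hmax
  exact hmax.trans (setIntegral_le_integral hf (ae_of_all _ hf0))

theorem measure_exists_lt_birkhoffSum_le (hT : MeasurePreserving T μ μ) (hf : Integrable f μ)
    (hfm : Measurable f) (hf0 : ∀ x, 0 ≤ f x) {ε : ℝ} (hε : 0 < ε) :
    μ {x | ∃ n : ℕ, ε * n < birkhoffSum T f n x} ≤ ENNReal.ofReal ((∫ x, f x ∂μ) / ε) := by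
  have hsub : {x | ∃ n : ℕ, ε * n < birkhoffSum T f n x}
      ⊆ ⋃ n, {x | 0 < maxBirkhoff T (fun x => f x - ε) n x} := by
    rintro x ⟨n, hn⟩
    refine Set.mem_iUnion.mpr ⟨n, lt_of_lt_of_le ?_ (birkhoffSum_le_maxBirkhoff n x)⟩
    simp only [birkhoffSum, Finset.sum_sub_distrib, Finset.sum_const, Finset.card_range,
      nsmul_eq_mul] at hn ⊢
    linarith
  have hmono : Monotone fun n => {x | 0 < maxBirkhoff T (fun x => f x - ε) n x} :=
    monotone_nat_of_le_succ fun n x hx => lt_of_lt_of_le hx (maxBirkhoff_le_succ n x)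
  refine (measure_mono hsub).trans ?_
  rw [hmono.measure_iUnion]
  refine iSup_le fun n => ?_
  rw [← ofReal_measureReal]
  refine ENNReal.ofReal_le_ofReal ((le_div_iff₀' hε).mpr ?_)
  exact mul_measureReal_maxBirkhoff_sub_pos_le hT hf hfm hf0 ε n

theorem ae_exists_forall_birkhoffSum_le {f : ℕ → X → ℝ} (hT : MeasurePreserving T μ μ)
    (hf : ∀ k, Integrable (f k) μ) (hfm : ∀ k, Measurable (f k)) (hf0 : ∀ k x, 0 ≤ f k x)
    (hlim : Tendsto (fun k => ∫ x, f k x ∂μ) atTop (𝓝 0)) {ε : ℝ} (hε : 0 < ε) :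
    ∀ᵐ x ∂μ, ∃ k, ∀ n : ℕ, birkhoffSum T (f k) n x ≤ ε * n := by
  have hbound : ∀ k, μ {x | ¬ ∃ k, ∀ n : ℕ, birkhoffSum T (f k) n x ≤ ε * n}
      ≤ ENNReal.ofReal ((∫ x, f k x ∂μ) / ε) := fun k => by
    refine le_trans (measure_mono fun x hx => ?_)
      (measure_exists_lt_birkhoffSum_le hT (hf k) (hfm k) (hf0 k) hε)
    simp only [Set.mem_ofPred_eq, not_exists, not_forall, not_le] at hx
    exact hx k
  have hzero : Tendsto (fun k => ENNReal.ofReal ((∫ x, f k x ∂μ) / ε)) atTop (𝓝 0) := by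
    simpa using ENNReal.tendsto_ofReal (hlim.div_const ε)
  exact le_antisymm (ge_of_tendsto' hzero hbound) zero_le

theorem ae_forall_exists_forall_birkhoffSum_le {f : ℕ → X → ℝ} (hT : MeasurePreserving T μ μ)
    (hf : ∀ k, Integrable (f k) μ) (hfm : ∀ k, Measurable (f k)) (hf0 : ∀ k x, 0 ≤ f k x)
    (hlim : Tendsto (fun k => ∫ x, f k x ∂μ) atTop (𝓝 0)) :
    ∀ᵐ x ∂μ, ∀ ε > 0, ∃ k, ∀ n : ℕ, birkhoffSum T (f k) n x ≤ ε * n := by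
  filter_upwards [ae_all_iff.mpr fun j : ℕ => ae_exists_forall_birkhoffSum_le hT hf hfm hf0 hlim
    (Nat.one_div_pos_of_nat (α := ℝ) (n := j))] with x hx ε hε
  obtain ⟨j, hj⟩ := exists_nat_one_div_lt hε
  obtain ⟨k, hk⟩ := hx j
  exact ⟨k, fun n => (hk n).trans (by gcongr)⟩

end MaximalErgodic

/-! ### Weighted averages of sequences with converging moving averages -/

/-- The average of `a` over the window of length `k` starting at `m`. -/
noncomputable def movingAverage {𝕜 : Type*} [RCLike 𝕜] (a : ℕ → 𝕜) (k m : ℕ) : 𝕜 :=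
  (k : 𝕜)⁻¹ * ∑ i ∈ Finset.range k, a (m + i)

/-- The moving averages of `a` over suitable window lengths are arbitrarily close to `l` on
average, uniformly in the number of windows. -/
def HasMovingMean {𝕜 : Type*} [RCLike 𝕜] (a : ℕ → 𝕜) (l : 𝕜) : Prop :=
  ∀ ε > 0, ∃ k : ℕ, 0 < k ∧ ∀ N : ℕ, ∑ m ∈ Finset.range N, ‖movingAverage a k m - l‖ ≤ ε * N

theorem mul_sum_le_sum_mul_of_antitone {w b : ℕ → ℝ} (hw : Antitone w)
    (hb : ∀ N, 0 ≤ ∑ i ∈ Finset.range N, b i) (M : ℕ) :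
    w M * ∑ i ∈ Finset.range M, b i ≤ ∑ i ∈ Finset.range M, w i * b i := by
  induction M with
  | zero => simp
  | succ M ih =>
    calc w (M + 1) * ∑ i ∈ Finset.range (M + 1), b i
        ≤ w M * ∑ i ∈ Finset.range (M + 1), b i :=
          mul_le_mul_of_nonneg_right (hw (Nat.le_succ M)) (hb _)
      _ = w M * ∑ i ∈ Finset.range M, b i + w M * b M := by rw [Finset.sum_range_succ, mul_add]
      _ ≤ ∑ i ∈ Finset.range M, w i * b i + w M * b M := by gcongr
      _ = _ := (Finset.sum_range_succ _ _).symm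

theorem sum_mul_le_of_forall_sum_le {w b : ℕ → ℝ} {ε : ℝ} (hw : Antitone w) (hw0 : ∀ i, 0 ≤ w i)
    (hb : ∀ N : ℕ, ∑ i ∈ Finset.range N, b i ≤ ε * N) (M : ℕ) :
    ∑ i ∈ Finset.range M, w i * b i ≤ ε * ∑ i ∈ Finset.range M, w i := by
  have hnonneg : ∀ N, 0 ≤ ∑ i ∈ Finset.range N, (ε - b i) := fun N => by
    rw [Finset.sum_sub_distrib, Finset.sum_const, Finset.card_range, nsmul_eq_mul]
    linarith [hb N]
  have := (mul_nonneg (hw0 M) (hnonneg M)).trans (mul_sum_le_sum_mul_of_antitone hw hnonneg M)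
  simp only [mul_sub, Finset.sum_sub_distrib, ← Finset.sum_mul] at this
  linarith

section Weighted

variable {𝕜 : Type*} [RCLike 𝕜] {a c : ℕ → 𝕜} {C : ℝ}

theorem sum_range_mul_sub_succ (a c : ℕ → 𝕜) (M : ℕ) :
    ∑ m ∈ Finset.range M, c m * (a m - a (m + 1))
      = c 0 * a 0 - c M * a M + ∑ m ∈ Finset.range M, (c (m + 1) - c m) * a (m + 1) := by
  induction M with
  | zero => simp
  | succ M ih =>
    rw [Finset.sum_range_succ, ih, Finset.sum_range_succ]
    ring

theorem norm_sum_mul_sub_succ_le (ha : ∀ i, ‖a i‖ ≤ C) (M : ℕ) :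
    ‖∑ m ∈ Finset.range M, c m * (a m - a (m + 1))‖
      ≤ C * (‖c 0‖ + ‖c M‖ + ∑ m ∈ Finset.range M, ‖c (m + 1) - c m‖) := by
  have hmul : ∀ (z : 𝕜) i, ‖z * a i‖ ≤ C * ‖z‖ := fun z i => by
    rw [norm_mul, mul_comm]
    exact mul_le_mul_of_nonneg_right (ha i) (norm_nonneg z)
  rw [sum_range_mul_sub_succ]
  calc _ ≤ ‖c 0 * a 0‖ + ‖c M * a M‖ + ∑ m ∈ Finset.range M, ‖(c (m + 1) - c m) * a (m + 1)‖ :=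
        norm_add_le_of_le (norm_sub_le _ _) (norm_sum_le _ _)
    _ ≤ C * ‖c 0‖ + C * ‖c M‖ + ∑ m ∈ Finset.range M, C * ‖c (m + 1) - c m‖ := by
        gcongr <;> apply hmul
    _ = _ := by rw [← Finset.mul_sum, mul_add, mul_add]

theorem norm_sum_mul_sub_shift_le (ha : ∀ i, ‖a i‖ ≤ C) (k M : ℕ) :
    ‖∑ m ∈ Finset.range M, c m * (a m - a (m + k))‖
      ≤ k * (C * (‖c 0‖ + ‖c M‖ + ∑ m ∈ Finset.range M, ‖c (m + 1) - c m‖)) := by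
  induction k with
  | zero => simp
  | succ k ih =>
    have hsplit : ∑ m ∈ Finset.range M, c m * (a m - a (m + (k + 1)))
        = ∑ m ∈ Finset.range M, c m * (a m - a (m + k))
          + ∑ m ∈ Finset.range M, c m * (a (m + k) - a (m + 1 + k)) := by
      rw [← Finset.sum_add_distrib]
      refine Finset.sum_congr rfl fun m _ => ?_
      rw [add_right_comm, ← add_assoc]
      ring
    rw [hsplit, Nat.cast_succ, add_one_mul]
    exact norm_add_le_of_le ih
      (norm_sum_mul_sub_succ_le (a := fun i => a (i + k)) (fun _ => ha _) M)

theorem sum_mul_sub_movingAverage {k : ℕ} (hk : 0 < k) (M : ℕ) :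
    ∑ m ∈ Finset.range M, c m * (a m - movingAverage a k m)
      = (k : 𝕜)⁻¹ * ∑ i ∈ Finset.range k, ∑ m ∈ Finset.range M, c m * (a m - a (m + i)) := by
  have hk' : (k : 𝕜) ≠ 0 := Nat.cast_ne_zero.mpr hk.ne'
  rw [Finset.sum_comm, Finset.mul_sum]
  refine Finset.sum_congr rfl fun m _ => ?_
  rw [← Finset.mul_sum, Finset.sum_sub_distrib, Finset.sum_const, Finset.card_range, nsmul_eq_mul,
    movingAverage]
  field_simp

theorem norm_sum_mul_sub_movingAverage_le (ha : ∀ i, ‖a i‖ ≤ C) {k : ℕ} (hk : 0 < k) (M : ℕ) :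
    ‖∑ m ∈ Finset.range M, c m * (a m - movingAverage a k m)‖
      ≤ k * (C * (‖c 0‖ + ‖c M‖ + ∑ m ∈ Finset.range M, ‖c (m + 1) - c m‖)) := by
  have hC : 0 ≤ C := (norm_nonneg _).trans (ha 0)
  set B := k * (C * (‖c 0‖ + ‖c M‖ + ∑ m ∈ Finset.range M, ‖c (m + 1) - c m‖)) with hB
  rw [sum_mul_sub_movingAverage hk, norm_mul, norm_inv, RCLike.norm_natCast,
    inv_mul_le_iff₀ (Nat.cast_pos.mpr hk)]
  calc _ ≤ ∑ _i ∈ Finset.range k, B := by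
        refine norm_sum_le_of_le _ fun i hi => (norm_sum_mul_sub_shift_le ha i M).trans ?_
        rw [hB]
        gcongr
        exact (Finset.mem_range.mp hi).le
    _ = k * B := by rw [Finset.sum_const, Finset.card_range, nsmul_eq_mul]

theorem norm_sum_mul_sub_le_of_forall_sum_le {w : ℕ → ℝ} {b : ℕ → 𝕜} {l : 𝕜} {ε : ℝ}
    (hw : Antitone w) (hc : ∀ i, ‖c i‖ ≤ w i)
    (hb : ∀ N : ℕ, ∑ m ∈ Finset.range N, ‖b m - l‖ ≤ ε * N) (M : ℕ) :
    ‖∑ m ∈ Finset.range M, c m * (b m - l)‖ ≤ ε * ∑ i ∈ Finset.range M, w i := by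
  calc _ ≤ ∑ m ∈ Finset.range M, w m * ‖b m - l‖ := norm_sum_le_of_le _ fun m _ => by
        rw [norm_mul]
        exact mul_le_mul_of_nonneg_right (hc m) (norm_nonneg _)
    _ ≤ _ := sum_mul_le_of_forall_sum_le hw (fun i => (norm_nonneg _).trans (hc i)) hb M

theorem isLittleO_const_sum {w : ℕ → ℝ}
    (hW : Tendsto (fun M => ∑ i ∈ Finset.range M, w i) atTop atTop) (t : ℝ) :
    (fun _ : ℕ => t) =o[atTop] fun M => ∑ i ∈ Finset.range M, w i :=
  Asymptotics.isLittleO_const_left.mpr (Or.inr (tendsto_norm_atTop_atTop.comp hW))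

theorem HasMovingMean.isLittleO_sum_mul_sub {w : ℕ → ℝ} {l : 𝕜} (hl : HasMovingMean a l)
    (ha : ∀ i, ‖a i‖ ≤ C) (hw : Antitone w) (hc : ∀ i, ‖c i‖ ≤ w i)
    (hW : Tendsto (fun M => ∑ i ∈ Finset.range M, w i) atTop atTop)
    (hV : (fun M => ∑ m ∈ Finset.range M, ‖c (m + 1) - c m‖)
      =o[atTop] fun M => ∑ i ∈ Finset.range M, w i) :
    (fun M => ∑ m ∈ Finset.range M, c m * (a m - l))
      =o[atTop] fun M => ∑ i ∈ Finset.range M, w i := by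
  refine Asymptotics.isLittleO_iff.mpr fun ε hε => ?_
  obtain ⟨k, hk, hb⟩ := hl (ε / 2) (half_pos hε)
  have hC : 0 ≤ C := (norm_nonneg _).trans (ha 0)
  have hvar : (fun M => k * (C * (w 0 + w 0 + ∑ m ∈ Finset.range M, ‖c (m + 1) - c m‖)))
      =o[atTop] fun M => ∑ i ∈ Finset.range M, w i :=
    (((isLittleO_const_sum hW _).add hV).const_mul_left C).const_mul_left _
  filter_upwards [hvar.def (half_pos hε), hW.eventually_ge_atTop 0] with M hM hpos
  have hsplit : ∑ m ∈ Finset.range M, c m * (a m - l)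
      = ∑ m ∈ Finset.range M, c m * (a m - movingAverage a k m)
        + ∑ m ∈ Finset.range M, c m * (movingAverage a k m - l) := by
    rw [← Finset.sum_add_distrib]
    exact Finset.sum_congr rfl fun m _ => by ring
  have hfirst : ‖∑ m ∈ Finset.range M, c m * (a m - movingAverage a k m)‖
      ≤ ε / 2 * ∑ i ∈ Finset.range M, w i := by
    rw [Real.norm_of_nonneg hpos] at hM
    refine ((norm_sum_mul_sub_movingAverage_le ha hk M).trans ?_).trans
      ((Real.le_norm_self _).trans hM)
    gcongr
    exacts [hc 0, (hc M).trans (hw (Nat.zero_le M))]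
  rw [hsplit, Real.norm_of_nonneg hpos]
  calc _ ≤ ε / 2 * ∑ i ∈ Finset.range M, w i + ε / 2 * ∑ i ∈ Finset.range M, w i :=
        norm_add_le_of_le hfirst (norm_sum_mul_sub_le_of_forall_sum_le hw hc hb M)
    _ = _ := by ring

end Weighted

/-! ### The mean ergodic theorem along orbits -/

theorem ae_iterate_eq_of_ae_eq {X Y : Type*} [MeasurableSpace X] {μ : Measure X}
    {T : X → X} (hT : MeasurePreserving T μ μ) {F G : X → Y} (h : F =ᵐ[μ] G) :
    ∀ᵐ x ∂μ, ∀ n, F (T^[n] x) = G (T^[n] x) :=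
  ae_all_iff.mpr fun n => (hT.iterate n).quasiMeasurePreserving.ae h

theorem movingAverage_orbit {𝕜 X : Type*} [RCLike 𝕜] (T : X → X) (F : X → 𝕜) (k m : ℕ) (x : X) :
    movingAverage (fun n => F (T^[n] x)) k m = birkhoffAverage 𝕜 T F k (T^[m] x) := by
  simp only [movingAverage, birkhoffAverage, birkhoffSum, smul_eq_mul,
    ← Function.iterate_add_apply, add_comm]

section Invariant

variable {𝕜 : Type*} [RCLike 𝕜] {X : Type*} [MeasurableSpace X] {μ : Measure X} {T : X → X}
  {F G : X → 𝕜}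

theorem koopman_iterate_toLp (hT : MeasurePreserving T μ μ) (hF : MemLp F 2 μ) (n : ℕ) :
    (koopman 𝕜 hT)^[n] (hF.toLp F) =
      (hF.comp_measurePreserving (hT.iterate n)).toLp (F ∘ T^[n]) := by
  induction n with
  | zero => rfl
  | succ n ih =>
    rw [Function.iterate_succ_apply', ih]
    exact (Lp.toLp_compMeasurePreserving _ hT).trans rfl

theorem coeFn_birkhoffSum_koopman (hT : MeasurePreserving T μ μ) (hF : MemLp F 2 μ) (n : ℕ) :
    ⇑(birkhoffSum (koopman 𝕜 hT) id n (hF.toLp F)) =ᵐ[μ] birkhoffSum T F n := by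
  induction n with
  | zero =>
    simp only [birkhoffSum_zero']
    exact Lp.coeFn_zero _ _ _
  | succ n ih =>
    rw [birkhoffSum_succ, id, koopman_iterate_toLp hT hF]
    have hFn := hF.comp_measurePreserving (hT.iterate n)
    filter_upwards [Lp.coeFn_add (birkhoffSum (koopman 𝕜 hT) id n (hF.toLp F)) (hFn.toLp _), ih,
      hFn.coeFn_toLp] with x hadd hsum hterm
    rw [hadd, Pi.add_apply, hsum, hterm, birkhoffSum_succ, Function.comp]

theorem coeFn_birkhoffAverage_koopman (hT : MeasurePreserving T μ μ) (hF : MemLp F 2 μ) (n : ℕ) :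
    ⇑(birkhoffAverage 𝕜 (koopman 𝕜 hT) id n (hF.toLp F)) =ᵐ[μ] birkhoffAverage 𝕜 T F n := by
  filter_upwards [Lp.coeFn_smul (n : 𝕜)⁻¹ (birkhoffSum (koopman 𝕜 hT) id n (hF.toLp F)),
    coeFn_birkhoffSum_koopman hT hF n] with x hsmul hsum
  rw [birkhoffAverage, hsmul, Pi.smul_apply, hsum, birkhoffAverage]

theorem invariantProj_comp_ae_eq (hT : MeasurePreserving T μ μ) (hF : MemLp F 2 μ) :
    ⇑(invariantProj hT hF) ∘ T =ᵐ[μ] invariantProj hT hF := by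
  have hmem : invariantProj hT hF ∈ (koopman 𝕜 hT).eqLocus (1 : Lp 𝕜 2 μ →L[𝕜] Lp 𝕜 2 μ) :=
    Submodule.starProjection_apply_mem _ _
  have hfix : Lp.compMeasurePreserving T hT (invariantProj hT hF) = invariantProj hT hF := hmem
  exact (hfix ▸ Lp.coeFn_compMeasurePreserving (invariantProj hT hF) hT).symm

theorem ae_invariantProj_iterate (hT : MeasurePreserving T μ μ) (hF : MemLp F 2 μ) :
    ∀ᵐ x ∂μ, ∀ n, invariantProj hT hF (T^[n] x) = invariantProj hT hF x := by
  refine ae_all_iff.mpr fun n => ?_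
  induction n with
  | zero => exact ae_of_all _ fun x => rfl
  | succ n ih =>
    filter_upwards [hT.quasiMeasurePreserving.ae ih, invariantProj_comp_ae_eq hT hF] with x hn hx
    rw [Function.iterate_succ_apply, hn]
    exact hx

theorem invariantProj_congr_ae (hT : MeasurePreserving T μ μ) (hF : MemLp F 2 μ)
    (hG : MemLp G 2 μ) (h : F =ᵐ[μ] G) : invariantProj hT hF = invariantProj hT hG := by
  rw [invariantProj, invariantProj, (MemLp.toLp_eq_toLp_iff hF hG).mpr h]

variable [IsProbabilityMeasure μ]

theorem integral_norm_le_norm_Lp_two (g : Lp 𝕜 2 μ) : ∫ x, ‖g x‖ ∂μ ≤ ‖g‖ := by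
  rw [integral_norm_eq_lintegral_enorm (Lp.aestronglyMeasurable g), Lp.norm_def,
    ← eLpNorm_one_eq_lintegral_enorm]
  exact ENNReal.toReal_mono (Lp.eLpNorm_ne_top g)
    (eLpNorm_le_eLpNorm_of_exponent_le (by norm_num) (Lp.aestronglyMeasurable g))

theorem tendsto_integral_norm_birkhoffAverage_sub (hT : MeasurePreserving T μ μ)
    (hF : MemLp F 2 μ) :
    Tendsto (fun k : ℕ => ∫ x, ‖birkhoffAverage 𝕜 T F k x - invariantProj hT hF x‖ ∂μ)
      atTop (𝓝 0) := by
  have hmean : Tendsto (fun k => birkhoffAverage 𝕜 (koopman 𝕜 hT) id k (hF.toLp F)) atTop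
      (𝓝 (invariantProj hT hF)) :=
    (koopman 𝕜 hT).tendsto_birkhoffAverage_orthogonalProjection
      (LinearIsometry.norm_toContinuousLinearMap_le _) (hF.toLp F)
  refine squeeze_zero (fun k => integral_nonneg fun x => norm_nonneg _) (fun k => ?_)
    (tendsto_iff_norm_sub_tendsto_zero.mp hmean)
  refine le_of_eq_of_le (integral_congr_ae ?_) (integral_norm_le_norm_Lp_two _)
  filter_upwards [Lp.coeFn_sub (birkhoffAverage 𝕜 (koopman 𝕜 hT) id k (hF.toLp F))
    (invariantProj hT hF), coeFn_birkhoffAverage_koopman hT hF k] with x hsub havg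
  rw [hsub, Pi.sub_apply, havg]

theorem ae_hasMovingMean_invariantProj (hT : MeasurePreserving T μ μ) (hFm : Measurable F)
    (hF : MemLp F 2 μ) :
    ∀ᵐ x ∂μ, HasMovingMean (fun n => F (T^[n] x)) (invariantProj hT hF x) := by
  set r : ℕ → X → ℝ := fun k x => ‖birkhoffAverage 𝕜 T F (k + 1) x - invariantProj hT hF x‖
  have hFi : ∀ i, Integrable (fun x => F (T^[i] x)) μ := fun i =>
    (hT.iterate i).integrable_comp_of_integrable (hF.integrable one_le_two)
  have hrm : ∀ k, Measurable (r k) := fun k =>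
    (Measurable.sub ((Finset.measurable_fun_sum _ fun i _ =>
      hFm.comp (hT.measurable.iterate i)).const_smul ((k + 1 : ℕ) : 𝕜)⁻¹)
      (Lp.stronglyMeasurable (invariantProj hT hF)).measurable).norm
  have hri : ∀ k, Integrable (r k) μ := fun k =>
    (Integrable.sub ((integrable_finsetSum _ fun i _ => hFi i).smul ((k + 1 : ℕ) : 𝕜)⁻¹)
      ((Lp.memLp (invariantProj hT hF)).integrable one_le_two)).norm
  have hlim : Tendsto (fun k => ∫ x, r k x ∂μ) atTop (𝓝 0) :=
    (tendsto_add_atTop_iff_nat 1).mpr (tendsto_integral_norm_birkhoffAverage_sub hT hF)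
  filter_upwards [ae_forall_exists_forall_birkhoffSum_le hT hri hrm (fun k x => norm_nonneg _) hlim,
    ae_invariantProj_iterate hT hF] with x hmax hinv ε hε
  obtain ⟨k, hk⟩ := hmax ε hε
  refine ⟨k + 1, k.succ_pos, fun N => le_of_eq_of_le (Finset.sum_congr rfl fun m _ => ?_) (hk N)⟩
  simp only [r, movingAverage_orbit, hinv m]

end Invariant

/-! ### Averages along a typical selection -/

/-- The embedding of a field of real or complex numbers into the complex numbers. -/
noncomputable def rclikeToComplex (𝕜 : Type*) [RCLike 𝕜] : 𝕜 →+* ℂ where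
  toFun z := ⟨RCLike.re z, RCLike.im z⟩
  map_one' := by apply Complex.ext <;> simp
  map_zero' := by apply Complex.ext <;> simp
  map_mul' z w := by apply Complex.ext <;> simp
  map_add' z w := by apply Complex.ext <;> simp

section Embedding

variable {𝕜 : Type*} [RCLike 𝕜]

theorem norm_rclikeToComplex (z : 𝕜) : ‖rclikeToComplex 𝕜 z‖ = ‖z‖ := by
  rw [← sq_eq_sq₀ (norm_nonneg _) (norm_nonneg _), Complex.sq_norm, Complex.normSq_apply,
    RCLike.norm_sq_eq_def]
  rfl

theorem rclikeToComplex_ofReal (t : ℝ) : rclikeToComplex 𝕜 (t : 𝕜) = (t : ℂ) := by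
  apply Complex.ext <;> simp [rclikeToComplex]

theorem measurable_rclikeToComplex : Measurable (rclikeToComplex 𝕜) :=
  (AddMonoidHomClass.isometry_of_norm (rclikeToComplex 𝕜)
    norm_rclikeToComplex).continuous.measurable

theorem rclikeToComplex_centredTerm {X : Type*} (y : ℕ → ℕ) (p : ℕ → ℝ) (T : X → X)
    (F₁ F₂ : X → 𝕜) (i : ℕ) (x : X) :
    rclikeToComplex 𝕜 (centredTerm y p T F₁ F₂ i x)
      = centredTerm y p T (rclikeToComplex 𝕜 ∘ F₁) (rclikeToComplex 𝕜 ∘ F₂) i x := by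
  simp only [centredTerm, map_mul, rclikeToComplex_ofReal, Function.comp,
    RCLike.ofReal_eq_complex_ofReal]

theorem centredTerm_smul_smul {X : Type*} (y : ℕ → ℕ) (p : ℕ → ℝ) (T : X → X) (a b : 𝕜)
    (F₁ F₂ : X → 𝕜) (i : ℕ) (x : X) :
    centredTerm y p T (a • F₁) (b • F₂) i x = a * b * centredTerm y p T F₁ F₂ i x := by
  simp only [centredTerm, Pi.smul_apply, smul_eq_mul]
  ring

variable {X : Type*} [MeasurableSpace X] {μ : Measure X} [IsProbabilityMeasure μ] {T : X → X}
  {y : ℕ → ℕ} {p : ℕ → ℝ} {δ : ℝ} {F₁ F₂ : X → 𝕜}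

namespace TypicalSelection

theorem ae_isLittleO_sum_centredTerm_of_norm_le_one (hy : TypicalSelection p y)
    (hp : SlowDecay p δ) (hδ : 0 < δ) (hT : MeasurePreserving T μ μ) (h₁ : Measurable F₁)
    (h₂ : Measurable F₂) (hb₁ : ∀ x, ‖F₁ x‖ ≤ 1) (hb₂ : ∀ x, ‖F₂ x‖ ≤ 1) :
    ∀ᵐ x ∂μ, (fun M => ∑ i ∈ Finset.range M, centredTerm y p T F₁ F₂ i x)
      =o[atTop] expCount p := by
  filter_upwards [hy.ae_isLittleO_sum_centredTerm hp hδ hT (measurable_rclikeToComplex.comp h₁)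
    (measurable_rclikeToComplex.comp h₂) (fun x => (norm_rclikeToComplex (F₁ x)).trans_le (hb₁ x))
    (fun x => (norm_rclikeToComplex (F₂ x)).trans_le (hb₂ x))] with x hx
  refine .of_norm_left (hx.norm_left.congr_left fun M => ?_)
  simp only [← rclikeToComplex_centredTerm, ← map_sum, norm_rclikeToComplex]

theorem ae_isLittleO_sum_centredTerm_of_norm_le (hy : TypicalSelection p y) (hp : SlowDecay p δ)
    (hδ : 0 < δ) (hT : MeasurePreserving T μ μ) {C₁ C₂ : ℝ} (hC₁ : 0 < C₁) (hC₂ : 0 < C₂)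
    (h₁ : Measurable F₁) (h₂ : Measurable F₂) (hb₁ : ∀ x, ‖F₁ x‖ ≤ C₁) (hb₂ : ∀ x, ‖F₂ x‖ ≤ C₂) :
    ∀ᵐ x ∂μ, (fun M => ∑ i ∈ Finset.range M, centredTerm y p T F₁ F₂ i x)
      =o[atTop] expCount p := by
  have hscale : ∀ {C : ℝ} {F : X → 𝕜}, 0 < C → (∀ x, ‖F x‖ ≤ C) →
      ∀ x, ‖((C : 𝕜)⁻¹ • F) x‖ ≤ 1 := fun hC hF x => by
    rw [Pi.smul_apply, norm_smul, norm_inv, RCLike.norm_ofReal, abs_of_pos hC, inv_mul_le_one₀ hC]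
    exact hF x
  have hC : (C₁ : 𝕜) * C₂ ≠ 0 := by exact_mod_cast (mul_pos hC₁ hC₂).ne'
  filter_upwards [hy.ae_isLittleO_sum_centredTerm_of_norm_le_one hp hδ hT
    (h₁.const_smul (C₁ : 𝕜)⁻¹) (h₂.const_smul (C₂ : 𝕜)⁻¹) (hscale hC₁ hb₁) (hscale hC₂ hb₂)]
    with x hx
  refine (hx.const_mul_left ((C₁ : 𝕜) * C₂)).congr_left fun M => ?_
  simp only [centredTerm_smul_smul, ← Finset.mul_sum]
  rw [← mul_inv, mul_inv_cancel_left₀ hC]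

end TypicalSelection

end Embedding

theorem selCount_succ (y : ℕ → ℕ) (i : ℕ) : selCount y (i + 1) = selCount y i + y i :=
  Finset.sum_range_succ _ _

theorem selCount_eq_count {y : ℕ → ℕ} (hy : ∀ i, y i = 0 ∨ y i = 1) (M : ℕ) :
    selCount y M = Nat.count (fun i => y i = 1) M := by
  induction M with
  | zero => simp [selCount]
  | succ M ih =>
    rw [selCount_succ, Nat.count_succ, ih]
    rcases hy M with h | h <;> simp [h]

theorem sum_mul_selCount_eq_sum_nth {𝕜 : Type*} [Semiring 𝕜] {y : ℕ → ℕ}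
    (hy : ∀ i, y i = 0 ∨ y i = 1) (g : ℕ → ℕ → 𝕜) (M : ℕ) :
    ∑ i ∈ Finset.range M, (y i : 𝕜) * g (selCount y i) i
      = ∑ n ∈ Finset.range (selCount y M), g n (Nat.nth (fun i => y i = 1) n) := by
  induction M with
  | zero => simp [selCount]
  | succ M ih =>
    rw [Finset.sum_range_succ, ih, selCount_succ]
    rcases hy M with h | h
    · simp [h]
    · rw [h, Finset.sum_range_succ, selCount_eq_count hy M,
        Nat.nth_count (p := fun i => y i = 1) h, Nat.cast_one, one_mul]

theorem norm_mul_selCount_succ_sub_le {𝕜 : Type*} [RCLike 𝕜] {y : ℕ → ℕ} {p : ℕ → ℝ}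
    (hy : ∀ i, y i = 0 ∨ y i = 1) (hp : Antitone p) (hp0 : ∀ i, 0 ≤ p i) {f : ℕ → 𝕜} {C : ℝ}
    (hf : ∀ i, ‖f i‖ ≤ C) (m : ℕ) :
    ‖(p (m + 1) : 𝕜) * f (selCount y (m + 1)) - (p m : 𝕜) * f (selCount y m)‖
      ≤ C * (p m - p (m + 1)) + 2 * C * (y m * p m) := by
  have hdec : 0 ≤ p m - p (m + 1) := sub_nonneg.mpr (hp m.le_succ)
  have hweight : ‖((p m - p (m + 1) : ℝ) : 𝕜) * f (selCount y (m + 1))‖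
      ≤ C * (p m - p (m + 1)) := by
    rw [norm_mul, RCLike.norm_ofReal, abs_of_nonneg hdec, mul_comm]
    exact mul_le_mul_of_nonneg_right (hf _) hdec
  have hvalue : ‖(p m : 𝕜) * (f (selCount y (m + 1)) - f (selCount y m))‖
      ≤ 2 * C * (y m * p m) := by
    rw [norm_mul, RCLike.norm_ofReal, abs_of_nonneg (hp0 m), selCount_succ]
    rcases hy m with h | h
    · simp [h]
    · rw [h, Nat.cast_one, one_mul, two_mul, mul_comm]
      exact mul_le_mul_of_nonneg_right (norm_sub_le_of_le (hf _) (hf _)) (hp0 m)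
  calc _ = ‖(p m : 𝕜) * (f (selCount y (m + 1)) - f (selCount y m))
        - ((p m - p (m + 1) : ℝ) : 𝕜) * f (selCount y (m + 1))‖ := by
        push_cast
        congr 1
        ring
    _ ≤ _ := (norm_sub_le_of_le hvalue hweight).trans_eq (add_comm _ _)

theorem tendsto_inv_mul_sum_of_isLittleO {𝕜 : Type*} [RCLike 𝕜] {a : ℕ → 𝕜} {l : 𝕜}
    (h : (fun N => ∑ n ∈ Finset.range N, (a n - l)) =o[atTop] fun N : ℕ => (N : ℝ)) :
    Tendsto (fun N : ℕ => (N : 𝕜)⁻¹ * ∑ n ∈ Finset.range N, a n) atTop (𝓝 l) := by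
  refine tendsto_iff_norm_sub_tendsto_zero.mpr (h.norm_left.tendsto_div_nhds_zero.congr' ?_)
  filter_upwards [eventually_ne_atTop 0] with N hN
  have hN' : (N : 𝕜) ≠ 0 := Nat.cast_ne_zero.mpr hN
  rw [Finset.sum_sub_distrib, Finset.sum_const, Finset.card_range, nsmul_eq_mul,
    div_eq_inv_mul, ← RCLike.norm_natCast (K := 𝕜), ← norm_inv, ← norm_mul, mul_sub,
    inv_mul_cancel_left₀ hN']

section Pathwise

variable {𝕜 : Type*} [RCLike 𝕜] {y : ℕ → ℕ} {p : ℕ → ℝ} {δ : ℝ}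

namespace TypicalSelection

theorem isEquivalent_selCount (hy : TypicalSelection p y) :
    Asymptotics.IsEquivalent atTop (fun M => (selCount y M : ℝ)) (expCount p) := hy.count

theorem tendsto_natCast_selCount (hy : TypicalSelection p y) (hp : SlowDecay p δ) (hδ : 0 < δ) :
    Tendsto (fun M => (selCount y M : ℝ)) atTop atTop :=
  hy.isEquivalent_selCount.symm.tendsto_atTop (hp.tendsto_expCount hδ)

theorem tendsto_selCount (hy : TypicalSelection p y) (hp : SlowDecay p δ) (hδ : 0 < δ) :
    Tendsto (selCount y) atTop atTop :=
  tendsto_natCast_atTop_iff.mp (hy.tendsto_natCast_selCount hp hδ)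

theorem infinite_setOf_eq_one (hy : TypicalSelection p y) (hp : SlowDecay p δ) (hδ : 0 < δ) :
    {i | y i = 1}.Infinite := by
  intro hfin
  obtain ⟨M, hM⟩ := ((hy.tendsto_selCount hp hδ).eventually_gt_atTop hfin.toFinset.card).exists
  rw [selCount_eq_count hy.zero_or_one, Nat.count_eq_card_filter_range] at hM
  refine absurd hM (not_lt.mpr (Finset.card_le_card fun i hi => ?_))
  exact hfin.mem_toFinset.mpr (Finset.mem_filter.mp hi).2

theorem isLittleO_sum_mul_of_tendsto_zero (hy : TypicalSelection p y) (hp : SlowDecay p δ)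
    (hδ : 0 < δ) {c : ℕ → ℝ} (hc : Tendsto c atTop (𝓝 0)) :
    (fun M => ∑ i ∈ Finset.range M, (y i : ℝ) * c i) =o[atTop] expCount p := by
  have hterm : (fun i => (y i : ℝ) * c i) =o[atTop] fun i => (y i : ℝ) := by
    simpa only [mul_one] using (Asymptotics.isBigO_refl (fun i => (y i : ℝ)) atTop).mul_isLittleO
      ((Asymptotics.isLittleO_one_iff ℝ).mpr hc)
  have hcast : (fun M => ∑ i ∈ Finset.range M, (y i : ℝ)) = fun M => (selCount y M : ℝ) :=
    funext fun M => (Nat.cast_sum _ _).symm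
  have hsum := hterm.sum_range (fun i => Nat.cast_nonneg _)
    (hcast ▸ hy.tendsto_natCast_selCount hp hδ)
  rw [hcast] at hsum
  exact hsum.trans_isBigO hy.isEquivalent_selCount.isBigO

theorem isLittleO_sum_variation (hy : TypicalSelection p y) (hp : SlowDecay p δ) (hδ : 0 < δ)
    (hzero : Tendsto p atTop (𝓝 0)) {f : ℕ → 𝕜} {C : ℝ} (hf : ∀ i, ‖f i‖ ≤ C) :
    (fun M => ∑ m ∈ Finset.range M,
      ‖(p (m + 1) : 𝕜) * f (selCount y (m + 1)) - (p m : 𝕜) * f (selCount y m)‖)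
      =o[atTop] expCount p := by
  have hC : 0 ≤ C := (norm_nonneg _).trans (hf 0)
  have hbound : (fun M => C * p 0 + 2 * C * ∑ i ∈ Finset.range M, (y i : ℝ) * p i)
      =o[atTop] expCount p :=
    (isLittleO_const_sum (hp.tendsto_expCount hδ) _).add
      ((hy.isLittleO_sum_mul_of_tendsto_zero hp hδ hzero).const_mul_left _)
  refine (Asymptotics.isBigO_of_le _ fun M => ?_).trans_isLittleO hbound
  rw [Real.norm_of_nonneg (Finset.sum_nonneg fun _ _ => norm_nonneg _)]
  refine le_trans ?_ (le_abs_self _)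
  calc _ ≤ ∑ m ∈ Finset.range M, (C * (p m - p (m + 1)) + 2 * C * (y m * p m)) :=
        Finset.sum_le_sum fun m _ =>
          norm_mul_selCount_succ_sub_le hy.zero_or_one hp.anti hp.nonneg hf m
    _ = C * (p 0 - p M) + 2 * C * ∑ m ∈ Finset.range M, y m * p m := by
        rw [Finset.sum_add_distrib, ← Finset.mul_sum, ← Finset.mul_sum, Finset.sum_range_sub' p M]
    _ ≤ _ := by
        gcongr
        exact sub_le_self _ (hp.nonneg M)

theorem isLittleO_sum_sub (hy : TypicalSelection p y) :
    (fun M => ∑ i ∈ Finset.range M, (((y i : ℝ) - p i : ℝ) : 𝕜)) =o[atTop] expCount p := by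
  refine .of_norm_left (hy.count.norm_left.congr_left fun M => ?_)
  rw [← RCLike.ofReal_sum, RCLike.norm_ofReal, Finset.sum_sub_distrib, selCount, Nat.cast_sum]
  rfl

variable {f₁ f₂ : ℕ → 𝕜} {l₁ l₂ : 𝕜} {C : ℝ}

theorem isLittleO_sum_selected_sub (hy : TypicalSelection p y) (hp : SlowDecay p δ) (hδ : 0 < δ)
    (hf₁ : ∀ i, ‖f₁ i‖ ≤ C) (hl₁ : HasMovingMean f₁ l₁) :
    (fun M => ∑ i ∈ Finset.range M, (y i : 𝕜) * (f₁ (selCount y i) - l₁))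
      =o[atTop] expCount p := by
  have hunit : (fun M : ℕ => ∑ m ∈ Finset.range M, (f₁ m - l₁)) =o[atTop] fun M => (M : ℝ) := by
    simpa using hl₁.isLittleO_sum_mul_sub (c := fun _ => 1) (w := fun _ => 1) hf₁ antitone_const
      (fun _ => by simp) (by simpa using tendsto_natCast_atTop_atTop) (by simp)
  refine ((hunit.comp_tendsto (hy.tendsto_selCount hp hδ)).trans_isBigO
    hy.isEquivalent_selCount.isBigO).congr_left fun M => ?_
  exact (sum_mul_selCount_eq_sum_nth hy.zero_or_one (fun n _ => f₁ n - l₁) M).symm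

theorem isLittleO_sum_expected_sub (hy : TypicalSelection p y) (hp : SlowDecay p δ) (hδ : 0 < δ)
    (hf₁ : ∀ i, ‖f₁ i‖ ≤ C) (hl₁ : HasMovingMean f₁ l₁)
    (hcent₁ : (fun M => ∑ i ∈ Finset.range M, (((y i : ℝ) - p i : ℝ) : 𝕜) * f₁ (selCount y i))
      =o[atTop] expCount p) :
    (fun M => ∑ i ∈ Finset.range M, (p i : 𝕜) * (f₁ (selCount y i) - l₁))
      =o[atTop] expCount p := by
  refine (((hy.isLittleO_sum_selected_sub hp hδ hf₁ hl₁).sub hcent₁).add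
    (hy.isLittleO_sum_sub.const_mul_left l₁)).congr_left fun M => ?_
  rw [Finset.mul_sum, ← Finset.sum_sub_distrib, ← Finset.sum_add_distrib]
  refine Finset.sum_congr rfl fun i _ => ?_
  push_cast
  ring

theorem isLittleO_sum_expected_mul_sub (hy : TypicalSelection p y) (hp : SlowDecay p δ)
    (hδ : 0 < δ) (hzero : Tendsto p atTop (𝓝 0)) (hC : 0 < C) (hf₁ : ∀ i, ‖f₁ i‖ ≤ C)
    (hf₂ : ∀ i, ‖f₂ i‖ ≤ C) (hl₂ : HasMovingMean f₂ l₂) :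
    (fun M => ∑ i ∈ Finset.range M, ((p i : 𝕜) * f₁ (selCount y i)) * (f₂ i - l₂))
      =o[atTop] expCount p := by
  have hsum : (fun M => ∑ i ∈ Finset.range M, C * p i) = fun M => C * expCount p M :=
    funext fun M => (Finset.mul_sum _ _ _).symm
  have h := hl₂.isLittleO_sum_mul_sub (c := fun i => (p i : 𝕜) * f₁ (selCount y i))
    (w := fun i => C * p i) hf₂ (hp.anti.const_mul hC.le)
    (fun i => by
      rw [norm_mul, RCLike.norm_ofReal, abs_of_pos (hp.pos i), mul_comm]
      exact mul_le_mul_of_nonneg_right (hf₁ _) (hp.nonneg i))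
    (hsum ▸ (hp.tendsto_expCount hδ).const_mul_atTop hC)
    (hsum ▸ (hy.isLittleO_sum_variation hp hδ hzero hf₁).const_mul_right hC.ne')
  rw [hsum] at h
  exact h.of_const_mul_right

theorem isLittleO_sum_selected_mul_sub (hy : TypicalSelection p y) (hp : SlowDecay p δ)
    (hδ : 0 < δ) (hzero : Tendsto p atTop (𝓝 0)) (hC : 0 < C)
    (hf₁ : ∀ i, ‖f₁ i‖ ≤ C) (hf₂ : ∀ i, ‖f₂ i‖ ≤ C)
    (hcent : (fun M => ∑ i ∈ Finset.range M, (((y i : ℝ) - p i : ℝ) : 𝕜) *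
      (f₁ (selCount y i) * f₂ i)) =o[atTop] expCount p)
    (hcent₁ : (fun M => ∑ i ∈ Finset.range M, (((y i : ℝ) - p i : ℝ) : 𝕜) * f₁ (selCount y i))
      =o[atTop] expCount p)
    (hl₁ : HasMovingMean f₁ l₁) (hl₂ : HasMovingMean f₂ l₂) :
    (fun M => ∑ i ∈ Finset.range M, (y i : 𝕜) * (f₁ (selCount y i) * f₂ i - l₁ * l₂))
      =o[atTop] expCount p := by
  refine (((hcent.add (hy.isLittleO_sum_expected_mul_sub hp hδ hzero hC hf₁ hf₂ hl₂)).add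
    ((hy.isLittleO_sum_expected_sub hp hδ hf₁ hl₁ hcent₁).const_mul_left l₂)).sub
    (hy.isLittleO_sum_sub.const_mul_left (l₁ * l₂))).congr_left fun M => ?_
  rw [Finset.mul_sum, Finset.mul_sum, ← Finset.sum_add_distrib, ← Finset.sum_add_distrib,
    ← Finset.sum_sub_distrib]
  refine Finset.sum_congr rfl fun i _ => ?_
  push_cast
  ring

theorem isLittleO_sum_nth (hy : TypicalSelection p y) (hp : SlowDecay p δ) (hδ : 0 < δ)
    {g : ℕ → ℕ → 𝕜}
    (h : (fun M => ∑ i ∈ Finset.range M, (y i : 𝕜) * g (selCount y i) i) =o[atTop] expCount p) :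
    (fun N : ℕ => ∑ n ∈ Finset.range N, g n (Nat.nth (fun i => y i = 1) n))
      =o[atTop] fun N => (N : ℝ) := by
  have hinf := hy.infinite_setOf_eq_one hp hδ
  have hnth : ∀ N, selCount y (Nat.nth (fun i => y i = 1) N) = N := fun N => by
    rw [selCount_eq_count hy.zero_or_one, Nat.count_nth_of_infinite hinf]
  refine ((h.trans_isBigO hy.isEquivalent_selCount.symm.isBigO).comp_tendsto
    (Nat.nth_strictMono hinf).tendsto_atTop).congr (fun N => ?_) fun N => ?_
  · rw [Function.comp, sum_mul_selCount_eq_sum_nth hy.zero_or_one, hnth]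
  · rw [Function.comp, hnth]

theorem tendsto_average (hy : TypicalSelection p y) (hp : SlowDecay p δ) (hδ : 0 < δ)
    (hzero : Tendsto p atTop (𝓝 0)) (hC : 0 < C)
    (hf₁ : ∀ i, ‖f₁ i‖ ≤ C) (hf₂ : ∀ i, ‖f₂ i‖ ≤ C)
    (hcent : (fun M => ∑ i ∈ Finset.range M, (((y i : ℝ) - p i : ℝ) : 𝕜) *
      (f₁ (selCount y i) * f₂ i)) =o[atTop] expCount p)
    (hcent₁ : (fun M => ∑ i ∈ Finset.range M, (((y i : ℝ) - p i : ℝ) : 𝕜) * f₁ (selCount y i))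
      =o[atTop] expCount p)
    (hl₁ : HasMovingMean f₁ l₁) (hl₂ : HasMovingMean f₂ l₂) :
    Tendsto (fun N : ℕ => (N : 𝕜)⁻¹ * ∑ n ∈ Finset.range N,
      f₁ n * f₂ (Nat.nth (fun i => y i = 1) n)) atTop (𝓝 (l₁ * l₂)) :=
  tendsto_inv_mul_sum_of_isLittleO (hy.isLittleO_sum_nth hp hδ
    (g := fun n i => f₁ n * f₂ i - l₁ * l₂)
    (hy.isLittleO_sum_selected_mul_sub hp hδ hzero hC hf₁ hf₂ hcent hcent₁ hl₁ hl₂))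

end TypicalSelection

end Pathwise

theorem exists_measurable_norm_le_ae_eq {𝕜 : Type*} [RCLike 𝕜] {X : Type*} [MeasurableSpace X]
    {μ : Measure X} {F : X → 𝕜} (hF : MemLp F ⊤ μ) :
    ∃ G : X → 𝕜, ∃ C : ℝ, Measurable G ∧ (∀ x, ‖G x‖ ≤ C) ∧ F =ᵐ[μ] G := by
  set G₀ := hF.1.mk F
  have hG₀ : Measurable G₀ := hF.1.stronglyMeasurable_mk.measurable
  refine ⟨fun x => if ‖G₀ x‖ ≤ lpNorm F ⊤ μ then G₀ x else 0, lpNorm F ⊤ μ,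
    Measurable.ite (measurableSet_le hG₀.norm measurable_const) hG₀ measurable_const,
    fun x => ?_, ?_⟩
  · beta_reduce
    split_ifs with h
    · exact h
    · exact norm_zero.trans_le lpNorm_nonneg
  · filter_upwards [hF.1.ae_eq_mk, ae_le_lpNorm_exponent_top hF] with x hx hle
    rw [if_pos (by rwa [hx] at hle), hx]

namespace TypicalSelection

variable {𝕜 : Type*} [RCLike 𝕜] {y : ℕ → ℕ} {p : ℕ → ℝ} {δ : ℝ} {X : Type*} [MeasurableSpace X]
  {μ : Measure X} [IsProbabilityMeasure μ] {T : X → X} {F₁ F₂ : X → 𝕜}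

theorem ae_tendsto_average (hy : TypicalSelection p y) (hp : SlowDecay p δ) (hδ : 0 < δ)
    (hzero : Tendsto p atTop (𝓝 0)) (hT : MeasurePreserving T μ μ) {C : ℝ} (hC : 0 < C)
    (h₁ : Measurable F₁) (h₂ : Measurable F₂) (hb₁ : ∀ x, ‖F₁ x‖ ≤ C) (hb₂ : ∀ x, ‖F₂ x‖ ≤ C)
    (hF₁ : MemLp F₁ 2 μ) (hF₂ : MemLp F₂ 2 μ) :
    ∀ᵐ x ∂μ, Tendsto (fun N : ℕ => (N : 𝕜)⁻¹ * ∑ n ∈ Finset.range N,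
      F₁ (T^[n] x) * F₂ (T^[Nat.nth (fun i => y i = 1) n] x)) atTop
      (𝓝 (invariantProj hT hF₁ x * invariantProj hT hF₂ x)) := by
  filter_upwards [hy.ae_isLittleO_sum_centredTerm_of_norm_le hp hδ hT hC hC h₁ h₂ hb₁ hb₂,
    hy.ae_isLittleO_sum_centredTerm_of_norm_le hp hδ hT hC one_pos h₁
      (measurable_const (a := (1 : 𝕜))) hb₁ fun _ => norm_one.le,
    ae_hasMovingMean_invariantProj hT h₁ hF₁, ae_hasMovingMean_invariantProj hT h₂ hF₂]
    with x hcent hcent₁ hl₁ hl₂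
  simp only [centredTerm, mul_one] at hcent hcent₁
  exact hy.tendsto_average hp hδ hzero (f₁ := fun n => F₁ (T^[n] x)) (f₂ := fun n => F₂ (T^[n] x))
    hC (fun _ => hb₁ _) (fun _ => hb₂ _) hcent hcent₁ hl₁ hl₂

theorem ae_tendsto_average_of_memLp_top (hy : TypicalSelection p y) (hp : SlowDecay p δ)
    (hδ : 0 < δ) (hzero : Tendsto p atTop (𝓝 0)) (hT : MeasurePreserving T μ μ)
    (hF₁ : MemLp F₁ ⊤ μ) (hF₂ : MemLp F₂ ⊤ μ) :
    ∀ᵐ x ∂μ, Tendsto (fun N : ℕ => (N : 𝕜)⁻¹ * ∑ n ∈ Finset.range N,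
      F₁ (T^[n] x) * F₂ (T^[Nat.nth (fun i => y i = 1) n] x)) atTop
      (𝓝 (invariantProj hT (hF₁.mono_exponent le_top) x *
        invariantProj hT (hF₂.mono_exponent le_top) x)) := by
  obtain ⟨G₁, C₁, hm₁, hb₁, he₁⟩ := exists_measurable_norm_le_ae_eq hF₁
  obtain ⟨G₂, C₂, hm₂, hb₂, he₂⟩ := exists_measurable_norm_le_ae_eq hF₂
  have hF₁' : MemLp F₁ 2 μ := hF₁.mono_exponent le_top
  have hF₂' : MemLp F₂ 2 μ := hF₂.mono_exponent le_top
  have hG₁ : MemLp G₁ 2 μ := (memLp_congr_ae he₁).mp hF₁'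
  have hG₂ : MemLp G₂ 2 μ := (memLp_congr_ae he₂).mp hF₂'
  have hC : 0 < max 1 (max C₁ C₂) := lt_max_of_lt_left one_pos
  filter_upwards [hy.ae_tendsto_average hp hδ hzero hT hC hm₁ hm₂
    (fun x => (hb₁ x).trans ((le_max_left _ _).trans (le_max_right _ _)))
    (fun x => (hb₂ x).trans ((le_max_right _ _).trans (le_max_right _ _))) hG₁ hG₂,
    ae_iterate_eq_of_ae_eq hT he₁, ae_iterate_eq_of_ae_eq hT he₂] with x hx horb₁ horb₂
  rw [invariantProj_congr_ae hT hF₁' hG₁ he₁, invariantProj_congr_ae hT hF₂' hG₂ he₂]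
  simpa only [horb₁, horb₂] using hx

end TypicalSelection

/-! ### From indices `0, 1, 2, …` to indices `1, 2, 3, …` -/

theorem nth_one_le_and_pred {Q : ℕ → Prop} (hQ : {i | Q i}.Infinite) (n : ℕ) :
    Nat.nth (fun m => 1 ≤ m ∧ Q (m - 1)) n = Nat.nth Q n + 1 := by
  classical
  set R : ℕ → Prop := fun m => 1 ≤ m ∧ Q (m - 1)
  have hcount : Nat.count R (Nat.nth Q n + 1) = n := by
    have hR : (fun k => R (k + 1)) = Q := by
      funext k
      simp [R]
    rw [Nat.count_succ', if_neg (by simp [R]), add_zero]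
    simp only [hR]
    convert Nat.count_nth_of_infinite hQ n
  have hmem : R (Nat.nth Q n + 1) := ⟨Nat.succ_pos _, Nat.nth_mem_of_infinite hQ n⟩
  have hnth := Nat.nth_count hmem
  rwa [hcount] at hnth

theorem tendsto_average_Ico_one {𝕜 : Type*} [RCLike 𝕜] {g : ℕ → 𝕜} {l : 𝕜}
    (h : Tendsto (fun N : ℕ => (N : 𝕜)⁻¹ * ∑ n ∈ Finset.range N, g n) atTop (𝓝 l)) :
    Tendsto (fun N : ℕ => (N : 𝕜)⁻¹ * ∑ n ∈ Finset.Ico 1 N, g (n - 1)) atTop (𝓝 l) := by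
  rw [← tendsto_add_atTop_iff_nat 1]
  have hmul := (tendsto_natCast_div_add_atTop (1 : 𝕜)).mul h
  rw [one_mul] at hmul
  refine hmul.congr' ?_
  filter_upwards [eventually_ne_atTop 0] with N hN
  have hN' : (N : 𝕜) ≠ 0 := Nat.cast_ne_zero.mpr hN
  rw [Finset.sum_Ico_eq_sum_range]
  simp only [Nat.add_sub_cancel_left, Nat.add_sub_cancel, Nat.cast_add, Nat.cast_one]
  field_simp

theorem TypicalSelection.ae_tendsto_average_Ico_one {𝕜 : Type*} [RCLike 𝕜] {y : ℕ → ℕ} {p : ℕ → ℝ}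
    {δ : ℝ} {X : Type*} [MeasurableSpace X] {μ : Measure X} [IsProbabilityMeasure μ] {T : X → X}
    {F₁ F₂ : X → 𝕜} (hy : TypicalSelection p y) (hp : SlowDecay p δ) (hδ : 0 < δ)
    (hzero : Tendsto p atTop (𝓝 0)) (hT : MeasurePreserving T μ μ)
    (hF₁ : MemLp F₁ ⊤ μ) (hF₂ : MemLp F₂ ⊤ μ) :
    ∀ᵐ x ∂μ, Tendsto (fun N : ℕ => (N : 𝕜)⁻¹ * ∑ n ∈ Finset.Ico 1 N,
      F₁ (T^[n] x) * F₂ (T^[Nat.nth (fun i => y i = 1) (n - 1) + 1] x)) atTop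
      (𝓝 (invariantProj hT (hF₁.mono_exponent le_top) x *
        invariantProj hT (hF₂.mono_exponent le_top) x)) := by
  filter_upwards [hT.quasiMeasurePreserving.ae
    (hy.ae_tendsto_average_of_memLp_top hp hδ hzero hT hF₁ hF₂),
    ae_invariantProj_iterate hT (hF₁.mono_exponent le_top),
    ae_invariantProj_iterate hT (hF₂.mono_exponent le_top)] with x hx hinv₁ hinv₂
  rw [← hinv₁ 1, ← hinv₂ 1]
  refine (tendsto_average_Ico_one hx).congr fun N => ?_
  congr 1
  refine Finset.sum_congr rfl fun n hn => ?_
  simp only [← Function.iterate_succ_apply, Nat.succ_eq_add_one,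
    Nat.sub_add_cancel (Finset.mem_Ico.mp hn).1]

theorem slowDecay_succ {u : ℕ → ℝ} {δ : ℝ} (hu01 : ∀ n, 1 ≤ n → u n ∈ Set.Icc (0 : ℝ) 1)
    (hu_anti : AntitoneOn u (Set.Ici 1))
    (hu_slow : Tendsto (fun n : ℕ => u n * ((n : ℝ) ^ (1 / 2 : ℝ) / (Real.log n) ^ (3 + δ)))
      atTop atTop) : SlowDecay (fun i => u (i + 1)) δ := by
  have hanti : Antitone fun i => u (i + 1) := fun i j h =>
    hu_anti (Set.mem_Ici.mpr i.succ_pos) (Set.mem_Ici.mpr j.succ_pos) (Nat.succ_le_succ h)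
  have hslow := (tendsto_add_atTop_iff_nat 1).mpr hu_slow
  refine ⟨hanti, fun i => ?_, fun i => (hu01 _ i.succ_pos).2, ?_⟩
  · obtain ⟨j, hpos, hij⟩ := ((hslow.eventually_gt_atTop 0).and (eventually_ge_atTop i)).exists
    have hne : u (j + 1) ≠ 0 := fun h => (by rw [h, zero_mul] : _ = (0 : ℝ)).not_gt hpos
    exact ((hu01 _ j.succ_pos).1.lt_of_ne' hne).trans_le (hanti hij)
  · simpa only [Real.sqrt_eq_rpow, Nat.cast_add, Nat.cast_one] using hslow

section SelectedSet

variable {Ω : Type*} {U : ℕ → Ω → ℕ} {ω : Ω}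

theorem infinite_selectedSet (h : {i | U (i + 1) ω = 1}.Infinite) : (selectedSet U ω).Infinite := by
  refine (h.image Nat.succ_injective.injOn).mono ?_
  rintro _ ⟨i, hi, rfl⟩
  exact ⟨i.succ_pos, hi⟩

theorem selectedSeq_eq_nth_add_one (h : {i | U (i + 1) ω = 1}.Infinite) (n : ℕ) :
    selectedSeq U ω n = Nat.nth (fun i => U (i + 1) ω = 1) (n - 1) + 1 := by
  rw [← nth_one_le_and_pred h, selectedSeq]
  congr 1
  funext m
  refine propext (and_congr_right fun hm => ?_)
  rw [Nat.sub_add_cancel hm]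

end SelectedSet

theorem theoremC {𝕜 : Type*} [RCLike 𝕜]
    -- the non-increasing sequence of probabilities `u 1 ≥ u 2 ≥ …` (`u 0` plays no role)
    (u : ℕ → ℝ)
    (hu01 : ∀ n, 1 ≤ n → u n ∈ Set.Icc (0 : ℝ) 1)
    (hu_anti : AntitoneOn u (Set.Ici 1))
    (δ : ℝ) (hδ : 0 < δ)
    (hu_slow : Tendsto
      (fun n : ℕ => u n * ((n : ℝ) ^ (1 / 2 : ℝ) / (Real.log n) ^ (3 + δ))) atTop atTop)
    (hu_zero : Tendsto u atTop (𝓝 0))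
    -- independent selectors `U 1, U 2, …` (`U 0` plays no role)
    {Ω : Type*} [MeasurableSpace Ω] (P : Measure Ω) [IsProbabilityMeasure P]
    (U : ℕ → Ω → ℕ)
    (hU_meas : ∀ n, 1 ≤ n → Measurable (U n))
    (hU01 : ∀ n, 1 ≤ n → ∀ ω, U n ω = 0 ∨ U n ω = 1)
    (hU_prob : ∀ n, 1 ≤ n → P {ω | U n ω = 1} = ENNReal.ofReal (u n))
    (hU_indep : ProbabilityTheory.iIndepFun (fun n : ℕ => U (n + 1)) P) :
    ∀ᵐ ω ∂P, (selectedSet U ω).Infinite ∧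
      ∀ (X : Type*) [MeasurableSpace X] (μ : Measure X) [IsProbabilityMeasure μ]
        (T : X → X) (hT : MeasurePreserving T μ μ)
        (F₁ F₂ : X → 𝕜) (hF₁ : MemLp F₁ ⊤ μ) (hF₂ : MemLp F₂ ⊤ μ),
        ∀ᵐ x ∂μ, Tendsto
          (fun N : ℕ => (N : 𝕜)⁻¹ *
            ∑ n ∈ Finset.Ico 1 N, F₁ (T^[n] x) * F₂ (T^[selectedSeq U ω n] x))
          atTop
          (𝓝 (invariantProj hT (hF₁.mono_exponent le_top) x *
            invariantProj hT (hF₂.mono_exponent le_top) x)) := by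
  have hp : SlowDecay (fun i => u (i + 1)) δ := slowDecay_succ hu01 hu_anti hu_slow
  have hzero : Tendsto (fun i => u (i + 1)) atTop (𝓝 0) := (tendsto_add_atTop_iff_nat 1).mpr hu_zero
  have hY : IsSelector P (fun i => U (i + 1)) fun i => u (i + 1) :=
    ⟨fun i => hU_meas _ i.succ_pos, fun i => hU01 _ i.succ_pos, hp.nonneg,
      fun i => hU_prob _ i.succ_pos, hU_indep⟩
  filter_upwards [hY.ae_typicalSelection hp hδ] with ω hω
  have hinf : {i | U (i + 1) ω = 1}.Infinite := hω.infinite_setOf_eq_one hp hδ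
  refine ⟨infinite_selectedSet hinf, fun X _ μ _ T hT F₁ F₂ hF₁ hF₂ => ?_⟩
  simp only [selectedSeq_eq_nth_add_one hinf]
  exact hω.ae_tendsto_average_Ico_one hp hδ hzero hT hF₁ hF₂
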